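/- Let $\mathfrak g$ be a finite-dimensional complex semisimple Lie algebra with Cartan subalgebra $\mathfrak h$, a choice of simple roots, and the triangular decomposition $\mathfrak g=\mathfrak n_-\oplus\mathfrak h\oplus\mathfrak n_+$. Let $S,\varepsilon$ be the antipode and counit of $U\mathfrak g$, and $Q_+$ the set of nonzero sums of simple roots. Let $F\subset(U\mathfrak g)^*$ be the algebra of matrix elements of all finite-dimensional representations of $\mathfrak g$, with multiplication $\mu$ and the action $(\overrightarrow a f)(x)=f(xa)$ of $U\mathfrak g$; let $F[0]$ be its zero weight space, and for $P\subset U\mathfrak g$ put $F[0]^P=\{f\in F[0]:\overrightarrow af=\varepsilon(a)f\ \forall a\in P\}$. For $\lambda\in\mathfrak h^*$ let $\pi_\lambda:U\mathfrak n_+\otimes U\mathfrak n_-\to\mathbb C$, $\pi_\lambda(x\otimes y)=(S(x)y)_0(\lambda)$, where $x\mapsto(x)_0$ is the projection $U\mathfrak g\to U\mathfrak h$ along $\mathfrak n_-U\mathfrak g+U\mathfrak g\,\mathfrak n_+$; let $K_\lambda\subset U\mathfrak n_-$ and $\widetilde K_\lambda\subset U\mathfrak n_+$ be the kernels of $\pi_\lambda$.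 Let $M(\lambda)$ be the Verma module with highest weight $\lambda$ and $V(\lambda)$ its irreducible quotient, with highest weight vector $\overline{\mathbf 1}_\lambda$. Put $$J_{\mathrm{red}}(\lambda)=1\otimes1+\sum_{\beta\in Q_+}\sum_{i,j}\big(G_\lambda^{\beta}\big)^{-1}_{ij}\,x^i_\beta\otimes z^j_\beta ,\qquad (G_\lambda^\beta)_{ij}=\pi_\lambda(z_\beta^i\otimes x_\beta^j),$$ where $x^i_\beta\in U\mathfrak n_-[-\beta]$ is a basis modulo $K_\lambda$ (so that the $x^i_\beta\overline{\mathbf 1}_\lambda$ form a basis of $V(\lambda)[\lambda-\beta]$) and $z^j_\beta\in U\mathfrak n_+[\beta]$ is a basis modulo $\widetilde K_\lambda$. (For $z^j_\beta=\omega(S(x^j_\beta))$, with $\omega$ the Chevalley involution, $G_\lambda^\beta$ is the matrix of the Shapovalov form on $V(\lambda)[\lambda-\beta]$.) Call $\lambda$ generic if $M(\lambda)$ is irreducible; then $J(\lambda)=J_{\mathrm{red}}(\lambda)$ is the fusion element. Limits $\lambda\to\lambda_0$ are taken over generic $\lambda$, inside a finite-dimensional subspace of $F\otimes F$, respectively of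 $F$. Define $\Theta:\mathrm{Hom}_{\mathfrak g}(V(\lambda),V(\lambda)\otimes F)\to F[0]$, $\varphi\mapsto f_\varphi$, by $\varphi(\overline{\mathbf 1}_\lambda)=\overline{\mathbf 1}_\lambda\otimes f_\varphi+(\text{terms of lower weight in }V(\lambda))$. It is injective with image $F[0]^{K_\lambda+\widetilde K_\lambda}$, and $\star_\lambda$ denotes the product on this image that corresponds to the product $\varphi*\psi=(\mathrm{id}\otimes\mu)(\varphi\otimes\mathrm{id})\psi$. Say that $\lambda_0\in\mathfrak h^*$ has the good regularity property if for every $\mathfrak n_-$-module $M$ the family of operators $J(\lambda)^M:M\otimes F[0]^{\widetilde K_{\lambda_0}}\to M\otimes F$ given by the action of $J(\lambda)$ ($\lambda$ generic) is regular at $\lambda_0$: near $\lambda_0$, the image of each vector is a combination of finitely many fixed vectors with coefficients holomorphic at $\lambda_0$. **Theorem.** Suppose that $\lambda_0\in\mathfrak h^*$ has the good regularity property. Then for all $f\in F[0]^{K_{\lambda_0}}$ and $g\in F[0]^{\widetilde K_{\lambda_0}}$, $$\overrightarrow{J(\lambda)}(f\otimes g)\longrightarrow\overrightarrow{J_{\mathrm{red}}(\lambda_0)}(f\otimes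 g)\qquad(\lambda\to\lambda_0).$$ Consequently, for all $f_1,f_2\in F[0]^{K_{\lambda_0}+\widetilde K_{\lambda_0}}$, $f_1\star_\lambda f_2\to f_1\star_{\lambda_0}f_2$ as $\lambda\to\lambda_0$. -/

import Mathlib

open scoped TensorProduct

universe u

noncomputable section

namespace EqQuant

open Module LieAlgebra

attribute [local instance 100] LieRing.ofAssociativeRing

/-! ### The Hopf algebra structure of the universal enveloping algebra -/

section Hopf

variable (L : Type u) [LieRing L] [LieAlgebra ℂ L]

/-- The universal enveloping algebra. -/
abbrev U : Type u := UniversalEnvelopingAlgebra ℂ L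

variable {L}

/-- The canonical map from a Lie algebra to its enveloping algebra. -/
abbrev gen (x : L) : U L := UniversalEnvelopingAlgebra.ι ℂ x

variable (L)

/-- The antipode as an algebra morphism to the opposite algebra, `x ↦ -x` on `L`. -/
def antipodeOp : U L →ₐ[ℂ] (U L)ᵐᵒᵖ :=
  UniversalEnvelopingAlgebra.lift ℂ
    { toFun := fun x => MulOpposite.op (-gen x)
      map_add' := by intro x y; simp only [gen, map_add, neg_add, MulOpposite.op_add]
      map_smul' := by intro c x; simp
      map_lie' := by
        intro x y
        simp only [gen, LieHom.map_lie, LieRing.of_associative_ring_bracket, ← MulOpposite.op_mul,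
          ← MulOpposite.op_sub]
        congr 1
        noncomm_ring }

/-- The antipode `S`. -/
def antipode : U L →ₗ[ℂ] U L :=
  (MulOpposite.opLinearEquiv ℂ).symm.toLinearMap ∘ₗ (antipodeOp L).toLinearMap

/-- The counit `ε`, zero on `L`. -/
def counit : U L →ₐ[ℂ] ℂ := UniversalEnvelopingAlgebra.lift ℂ 0

/-- The comultiplication `Δ`, `x ↦ x ⊗ 1 + 1 ⊗ x` on `L`. -/
def comul : U L →ₐ[ℂ] U L ⊗[ℂ] U L :=
  UniversalEnvelopingAlgebra.lift ℂ
    { toFun := fun x => gen x ⊗ₜ[ℂ] 1 + 1 ⊗ₜ[ℂ] gen x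
      map_add' := by
        intro x y
        simp only [gen, map_add, TensorProduct.add_tmul, TensorProduct.tmul_add]
        abel
      map_smul' := by
        intro c x
        simp [gen, TensorProduct.smul_tmul', TensorProduct.tmul_smul]
      map_lie' := by
        intro x y
        simp only [gen, LieHom.map_lie, LieRing.of_associative_ring_bracket, mul_add, add_mul,
          Algebra.TensorProduct.tmul_mul_tmul, one_mul, mul_one, TensorProduct.sub_tmul,
          TensorProduct.tmul_sub]
        abel }

variable {L}

/-- The algebra morphism `U 𝔰 → U L` induced by the inclusion of a subalgebra `𝔰`. -/
def emb (s : LieSubalgebra ℂ L) : U s →ₐ[ℂ] U L :=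
  UniversalEnvelopingAlgebra.lift ℂ ((UniversalEnvelopingAlgebra.ι ℂ).comp s.incl)

/-! ### The algebra `F` of matrix elements -/

variable (L)

/-- `F`: the span of all matrix elements of all finite-dimensional representations of `U L`,
inside the dual of `U L`. -/
def matElts : Submodule ℂ (Dual ℂ (U L)) :=
  Submodule.span ℂ {f | ∃ (n : Type) (_ : Fintype n) (_ : DecidableEq n)
    (r : U L →ₐ[ℂ] Matrix n n ℂ) (i j : n), ∀ x, f x = r x i j}

/-- The multiplication of linear forms on `U L` dual to the comultiplication:
`(f g)(x) = (f ⊗ g)(Δ x)`. -/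
def convMul : Dual ℂ (U L) ⊗[ℂ] Dual ℂ (U L) →ₗ[ℂ] Dual ℂ (U L) :=
  LinearMap.lcomp ℂ ℂ (comul L).toLinearMap ∘ₗ TensorProduct.dualDistrib ℂ (U L) (U L)

theorem convMul_mem (f g : Dual ℂ (U L)) (hf : f ∈ matElts L) (hg : g ∈ matElts L) :
    convMul L (f ⊗ₜ g) ∈ matElts L := by
  induction hf using Submodule.span_induction with
  | zero => simp
  | add x y _ _ hx hy => rw [TensorProduct.add_tmul, map_add]; exact add_mem hx hy
  | smul c x _ hx =>
    rw [← TensorProduct.smul_tmul', map_smul]; exact Submodule.smul_mem _ _ hx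
  | mem f hf =>
    induction hg using Submodule.span_induction with
    | zero => simp
    | add x y _ _ hx hy => rw [TensorProduct.tmul_add, map_add]; exact add_mem hx hy
    | smul c x _ hx => rw [TensorProduct.tmul_smul, map_smul]; exact Submodule.smul_mem _ _ hx
    | mem g hg =>
      obtain ⟨n, _, _, r, i, j, hr⟩ := hf
      obtain ⟨m, _, _, s, k, l, hs⟩ := hg
      refine Submodule.subset_span ⟨n × m, inferInstance, inferInstance,
        ((Matrix.kroneckerAlgEquiv n m ℂ).toAlgHom.comp
          (Algebra.TensorProduct.map r s)).comp (comul L), (i, k), (j, l), fun x => ?_⟩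
      simp only [convMul, LinearMap.comp_apply, LinearMap.lcomp_apply, AlgHom.comp_apply,
        AlgHom.toLinearMap_apply]
      induction comul L x using TensorProduct.induction_on with
      | zero => simp
      | add a b ha hb => simp only [map_add, ha, hb, Matrix.add_apply]
      | tmul a b => simp [hr, hs]

/-- The multiplication `μ` of `F`. -/
def mulF : matElts L ⊗[ℂ] matElts L →ₗ[ℂ] matElts L :=
  LinearMap.codRestrict (matElts L)
    (convMul L ∘ₗ TensorProduct.map (matElts L).subtype (matElts L).subtype) (by
      intro t
      induction t using TensorProduct.induction_on with
      | zero => simp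
      | add a b ha hb => rw [map_add]; exact add_mem ha hb
      | tmul f g => exact convMul_mem L f g f.2 g.2)

theorem reg_mem (a : U L) (f : Dual ℂ (U L)) (hf : f ∈ matElts L) :
    f ∘ₗ LinearMap.mulRight ℂ a ∈ matElts L := by
  induction hf using Submodule.span_induction with
  | zero => simp
  | add x y _ _ hx hy => rw [LinearMap.add_comp]; exact add_mem hx hy
  | smul c x _ hx => rw [LinearMap.smul_comp]; exact Submodule.smul_mem _ _ hx
  | mem f hf =>
    obtain ⟨n, hn, hd, r, i, j, hr⟩ := hf
    have : f ∘ₗ LinearMap.mulRight ℂ a =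
        ∑ k, r a k j • (Matrix.entryLinearMap ℂ ℂ i k ∘ₗ r.toLinearMap) := by
      ext x
      simp [hr, Matrix.mul_apply, LinearMap.sum_apply, mul_comm]
    rw [this]
    exact Submodule.sum_mem _ fun k _ => Submodule.smul_mem _ _
      (Submodule.subset_span ⟨n, hn, hd, r, i, k, fun x => rfl⟩)

/-- The left regular action of `U L` on `F`: `(a f)(x) = f (x a)`. -/
def regAct : U L →ₐ[ℂ] End ℂ (matElts L) where
  toFun a :=
    { toFun := fun f => ⟨(f : Dual ℂ (U L)) ∘ₗ LinearMap.mulRight ℂ a, reg_mem L a f f.2⟩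
      map_add' := fun _ _ => rfl
      map_smul' := fun _ _ => rfl }
  map_one' := by ext; simp
  map_mul' a c := by ext; simp [mul_assoc]
  map_zero' := by ext; simp
  map_add' a c := by ext; simp [mul_add]
  commutes' c := by ext; simp [Algebra.algebraMap_eq_smul_one]

end Hopf

/-! ### Triangular decomposition, Verma modules and the Shapovalov pairing -/

section Main

variable {L : Type u} [LieRing L] [LieAlgebra ℂ L] [FiniteDimensional ℂ L]
  [LieAlgebra.IsKilling ℂ L] {H : LieSubalgebra ℂ L} [H.IsCartanSubalgebra]
  (b : (IsKilling.rootSystem H).Base)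

/-- `Q₊`: the nonzero sums of simple roots. -/
def Qplus : Set (Dual ℂ H) :=
  {β | β ≠ 0 ∧ β ∈ AddSubmonoid.closure ((IsKilling.rootSystem H).root '' b.support)}

/-- `𝔫₊`, generated by the root spaces of the positive roots (the roots lying in `Q₊`). -/
def nPlus : LieSubalgebra ℂ L :=
  LieSubalgebra.lieSpan ℂ L
    {e | ∃ α : H.root, (IsKilling.rootSystem H).root α ∈ Qplus b ∧
      e ∈ rootSpace H ((IsKilling.rootSystem H).root α)}

/-- `𝔫₋`, generated by the root spaces of the negative roots. -/
def nMinus : LieSubalgebra ℂ L :=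
  LieSubalgebra.lieSpan ℂ L
    {e | ∃ α : H.root, -(IsKilling.rootSystem H).root α ∈ Qplus b ∧
      e ∈ rootSpace H ((IsKilling.rootSystem H).root α)}

/-- For a subalgebra `𝔫` spanned by root vectors, the weight space `(U 𝔫)[μ]`: the span of the
products of root vectors of `𝔫` whose roots add up to `μ`. -/
def wtSpace (n : LieSubalgebra ℂ L) (μ : Dual ℂ H) : Submodule ℂ (U n) :=
  Submodule.span ℂ {y | ∃ l : List (Dual ℂ H × n),
    (∀ p ∈ l, (p.2 : L) ∈ rootSpace H p.1) ∧ (l.map Prod.fst).sum = μ ∧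
      y = (l.map fun p => gen p.2).prod}

/-- `p : U L → U 𝔥` is the projection onto `U 𝔥` along `𝔫₋ · U L + U L · 𝔫₊`. -/
def IsHCProj (p : U L →ₗ[ℂ] U H) : Prop :=
  (∀ u : U H, p (emb H u) = u) ∧ (∀ y ∈ nMinus b, ∀ u : U L, p (gen y * u) = 0) ∧
    ∀ e ∈ nPlus b, ∀ u : U L, p (u * gen e) = 0

open Classical in
/-- The projection `x ↦ (x)₀` (it exists by the Poincaré-Birkhoff-Witt theorem and is unique). -/
def hcProj : U L →ₗ[ℂ] U H := if h : ∃ p, IsHCProj b p then h.choose else 0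

/-- Evaluation of an element of `U 𝔥` (a polynomial on `𝔥*`) at `λ ∈ 𝔥*`. -/
def evalAt (lam : Dual ℂ H) : U H →ₐ[ℂ] ℂ :=
  UniversalEnvelopingAlgebra.lift ℂ
    { lam with
      map_lie' := by
        intro x y
        simp [LieRing.of_associative_ring_bracket, mul_comm, trivial_lie_zero H H x y] }

/-- The pairing `π_λ : U 𝔫₊ ⊗ U 𝔫₋ → ℂ`, `π_λ(x ⊗ y) = (S(x) y)₀(λ)`. -/
def shapPairing (lam : Dual ℂ H) : U (nPlus b) →ₗ[ℂ] U (nMinus b) →ₗ[ℂ] ℂ :=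
  ((LinearMap.mul ℂ (U L)).compl₁₂ (antipode L ∘ₗ (emb (nPlus b)).toLinearMap)
    (emb (nMinus b)).toLinearMap).compr₂ ((evalAt lam).toLinearMap ∘ₗ hcProj b)

/-- `K_λ ⊆ U 𝔫₋`, the right kernel of `π_λ`. -/
def K (lam : Dual ℂ H) : Submodule ℂ (U (nMinus b)) := LinearMap.ker (shapPairing b lam).flip

/-- `K̃_λ ⊆ U 𝔫₊`, the left kernel of `π_λ`. -/
def Ktilde (lam : Dual ℂ H) : Submodule ℂ (U (nPlus b)) := LinearMap.ker (shapPairing b lam)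

/-- `K_λ` as a subspace of `U L`. -/
def KinU (lam : Dual ℂ H) : Submodule ℂ (U L) := (K b lam).map (emb (nMinus b)).toLinearMap

/-- `K̃_λ` as a subspace of `U L`. -/
def KtildeInU (lam : Dual ℂ H) : Submodule ℂ (U L) :=
  (Ktilde b lam).map (emb (nPlus b)).toLinearMap

/-- `F[0]^P`: the `f ∈ F` of weight `0` (for the left regular action) with `a f = ε(a) f` for all
`a ∈ P`. -/
def F0 (H : LieSubalgebra ℂ L) (P : Submodule ℂ (U L)) : Submodule ℂ (matElts L) where
  carrier := {f | (∀ h ∈ H, regAct L (gen h) f = 0) ∧ ∀ a ∈ P, regAct L a f = counit L a • f}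
  add_mem' := by
    rintro f g ⟨hf, hf'⟩ ⟨hg, hg'⟩
    exact ⟨fun h hh => by rw [map_add, hf h hh, hg h hh, add_zero],
      fun a ha => by rw [map_add, hf' a ha, hg' a ha, smul_add]⟩
  zero_mem' := ⟨fun h _ => map_zero _, fun a _ => by simp⟩
  smul_mem' := by
    rintro c f ⟨hf, hf'⟩
    exact ⟨fun h hh => by rw [map_smul, hf h hh, smul_zero],
      fun a ha => by rw [map_smul, hf' a ha, smul_comm]⟩

/-- The left ideal of `U L` generated by `𝔫₊` and by `h - λ(h)`, `h ∈ 𝔥`. -/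
def vermaIdeal (lam : Dual ℂ H) : Submodule (U L) (U L) :=
  Submodule.span (U L) ({x | ∃ e ∈ nPlus b, x = gen e} ∪
    {x | ∃ h : H, x = gen (h : L) - algebraMap ℂ (U L) (lam h)})

/-- The Verma module `M(λ)`; its highest weight vector is the class of `1`. -/
abbrev Verma (lam : Dual ℂ H) : Type u := U L ⧸ vermaIdeal b lam

/-- The largest proper submodule `K(λ)` of `M(λ)`. -/
def maxSub (lam : Dual ℂ H) : Submodule (U L) (Verma b lam) :=
  sSup {N : Submodule (U L) (Verma b lam) | N ≠ ⊤}

/-- The irreducible module `V(λ) = M(λ) / K(λ)`. -/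
abbrev Irr (lam : Dual ℂ H) : Type u := Verma b lam ⧸ maxSub b lam

/-- The highest weight vector of `V(λ)`. -/
def hwVec (lam : Dual ℂ H) : Irr b lam := (maxSub b lam).mkQ ((vermaIdeal b lam).mkQ 1)

/-- `λ` is generic when the Verma module `M(λ)` is irreducible. -/
def IsGeneric (lam : Dual ℂ H) : Prop := IsSimpleModule (U L) (Verma b lam)

/-! ### The reduced fusion element -/

/-- `t ∈ U 𝔫₋ ⊗ U 𝔫₊` is the weight `(-β, β)` component of the reduced fusion element at `λ`,
written in some bases `x i` of `(U 𝔫₋)[-β]` modulo `K_λ`, that is of `V(λ)[λ - β]`, and `z j` of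
`(U 𝔫₊)[β]` modulo `K̃_λ`. For the basis `z j = ω(S(x j))`, where `ω` is the Chevalley
(anti-)involution, the matrix below is the matrix of the Shapovalov form on `V(λ)[λ - β]` in the
basis `x i`. -/
def IsFusionTerm (lam β : Dual ℂ H) (t : U (nMinus b) ⊗[ℂ] U (nPlus b)) : Prop :=
  ∃ (n : ℕ) (x : Fin n → U (nMinus b)) (z : Fin n → U (nPlus b)),
    (∀ i, x i ∈ wtSpace (nMinus b) (-β)) ∧ (∀ j, z j ∈ wtSpace (nPlus b) β) ∧
    LinearIndependent ℂ (fun i => (K b lam).mkQ (x i)) ∧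
    LinearIndependent ℂ (fun j => (Ktilde b lam).mkQ (z j)) ∧
    wtSpace (nMinus b) (-β) ≤ Submodule.span ℂ (Set.range x) ⊔ K b lam ∧
    wtSpace (nPlus b) β ≤ Submodule.span ℂ (Set.range z) ⊔ Ktilde b lam ∧
    t = ∑ i, ∑ j, (Matrix.of fun k l => shapPairing b lam (z k) (x l))⁻¹ i j •
      (x i ⊗ₜ[ℂ] z j)

open Classical in
/-- The weight `(-β, β)` component of the reduced fusion element `J_red(λ)`, computed in some
bases. It exists as the weight spaces are finite-dimensional; for generic `λ` it does not depend on
the bases, and in general a change of the bases changes it by an element of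
`K_λ ⊗ U 𝔫₊ + U 𝔫₋ ⊗ K̃_λ`. -/
def fusionTerm (lam β : Dual ℂ H) : U (nMinus b) ⊗[ℂ] U (nPlus b) :=
  if h : ∃ t, IsFusionTerm b lam β t then h.choose else 0

/-- The action of `J_red(λ) = 1 ⊗ 1 + ∑_{β ∈ Q₊} J_β` on `M ⊗ F`, for a `U 𝔫₋`-module `M` with
structure map `s`. The sum is finite on every element. For generic `λ`, where `V(λ) = M(λ)`, the
element `J_red(λ)` is the fusion element `J(λ)`, and this is the operator `J(λ)^M`. -/
def fusion (lam : Dual ℂ H) {M : Type u} [AddCommGroup M] [Module ℂ M]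
    (s : U (nMinus b) →ₐ[ℂ] End ℂ M) (w : M ⊗[ℂ] matElts L) : M ⊗[ℂ] matElts L :=
  w + ∑ᶠ β ∈ Qplus b,
    TensorProduct.homTensorHomMap (RingHom.id ℂ) M (matElts L) M (matElts L)
      (TensorProduct.map s.toLinearMap ((regAct L).comp (emb (nPlus b))).toLinearMap
        (fusionTerm b lam β)) w

/-- The structure map `U 𝔫₋ → End F` of the left regular action. -/
def regMinus : U (nMinus b) →ₐ[ℂ] End ℂ (matElts L) := (regAct L).comp (emb (nMinus b))

/-- The structure map `U 𝔫₋ → End M` of an `𝔫₋`-module. -/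
def actMinus (M : Type u) [AddCommGroup M] [Module ℂ M] [LieRingModule (nMinus b) M]
    [LieModule ℂ (nMinus b) M] : U (nMinus b) →ₐ[ℂ] End ℂ M :=
  UniversalEnvelopingAlgebra.lift ℂ (LieModule.toEnd ℂ (nMinus b) M)

/-! ### The star product -/

/-- The weight space `V(λ)[μ]`. -/
def irrWt (lam μ : Dual ℂ H) : Submodule ℂ (Irr b lam) where
  carrier := {v | ∀ h : H, gen (h : L) • v = μ h • v}
  add_mem' := by intro v w hv hw h; rw [smul_add, smul_add, hv h, hw h]
  zero_mem' := by intro h; simp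
  smul_mem' := by intro c v hv h; rw [smul_comm, hv h, smul_comm]

/-- `p` is the coefficient of the highest weight vector with respect to the weight decomposition
of `V(λ)`. -/
def IsHwCoeff (lam : Dual ℂ H) (p : Irr b lam →ₗ[ℂ] ℂ) : Prop :=
  p (hwVec b lam) = 1 ∧ ∀ β ∈ Qplus b, ∀ v ∈ irrWt b lam (lam - β), p v = 0

open Classical in
/-- The coefficient of the highest weight vector of `V(λ)` (it exists and is unique). -/
def hwCoeff (lam : Dual ℂ H) : Irr b lam →ₗ[ℂ] ℂ :=
  if h : ∃ p, IsHwCoeff b lam p then h.choose else 0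

/-- `Hom_L(V(λ), V(λ) ⊗ F)`, where `F` carries the left regular action. -/
def homL (lam : Dual ℂ H) : Set (Irr b lam →ₗ[ℂ] Irr b lam ⊗[ℂ] matElts L) :=
  {φ | ∀ (x : L) (v : Irr b lam), φ (gen x • v) =
    (Algebra.lsmul ℂ ℂ (Irr b lam) (gen x)).rTensor (matElts L) (φ v) +
      (regAct L (gen x)).lTensor (Irr b lam) (φ v)}

/-- The product `φ * ψ = (id ⊗ μ) ∘ (φ ⊗ id) ∘ ψ`. -/
def homMul (lam : Dual ℂ H) (φ ψ : Irr b lam →ₗ[ℂ] Irr b lam ⊗[ℂ] matElts L) :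
    Irr b lam →ₗ[ℂ] Irr b lam ⊗[ℂ] matElts L :=
  (mulF L).lTensor (Irr b lam) ∘ₗ
    (TensorProduct.assoc ℂ (Irr b lam) (matElts L) (matElts L)).toLinearMap ∘ₗ
      φ.rTensor (matElts L) ∘ₗ ψ

/-- `Θ`: the element `f_φ` with `φ(1_λ) = 1_λ ⊗ f_φ + lower order terms`. -/
def theta (lam : Dual ℂ H) (φ : Irr b lam →ₗ[ℂ] Irr b lam ⊗[ℂ] matElts L) : matElts L :=
  TensorProduct.lid ℂ (matElts L) ((hwCoeff b lam).rTensor (matElts L) (φ (hwVec b lam)))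

/-- The star product `f₁ ⋆_λ f₂ = Θ(Θ⁻¹(f₁) * Θ⁻¹(f₂))`, where `Θ⁻¹` is the inverse of `Θ` on
`Hom_L(V(λ), V(λ) ⊗ F)`; it is meant for `f₁, f₂` in the image `F[0]^{K_λ + K̃_λ}` of `Θ`. -/
def star (lam : Dual ℂ H) (f₁ f₂ : matElts L) : matElts L :=
  theta b lam (homMul b lam (Function.invFunOn (theta b lam) (homL b lam) f₁)
    (Function.invFunOn (theta b lam) (homL b lam) f₂))

/-! ### Limits and regularity -/

/-- The linear coordinates `(λ(α^∨))_α` on `𝔥*`, with `α` running over the simple roots. -/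
def coords (lam : Dual ℂ H) : b.support → ℂ := fun i => lam ((IsKilling.rootSystem H).coroot i)

/-- The filter of generic `λ` tending to `λ₀` (in the usual topology of `𝔥*`). -/
def genericNhds (lam₀ : Dual ℂ H) : Filter (Dual ℂ H) :=
  Filter.comap (coords b) (nhds (coords b lam₀)) ⊓ Filter.principal {lam | IsGeneric b lam}

/-- Convergence in a complex vector space `W`: the family eventually stays in a finite-dimensional
subspace and converges there, i.e. weakly. -/
def ConvergesTo {X W : Type*} [AddCommGroup W] [Module ℂ W] (l : Filter X) (u : X → W) (w : W) :
    Prop :=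
  ∃ E : Submodule ℂ W, FiniteDimensional ℂ E ∧ w ∈ E ∧ (∀ᶠ x in l, u x ∈ E) ∧
    ∀ ξ : Dual ℂ W, Filter.Tendsto (fun x => ξ (u x)) l (nhds (ξ w))

/-- Regularity at `λ₀` of a family of vectors defined for generic `λ`: near `λ₀` it is a linear
combination of finitely many fixed vectors with coefficients holomorphic at `λ₀`. -/
def IsRegularAt (lam₀ : Dual ℂ H) {W : Type*} [AddCommGroup W] [Module ℂ W]
    (u : Dual ℂ H → W) : Prop :=
  ∃ (n : ℕ) (c : Fin n → (b.support → ℂ) → ℂ) (w : Fin n → W),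
    (∀ k, AnalyticAt ℂ (c k) (coords b lam₀)) ∧
      ∀ᶠ lam in genericNhds b lam₀, u lam = ∑ k, c k (coords b lam) • w k

/-- The good regularity property of `λ₀`: for every `𝔫₋`-module `M`, the family of operators
`J(λ)^M : M ⊗ F[0]^{K̃_{λ₀}} → M ⊗ F` is regular at `λ₀`. -/
def GoodRegularity (lam₀ : Dual ℂ H) : Prop :=
  ∀ (M : Type u) [AddCommGroup M] [Module ℂ M] [LieRingModule (nMinus b) M]
    [LieModule ℂ (nMinus b) M] (w : M ⊗[ℂ] F0 H (KtildeInU b lam₀)),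
    IsRegularAt b lam₀ fun lam => fusion b lam (actMinus b M)
      ((F0 H (KtildeInU b lam₀)).subtype.lTensor M w)

end Main

end EqQuant

end

noncomputable section

namespace EqQuant

open Module LieAlgebra

attribute [local instance 100] LieRing.ofAssociativeRing

/-! ### Generalities on enveloping algebras -/

section Enveloping

variable {L : Type u} [LieRing L] [LieAlgebra ℂ L]

/-! Let `fusionVec b λ g` be the vector `J_red(λ)(1 ⊗ g)` of `U 𝔫₋ ⊗ F`. The map `y ⊗ h ↦ y f ⊗ h`
sends it to `J_red(λ)(f ⊗ g)`. When its first factor is contracted with any `x ∈ U 𝔫₊` by the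
Shapovalov pairing `π_λ`, the result is `x g` (`contr_fusionVec`): the inverse Gram matrices give
this modulo `K̃_λ`, which is harmless at `λ₀` because `g` is killed by `K̃_{λ₀}`, and harmless at
generic `λ` because `K̃_λ` then has no nonzero vector of weight in `Q₊`. These equations determine
the vector up to `K_λ ⊗ F`.

Good regularity for the single module `M = U 𝔫₋` makes `J(λ)(1 ⊗ g)` converge to some `T`. Since
`π_λ` is polynomial in `λ`, the equations pass to the limit, so `T` satisfies those of `J_red(λ₀)(1
⊗ g)` (`exists_limit_fusionVec`). The two vectors differ by an element of `K_{λ₀} ⊗ F`, which acts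
on `f` by zero; this is `convergesTo_fusion`.

For the star product, an intertwiner `φ` with `f_φ = f` must send the highest weight vector to
`J_red(λ)(1 ⊗ f)` applied to it, because both vectors have the same matrix coefficients `x f`
(`IsAdmissible.apply_hwVec`); conversely this vector defines an intertwiner
(`IsAdmissible.exists_mem_homL`). Reading off the leading term of `φ * ψ` gives `f₁ ⋆_λ f₂ =
μ(J_red(λ)(f₁ ⊗ f₂))` (`IsAdmissible.star_eq`), both at `λ₀` and at generic `λ`, and the second
claim is the image of the first under `μ`.

The structure theory behind this is built from a model of the Verma module on `U 𝔫₋`. It yields the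
Harish-Chandra projection, the injectivity of `U 𝔫₋ → M(λ)`, and the description of `K_λ` as the
annihilator in `U 𝔫₋` of the highest weight vector of `V(λ)`. Poincaré-Birkhoff-Witt bases of `U 𝔫₊`
and `U 𝔫₋` supply finite and equal dimensions of opposite weight spaces. -/

theorem gen_lie (x y : L) : gen ⁅x, y⁆ = gen x * gen y - gen y * gen x := by
  rw [gen, LieHom.map_lie, LieRing.of_associative_ring_bracket]

/-- A subspace that contains `1` and is stable under left multiplication by `L` is everything. -/
theorem mem_of_left_stable {P : Submodule ℂ (U L)} (h1 : (1 : U L) ∈ P)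
    (hm : ∀ (x : L), ∀ u ∈ P, gen x * u ∈ P) (u : U L) : u ∈ P := by
  obtain ⟨t, rfl⟩ : ∃ t, UniversalEnvelopingAlgebra.mkAlgHom ℂ L t = u :=
    RingCon.mkₐ_surjective (UniversalEnvelopingAlgebra.ringCon ℂ L) u
  suffices ∀ v ∈ P, UniversalEnvelopingAlgebra.mkAlgHom ℂ L t * v ∈ P by
    simpa using this 1 h1
  induction t using TensorAlgebra.induction with
  | algebraMap r =>
    intro v hv
    rw [AlgHom.commutes, ← Algebra.smul_def]
    exact P.smul_mem r hv
  | ι x =>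
    intro v hv
    have := hm x v hv
    rwa [gen, UniversalEnvelopingAlgebra.ι_apply] at this
  | mul a b ha hb =>
    intro v hv
    rw [map_mul, mul_assoc]
    exact ha _ (hb _ hv)
  | add a b ha hb =>
    intro v hv
    rw [map_add, add_mul]
    exact add_mem (ha _ hv) (hb _ hv)

@[elab_as_elim]
theorem left_induction {C : U L → Prop} (one : C 1) (gen_mul : ∀ (x : L) (u : U L), C u → C (gen x * u))
    (add : ∀ u v, C u → C v → C (u + v)) (smul : ∀ (c : ℂ) u, C u → C (c • u)) (u : U L) : C u :=
  mem_of_left_stable (P :=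
    { carrier := {u | C u}
      add_mem' := fun {a b} ha hb => add a b ha hb
      zero_mem' := by simpa using smul 0 1 one
      smul_mem' := fun c a ha => smul c a ha }) one (fun x u hu => gen_mul x u hu) u

theorem lift_gen {A : Type*} [Ring A] [Algebra ℂ A] (f : L →ₗ⁅ℂ⁆ A) (x : L) :
    UniversalEnvelopingAlgebra.lift ℂ f (gen x) = f x :=
  UniversalEnvelopingAlgebra.lift_ι_apply ℂ f x

theorem counit_gen (x : L) : counit L (gen x) = 0 := by
  rw [counit, lift_gen]; rfl

theorem comul_gen (x : L) : comul L (gen x) = gen x ⊗ₜ[ℂ] 1 + 1 ⊗ₜ[ℂ] gen x := by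
  rw [comul, lift_gen]; rfl

theorem emb_gen (s : LieSubalgebra ℂ L) (x : s) : emb s (gen x) = gen (x : L) := by
  rw [emb, lift_gen]; rfl

theorem antipode_gen (x : L) : antipode L (gen x) = -gen x := by
  rw [antipode, LinearMap.comp_apply, AlgHom.toLinearMap_apply, antipodeOp, lift_gen]; rfl

theorem antipode_one : antipode L 1 = 1 := by
  simp [antipode]

theorem antipode_mul (a c : U L) : antipode L (a * c) = antipode L c * antipode L a := by
  simp [antipode]

theorem antipode_gen_mul (x : L) (u : U L) :
    antipode L (gen x * u) = -(antipode L u * gen x) := by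
  rw [antipode_mul, antipode_gen, mul_neg]

theorem antipode_emb (s : LieSubalgebra ℂ L) (u : U s) :
    antipode L (emb s u) = emb s (antipode s u) := by
  induction u using left_induction with
  | one => simp [antipode_one]
  | gen_mul x u hu =>
    rw [map_mul, emb_gen, antipode_gen_mul, antipode_gen_mul, hu, map_neg, map_mul, emb_gen]
  | add u v hu hv => simp [hu, hv]
  | smul c u hu => simp [hu]

theorem antipode_antipode (u : U L) : antipode L (antipode L u) = u := by
  induction u using left_induction with
  | one => simp [antipode_one]
  | gen_mul x u hu =>
    rw [antipode_gen_mul, map_neg, antipode_mul, antipode_gen, hu, neg_mul, neg_neg]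
  | add u v hu hv => simp [hu, hv]
  | smul c u hu => simp [hu]

theorem counit_emb (s : LieSubalgebra ℂ L) (u : U s) : counit L (emb s u) = counit s u := by
  induction u using left_induction with
  | one => simp
  | gen_mul x u hu => rw [map_mul, map_mul, map_mul, emb_gen, counit_gen, counit_gen]; simp
  | add u v hu hv => simp [hu, hv]
  | smul c u hu => simp [hu]

theorem counit_antipode (x : U L) :
    counit L (antipode L x) = counit L x := by
  induction x using left_induction with
  | one => simp [antipode_one]
  | gen_mul a x hx => rw [antipode_gen_mul, map_neg, map_mul, map_mul, counit_gen]; simp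
  | add x y hx hy => simp only [map_add, hx, hy]
  | smul c x hx => simp only [map_smul, hx]

/-! ### The Verma module on `U 𝔫` attached to a splitting -/

/-- The action of `𝔫` on `Hom(L, U 𝔫)` by `(a D)(x) = a D(x) + D([x, a])`. -/
def homAct (n : LieSubalgebra ℂ L) : n →ₗ⁅ℂ⁆ End ℂ (L →ₗ[ℂ] U n) where
  toFun a := LinearMap.llcomp ℂ L (U n) (U n) (LinearMap.mulLeft ℂ (gen a)) -
    (LinearMap.lcomp ℂ (U n) (LieAlgebra.ad ℂ L (a : L)))
  map_add' a c := by
    ext D x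
    simp only [LinearMap.sub_apply, LinearMap.llcomp_apply, LinearMap.lcomp_apply,
      LinearMap.mulLeft_apply, map_add, LinearMap.add_apply, add_mul, AddMemClass.coe_add, gen]
    abel
  map_smul' r a := by
    ext D x
    simp [-UniversalEnvelopingAlgebra.ι_apply, gen, smul_sub]
  map_lie' {a c} := by
    ext D x
    simp only [LinearMap.sub_apply, LinearMap.llcomp_apply, LinearMap.lcomp_apply,
      LinearMap.mulLeft_apply, gen_lie, LieSubalgebra.coe_bracket, LieAlgebra.ad_apply,
      LieRing.of_associative_ring_bracket, Module.End.mul_apply, lie_lie, map_sub]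
    noncomm_ring

theorem homAct_apply (n : LieSubalgebra ℂ L) (a : n) (D : L →ₗ[ℂ] U n) (x : L) :
    homAct n a D x = gen a * D x + D ⁅x, (a : L)⁆ := by
  rw [← lie_skew, map_neg, ← sub_eq_add_neg]; rfl

variable (n : LieSubalgebra ℂ L) (pr : L →ₗ[ℂ] n) (χ : L →ₗ[ℂ] ℂ)

/-- The operator on `U 𝔫` by which `x : L` acts on the Verma module. -/
def vermaOp (x : L) : End ℂ (U n) where
  toFun y := UniversalEnvelopingAlgebra.lift ℂ (homAct n) y
    ((UniversalEnvelopingAlgebra.ι ℂ : n →ₗ⁅ℂ⁆ U n).toLinearMap ∘ₗ pr + (Algebra.linearMap ℂ (U n)) ∘ₗ χ) x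
  map_add' y z := by simp
  map_smul' c y := by simp

theorem vermaOp_one (x : L) : vermaOp n pr χ x 1 = gen (pr x) + algebraMap ℂ (U n) (χ x) := by
  simp only [vermaOp, LinearMap.coe_mk, AddHom.coe_mk, map_one]
  rfl

/-- In a module, `x (a y) = a (x y) + [x, a] y`. Hence `D_y : x ↦ x y` obeys `D_{ay}(x) = a D_y(x) +
D_y([x, a])`, and `homAct` is exactly this rule: `D_y` arises from `D_1 = pr + χ` by the action of
`y`. -/
theorem vermaOp_gen_mul (x : L) (a : n) (y : U n) :
    vermaOp n pr χ x (gen a * y) = gen a * vermaOp n pr χ x y + vermaOp n pr χ ⁅x, (a : L)⁆ y := by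
  simp only [vermaOp, LinearMap.coe_mk, AddHom.coe_mk, map_mul, lift_gen, Module.End.mul_apply,
    homAct_apply]

theorem vermaOp_add (x y : L) : vermaOp n pr χ (x + y) = vermaOp n pr χ x + vermaOp n pr χ y := by
  ext z; exact (UniversalEnvelopingAlgebra.lift ℂ (homAct n) z _).map_add x y

theorem vermaOp_smul (c : ℂ) (x : L) : vermaOp n pr χ (c • x) = c • vermaOp n pr χ x := by
  ext z; exact (UniversalEnvelopingAlgebra.lift ℂ (homAct n) z _).map_smul c x

/-- `pr` and `χ` are the projection to `𝔫` along a complementary subalgebra and a character of the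
latter. -/
structure IsSplitting : Prop where
  pr_coe : ∀ x : n, pr x = x
  chi_coe : ∀ x : n, χ x = 0
  pr_lie : ∀ x y, pr x = 0 → pr y = 0 → pr ⁅x, y⁆ = 0
  chi_lie : ∀ x y, pr x = 0 → pr y = 0 → χ ⁅x, y⁆ = 0

variable {n pr χ}

theorem vermaOp_coe (hs : IsSplitting n pr χ) (a : n) (y : U n) :
    vermaOp n pr χ a y = gen a * y := by
  induction y using left_induction generalizing a with
  | one => simp [vermaOp_one, hs.pr_coe, hs.chi_coe, -UniversalEnvelopingAlgebra.ι_apply]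
  | gen_mul c y hy =>
    rw [vermaOp_gen_mul, hy, ← LieSubalgebra.coe_bracket, hy, gen_lie]
    noncomm_ring
  | add y z hy hz => simp only [map_add, hy, hz, mul_add]
  | smul r y hy => simp only [map_smul, hy, mul_smul_comm]

/-- Induction on `y`; the step is the Jacobi identity. At `y = 1`, brackets with an element of `𝔫`
reduce to `vermaOp_gen_mul`. On the complementary subalgebra all operators are scalars at `1`, and
the character kills brackets. -/
theorem vermaOp_lie (hs : IsSplitting n pr χ) (x z : L) (y : U n) :
    vermaOp n pr χ ⁅x, z⁆ y =
      vermaOp n pr χ x (vermaOp n pr χ z y) - vermaOp n pr χ z (vermaOp n pr χ x y) := by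
  induction y using left_induction generalizing x z with
  | one =>
    have split : ∀ x : L, ∃ (a : n) (c : L), pr c = 0 ∧ x = a + c := fun x =>
      ⟨pr x, x - pr x, by rw [map_sub, hs.pr_coe, sub_self], by abel⟩
    have hbb : ∀ x z : L, pr x = 0 → pr z = 0 → vermaOp n pr χ ⁅x, z⁆ 1 =
        vermaOp n pr χ x (vermaOp n pr χ z 1) - vermaOp n pr χ z (vermaOp n pr χ x 1) := by
      intro x z hx hz
      simp only [vermaOp_one, hs.pr_lie x z hx hz, hs.chi_lie x z hx hz, hx, hz, map_zero,
        zero_add, Algebra.algebraMap_eq_smul_one, map_smul]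
      simp [mul_comm, smul_smul, -UniversalEnvelopingAlgebra.ι_apply]
    have hab : ∀ (a : n) (z : L), vermaOp n pr χ ⁅z, (a : L)⁆ 1 =
        vermaOp n pr χ z (vermaOp n pr χ a 1) - vermaOp n pr χ a (vermaOp n pr χ z 1) := by
      intro a z
      rw [vermaOp_coe hs, vermaOp_coe hs, vermaOp_gen_mul]
      abel
    have hba : ∀ (a : n) (z : L), vermaOp n pr χ ⁅(a : L), z⁆ 1 =
        vermaOp n pr χ a (vermaOp n pr χ z 1) - vermaOp n pr χ z (vermaOp n pr χ a 1) := by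
      intro a z
      rw [← lie_skew, ← neg_one_smul ℂ, vermaOp_smul, LinearMap.smul_apply, hab]
      simp
    obtain ⟨a, c, hc, rfl⟩ := split x
    obtain ⟨a', c', hc', rfl⟩ := split z
    simp only [add_lie, lie_add, vermaOp_add, LinearMap.add_apply, map_add, hba, hab,
      hbb c c' hc hc']
    abel
  | gen_mul a y hy =>
    have hj : ⁅⁅x, z⁆, (a : L)⁆ = ⁅⁅x, (a : L)⁆, z⁆ + ⁅x, ⁅z, (a : L)⁆⁆ := by
      rw [lie_lie, ← lie_skew z ⁅x, (a : L)⁆]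
      abel
    rw [vermaOp_gen_mul, hj, vermaOp_add, LinearMap.add_apply]
    simp only [vermaOp_gen_mul, map_add, hy, mul_sub]
    abel
  | add y y' hy hy' => simp only [map_add, hy, hy']; abel
  | smul r y hy => simp only [map_smul, hy, smul_sub]

/-- The Verma module of a splitting, realized on `U 𝔫`. -/
def vermaRep (hs : IsSplitting n pr χ) : U L →ₐ[ℂ] End ℂ (U n) :=
  UniversalEnvelopingAlgebra.lift ℂ
    { toFun := vermaOp n pr χ
      map_add' := vermaOp_add n pr χ
      map_smul' := vermaOp_smul n pr χ
      map_lie' := by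
        intro x z
        ext y
        rw [vermaOp_lie hs]
        rfl }

theorem vermaRep_gen (hs : IsSplitting n pr χ) (x : L) : vermaRep hs (gen x) = vermaOp n pr χ x := by
  rw [vermaRep, lift_gen]; rfl

theorem vermaRep_emb (hs : IsSplitting n pr χ) (y z : U n) : vermaRep hs (emb n y) z = y * z := by
  induction y using left_induction with
  | one => simp
  | gen_mul a y hy =>
    rw [map_mul, map_mul, Module.End.mul_apply, hy, emb_gen, vermaRep_gen, vermaOp_coe hs,
      mul_assoc]
  | add y y' hy hy' => simp [hy, hy', add_mul]
  | smul r y hy => simp [hy]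

theorem vermaRep_gen_one_of_pr_eq_zero (hs : IsSplitting n pr χ) {x : L} (hx : pr x = 0) :
    vermaRep hs (gen x) 1 = χ x • 1 := by
  rw [vermaRep_gen, vermaOp_one, hx, Algebra.algebraMap_eq_smul_one, gen, map_zero, zero_add]

/-! ### Products of subalgebras -/

/-- The span of the products `y p`, `y ∈ U 𝔫`, `p ∈ P`. -/
def mulSpan (n : LieSubalgebra ℂ L) (P : Submodule ℂ (U L)) : Submodule ℂ (U L) :=
  (LinearMap.range (emb n).toLinearMap) * P

/-- Moving `x` to the right past `a ∈ 𝔫` produces `[x, a]`, which stays in `𝔫 + B`. The claim is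
made for all `x ∈ 𝔫 + B`, not only for `B`, so that the induction on `y` closes. -/
theorem mulSpan_left_stable {n : LieSubalgebra ℂ L} {P : Submodule ℂ (U L)} {B : Submodule ℂ L}
    (hB : ∀ c ∈ B, ∀ a ∈ n, ⁅c, a⁆ ∈ n.toSubmodule ⊔ B) (hP : ∀ c ∈ B, ∀ p ∈ P, gen c * p ∈ P)
    {x : L} (hx : x ∈ n.toSubmodule ⊔ B) {u : U L} (hu : u ∈ mulSpan n P) :
    gen x * u ∈ mulSpan n P := by
  have hn : ∀ a : n, ∀ u ∈ mulSpan n P, gen (a : L) * u ∈ mulSpan n P := by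
    intro a u hu
    refine Submodule.mul_induction_on hu ?_ fun u v hu hv => by rw [mul_add]; exact add_mem hu hv
    rintro _ ⟨y, rfl⟩ p hp
    rw [← mul_assoc, ← emb_gen, AlgHom.toLinearMap_apply, ← map_mul]
    exact Submodule.mul_mem_mul ⟨_, rfl⟩ hp
  refine Submodule.mul_induction_on hu ?_ fun u v hu hv => by rw [mul_add]; exact add_mem hu hv
  rintro _ ⟨y, rfl⟩ p hp
  rw [AlgHom.toLinearMap_apply]
  induction y using left_induction generalizing x with
  | one =>
    obtain ⟨a, ha, c, hc, rfl⟩ := Submodule.mem_sup.1 hx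
    have h1 : ∀ p ∈ P, p ∈ mulSpan n P := fun p hp => by
      have h1 : (1 : U L) ∈ LinearMap.range (emb n).toLinearMap := ⟨1, map_one (emb n)⟩
      simpa [mulSpan] using Submodule.mul_mem_mul h1 hp
    rw [map_one, one_mul, gen, map_add, add_mul]
    exact add_mem (hn ⟨a, ha⟩ p (h1 p hp)) (h1 _ (hP c hc p hp))
  | gen_mul a y hy =>
    have key : gen x * (emb n (gen a * y) * p) =
        gen (a : L) * (gen x * (emb n y * p)) + gen ⁅x, (a : L)⁆ * (emb n y * p) := by
      rw [map_mul, emb_gen, gen_lie]; noncomm_ring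
    rw [key]
    refine add_mem (hn a _ (hy hx)) (hy ?_)
    obtain ⟨a', ha', c, hc, rfl⟩ := Submodule.mem_sup.1 hx
    rw [add_lie]
    exact add_mem (Submodule.mem_sup_left (n.lie_mem ha' a.2)) (hB c hc a a.2)
  | add y y' hy hy' =>
    rw [map_add, add_mul, mul_add]; exact add_mem (hy hx) (hy' hx)
  | smul r y hy =>
    rw [map_smul, smul_mul_assoc, mul_smul_comm]; exact Submodule.smul_mem _ _ (hy hx)

end Enveloping

/-! ### The Poincaré-Birkhoff-Witt theorem -/

section PBW

variable {L : Type u} [LieRing L] [LieAlgebra ℂ L] {ι : Type*}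

/-- A linear form dual to a member of a linearly independent family. -/
theorem exists_dual_of_linearIndepOn {V κ : Type*} [AddCommGroup V] [Module ℂ V] {v : κ → V}
    {s : Set κ} (h : LinearIndepOn ℂ v s) {t : κ} (ht : t ∈ s) :
    ∃ φ : V →ₗ[ℂ] ℂ, φ (v t) = 1 ∧ ∀ t' ∈ s, t' ≠ t → φ (v t') = 0 := by
  classical
  obtain ⟨φ, hφ⟩ := LinearMap.exists_extend (Finsupp.lapply (⟨t, ht⟩ : s) ∘ₗ h.repr)
  have key : ∀ x : s, φ (v x) = (Finsupp.single x (1 : ℂ)) (⟨t, ht⟩ : s) := by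
    intro x
    have hx : v x ∈ Submodule.span ℂ (Set.range fun x : s => v x) :=
      Submodule.subset_span ⟨x, rfl⟩
    have := LinearMap.congr_fun hφ ⟨v x, hx⟩
    simp only [LinearMap.comp_apply, Submodule.subtype_apply] at this
    rw [this, h.repr_eq_single x ⟨v x, hx⟩ rfl]
    rfl
  refine ⟨φ, by simpa using key ⟨t, ht⟩, fun t' ht' hne => ?_⟩
  rw [key ⟨t', ht'⟩, Finsupp.single_eq_of_ne]
  simpa using hne.symm

/-- The counit is `1` at `1` and `0` on generators, so subtracting a multiple of it corrects the
value at `1` and nothing else. -/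
theorem exists_dual_gen (hinj : Function.Injective (gen : L → U L)) {e : ι → L}
    (he : LinearIndependent ℂ e) (a : ι) :
    ∃ ψ : U L →ₗ[ℂ] ℂ, ψ 1 = 0 ∧ ψ (gen (e a)) = 1 ∧ ∀ i, i ≠ a → ψ (gen (e i)) = 0 := by
  have hi : LinearIndepOn ℂ (fun i => gen (e i)) Set.univ := by
    rw [linearIndepOn_univ_iff]
    exact he.map' (UniversalEnvelopingAlgebra.ι ℂ : L →ₗ⁅ℂ⁆ U L).toLinearMap
      (LinearMap.ker_eq_bot.2 hinj)
  obtain ⟨φ, h1, h2⟩ := exists_dual_of_linearIndepOn hi (Set.mem_univ a)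
  refine ⟨φ - φ 1 • (counit L).toLinearMap, by simp, ?_, fun i hi => ?_⟩
  · rw [LinearMap.sub_apply, h1, LinearMap.smul_apply, AlgHom.toLinearMap_apply, counit_gen]; simp
  · rw [LinearMap.sub_apply, h2 i trivial hi, LinearMap.smul_apply, AlgHom.toLinearMap_apply,
      counit_gen]; simp

theorem sum_map_ite_eq_count {κ : Type*} [DecidableEq κ] (S : Multiset κ) (x : κ) :
    (S.map fun p => if p = x then (1 : ℂ) else 0).sum = (S.count x : ℂ) := by
  induction S using Multiset.induction with
  | empty => simp
  | cons a S ih =>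
    rw [Multiset.map_cons, Multiset.sum_cons, ih, Multiset.count_cons]
    by_cases h : a = x
    · simp [h, add_comm]
    · simp [h, Ne.symm h]

variable {W : Type*} [AddCommMonoid W] (e : ι → L) (wt : ι → W)

/-- The span of the words in the `e i` of length `< k` and weight `γ`. -/
def wordSpan (k : ℕ) (γ : W) : Submodule ℂ (U L) :=
  Submodule.span ℂ {u | ∃ l : List ι, l.length < k ∧ (l.map wt).sum = γ ∧
    u = (l.map fun i => gen (e i)).prod}

variable {e wt}

theorem gen_mul_mem_wordSpan {k : ℕ} {γ : W} (a : ι) {u : U L} (hu : u ∈ wordSpan e wt k γ) :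
    gen (e a) * u ∈ wordSpan e wt (k + 1) (wt a + γ) := by
  have : wordSpan e wt k γ ≤
      (wordSpan e wt (k + 1) (wt a + γ)).comap (LinearMap.mulLeft ℂ (gen (e a))) := by
    refine Submodule.span_le.2 ?_
    rintro _ ⟨l, hl, hw, rfl⟩
    exact Submodule.subset_span ⟨a :: l, by simpa using hl, by simp [hw], by simp⟩
  exact this hu

/-- A transposition of neighbours costs a commutator, hence words with one letter fewer; `hbr` says
that the bracket is homogeneous, so the weight is kept. -/
theorem prod_sub_prod_mem_wordSpan
    (hbr : ∀ i j, ⁅e i, e j⁆ ∈ Submodule.span ℂ (e '' {k | wt k = wt i + wt j})) {l l' : List ι}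
    (h : l.Perm l') : (l.map fun i => gen (e i)).prod - (l'.map fun i => gen (e i)).prod ∈
      wordSpan e wt l.length (l.map wt).sum := by
  induction h with
  | nil => simp
  | cons a h ih =>
    simp only [List.map_cons, List.prod_cons, List.length_cons, List.sum_cons, ← mul_sub]
    exact gen_mul_mem_wordSpan a ih
  | swap a c l =>
    have : ((c :: a :: l).map fun i => gen (e i)).prod - ((a :: c :: l).map fun i => gen (e i)).prod
        = gen ⁅e c, e a⁆ * (l.map fun i => gen (e i)).prod := by
      rw [gen_lie]; simp only [List.map_cons, List.prod_cons]; noncomm_ring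
    rw [this]
    have key : Submodule.span ℂ (e '' {k | wt k = wt c + wt a}) ≤
        (wordSpan e wt (c :: a :: l).length ((c :: a :: l).map wt).sum).comap
          (LinearMap.mulRight ℂ (l.map fun i => gen (e i)).prod ∘ₗ
            (UniversalEnvelopingAlgebra.ι ℂ : L →ₗ⁅ℂ⁆ U L).toLinearMap) := by
      refine Submodule.span_le.2 ?_
      rintro _ ⟨k, hk, rfl⟩
      refine Submodule.subset_span ⟨k :: l, by simp, ?_, rfl⟩
      rw [Set.mem_ofPred_eq] at hk
      simp [hk, add_assoc]
    exact key (hbr c a)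
  | trans h h' ih ih' =>
    rw [← h.length_eq, ← (h.map wt).sum_eq] at ih'
    simpa using add_mem ih ih'

variable [LinearOrder ι] (e) in
/-- The ordered monomial in the elements `e i`, with the indices from a multiset. -/
def mon (s : Multiset ι) : U L := (s.sort.map fun i => gen (e i)).prod

variable [LinearOrder ι] (e)

theorem mon_zero : mon e 0 = 1 := by simp [mon]

theorem mon_singleton (i : ι) : mon e {i} = gen (e i) := by
  simp [mon, -UniversalEnvelopingAlgebra.ι_apply]

theorem mon_cons {a : ι} {s : Multiset ι} (h : ∀ c ∈ s, a ≤ c) :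
    mon e (a ::ₘ s) = gen (e a) * mon e s := by
  rw [mon, Multiset.sort_cons _ _ _ h, List.map_cons, List.prod_cons, mon]

/-- The generators are primitive, so each letter goes to one of the two factors. Prepending a
smallest letter leaves both factors ordered, which is why no reordering terms appear. -/
theorem comul_mon (s : Multiset ι) :
    comul L (mon e s) = (s.antidiagonal.map fun p => mon e p.1 ⊗ₜ[ℂ] mon e p.2).sum := by
  suffices ∀ l : List ι, l.Pairwise (· ≤ ·) → comul L (mon e l) =
      ((l : Multiset ι).antidiagonal.map fun p => mon e p.1 ⊗ₜ[ℂ] mon e p.2).sum by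
    have h := this s.sort (Multiset.pairwise_sort _ _)
    rwa [Multiset.sort_eq] at h
  intro l hl
  induction l with
  | nil => simp [mon_zero, Algebra.TensorProduct.one_def]
  | cons a l ih =>
    rw [List.pairwise_cons] at hl
    have hle : ∀ c ∈ (l : Multiset ι), a ≤ c := fun c hc => hl.1 c (by simpa using hc)
    rw [← Multiset.cons_coe, mon_cons e hle, map_mul, ih hl.2, comul_gen,
      Multiset.antidiagonal_cons, Multiset.map_add, Multiset.sum_add, Multiset.map_map,
      Multiset.map_map, add_mul, add_comm, ← Multiset.sum_map_mul_left, ← Multiset.sum_map_mul_left]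
    congr 2 <;> refine Multiset.map_congr rfl fun p hp => ?_
    all_goals
      rw [Multiset.mem_antidiagonal] at hp
      simp only [Function.comp_apply, Prod.map_fst, Prod.map_snd, id,
        Algebra.TensorProduct.tmul_mul_tmul, one_mul]
      rw [mon_cons e fun c hc => hle c (by rw [← hp]; simp [hc])]

/-- The hard half of Poincaré-Birkhoff-Witt, deduced from injectivity on `L` alone. Induct on the
maximal length; the comultiplication splits off one letter and so tests a monomial by linear forms
on shorter ones. Characteristic zero enters through multiplicities, which must not vanish. -/
theorem linearIndependent_mon (hinj : Function.Injective (gen : L → U L)) {e : ι → L}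
    (he : LinearIndependent ℂ e) : LinearIndependent ℂ (mon e) := by
  classical
  suffices H : ∀ (N : ℕ) (c : Multiset ι →₀ ℂ), (∀ s ∈ c.support, s.card ≤ N) →
      Finsupp.linearCombination ℂ (mon e) c = 0 → c = 0 by
    rw [linearIndependent_iff]
    intro c hc
    exact H (c.support.sup Multiset.card) c (fun s hs => Finset.le_sup hs) hc
  intro N
  induction N with
  | zero =>
    intro c hc h
    have hc' : c = Finsupp.single 0 (c 0) := by
      ext s
      by_cases hs : s = 0
      · simp [hs]
      · rw [Finsupp.single_eq_of_ne hs]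
        by_contra hne
        exact hs (by simpa using hc s (Finsupp.mem_support_iff.2 hne))
    rw [hc', Finsupp.linearCombination_single, mon_zero] at h
    have := congrArg (counit L) h
    rw [hc']
    simpa using this
  | succ N ih =>
    intro c hc h
    have hli : LinearIndepOn ℂ (mon e) {s : Multiset ι | s.card ≤ N} := by
      rw [linearIndepOn_iff]
      intro d hd hd0
      exact ih d (fun s hs => (Finsupp.mem_supported ℂ d).1 hd hs) hd0
    refine ih c (fun s hs => ?_) h
    by_contra hlt
    have hs1 : s.card = N + 1 := le_antisymm (hc s hs) (by omega)
    obtain ⟨a, t, rfl⟩ : ∃ a t, s = a ::ₘ t := by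
      obtain ⟨a, ha⟩ := Multiset.card_pos_iff_exists_mem.1 (by omega : 0 < s.card)
      exact ⟨a, _, (Multiset.cons_erase ha).symm⟩
    have ht : t.card = N := by simpa using hs1
    obtain ⟨φ, hφ1, hφ0⟩ := exists_dual_of_linearIndepOn hli (t := t) ht.le
    obtain ⟨ψ, hψ1, hψa, hψi⟩ := exists_dual_gen hinj he a
    let Φ : U L →ₗ[ℂ] ℂ :=
      (TensorProduct.lid ℂ ℂ).toLinearMap ∘ₗ TensorProduct.map ψ φ ∘ₗ (comul L).toLinearMap
    have hΦ : ∀ s : Multiset ι, s.card ≤ N + 1 →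
        Φ (mon e s) = (s.antidiagonal.count ({a}, t) : ℂ) := by
      intro s hsN
      have : Φ (mon e s) =
          (s.antidiagonal.map fun p => if p = ({a}, t) then (1 : ℂ) else 0).sum := by
        simp only [Φ, LinearMap.comp_apply, AlgHom.toLinearMap_apply, comul_mon, map_multiset_sum,
          Multiset.map_map, LinearEquiv.coe_coe]
        congr 1
        refine Multiset.map_congr rfl fun p hp => ?_
        change TensorProduct.lid ℂ ℂ (TensorProduct.map ψ φ (mon e p.1 ⊗ₜ mon e p.2)) = _
        rw [TensorProduct.map_tmul, TensorProduct.lid_tmul, smul_eq_mul]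
        rw [Multiset.mem_antidiagonal] at hp
        have hcard : p.1.card + p.2.card = s.card := by rw [← hp, Multiset.card_add]
        -- `ψ` kills the terms whose left factor is empty. A left factor with two or more letters
        -- leaves a right factor shorter than `t`, which `φ` kills. Only `({a}, t)` survives.
        rcases Nat.lt_trichotomy p.1.card 1 with h0 | h1 | h2
        · have h0' : p.1 = 0 := by rw [← Multiset.card_eq_zero]; omega
          rw [h0', mon_zero, hψ1, zero_mul, if_neg]
          rintro rfl
          simp at h0'
        · obtain ⟨i, hi⟩ := Multiset.card_eq_one.1 h1
          rw [hi, mon_singleton]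
          by_cases hia : i = a
          · subst hia
            rw [hψa, one_mul]
            by_cases hp2 : p.2 = t
            · rw [hp2, hφ1, if_pos (Prod.ext hi hp2)]
            · rw [hφ0 p.2 (by simp only [Set.mem_ofPred_eq]; omega) hp2, if_neg]
              rintro rfl; exact hp2 rfl
          · rw [hψi i hia, zero_mul, if_neg]
            rintro rfl
            exact hia (by simpa using hi.symm)
        · have hp2 : p.2 ≠ t := by intro h; rw [h] at hcard; omega
          rw [hφ0 p.2 (by simp only [Set.mem_ofPred_eq]; omega) hp2, mul_zero, if_neg]
          rintro rfl; exact hp2 rfl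
      rw [this, sum_map_ite_eq_count]
    have h0 := congrArg Φ h
    rw [map_zero, Finsupp.linearCombination_apply, Finsupp.sum, map_sum,
      Finset.sum_eq_single (a ::ₘ t)] at h0
    · rw [map_smul, hΦ _ (hc _ hs), smul_eq_mul, mul_eq_zero] at h0
      rcases h0 with h0 | h0
      · exact (Finsupp.mem_support_iff.1 hs) h0
      · rw [Nat.cast_eq_zero, Multiset.count_eq_zero, Multiset.mem_antidiagonal] at h0
        exact h0 (by simp)
    · intro s hs' hne
      rw [map_smul, hΦ _ (hc _ hs'), Multiset.count_eq_zero_of_notMem, Nat.cast_zero, smul_zero]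
      rw [Multiset.mem_antidiagonal]
      intro hs2
      exact hne (by rw [← hs2]; simp)
    · intro hn; exact absurd hs hn

variable {e}

theorem prod_mem_span_mon
    (hbr : ∀ i j, ⁅e i, e j⁆ ∈ Submodule.span ℂ (e '' {k | wt k = wt i + wt j})) (l : List ι) :
    (l.map fun i => gen (e i)).prod ∈
      Submodule.span ℂ (mon e '' {s | (s.map wt).sum = (l.map wt).sum}) := by
  induction hN : l.length using Nat.strong_induction_on generalizing l with
  | _ N ih =>
    have h1 : wordSpan e wt l.length (l.map wt).sum ≤
        Submodule.span ℂ (mon e '' {s | (s.map wt).sum = (l.map wt).sum}) := by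
      refine Submodule.span_le.2 ?_
      rintro _ ⟨l', hl', hw, rfl⟩
      rw [← hw]
      exact ih _ (hN ▸ hl') l' rfl
    have hp : l.Perm (l : Multiset ι).sort := by
      rw [← Multiset.coe_eq_coe, Multiset.sort_eq]
    have h2 := h1 (prod_sub_prod_mem_wordSpan hbr hp)
    have h3 : (((l : Multiset ι).sort).map fun i => gen (e i)).prod ∈
        Submodule.span ℂ (mon e '' {s | (s.map wt).sum = (l.map wt).sum}) :=
      Submodule.subset_span ⟨l, by simp, rfl⟩
    simpa using add_mem h2 h3

end PBW

/-! ### Positive roots and the triangular decomposition -/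

section RootSums

variable {L : Type u} [LieRing L] [LieAlgebra ℂ L] {H : LieSubalgebra ℂ L} [H.IsCartanSubalgebra]

/-- The sum of the root spaces with weight in `S`. -/
def rootSum (H : LieSubalgebra ℂ L) [H.IsCartanSubalgebra] (S : Set (H → ℂ)) : LieSubmodule ℂ H L :=
  ⨆ χ ∈ S, rootSpace H χ

theorem cartan_toSubmodule [FiniteDimensional ℂ L] : H.toSubmodule = (rootSum H ({0} : Set (H → ℂ))).toSubmodule := by
  rw [rootSum, iSup_singleton, rootSpace_zero_eq]; rfl

theorem rootSum_union (S T : Set (H → ℂ)) :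
    (rootSum H (S ∪ T)).toSubmodule = (rootSum H S).toSubmodule ⊔ (rootSum H T).toSubmodule := by
  rw [rootSum, iSup_union]; rfl

theorem rootSum_disjoint {S T : Set (H → ℂ)} (h : Disjoint S T) :
    Disjoint (rootSum H S).toSubmodule (rootSum H T).toSubmodule := by
  rw [LieSubmodule.disjoint_toSubmodule]
  exact (LieModule.iSupIndep_genWeightSpace ℂ H L).disjoint_biSup_biSup h

theorem counit_of_mem_wtSpace {n : LieSubalgebra ℂ L} {γ : Dual ℂ H} (hγ : γ ≠ 0) {y : U n}
    (hy : y ∈ wtSpace n γ) : counit n y = 0 := by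
  have : wtSpace n γ ≤ LinearMap.ker (counit n).toLinearMap := by
    refine Submodule.span_le.2 ?_
    rintro _ ⟨l, hl, rfl, rfl⟩
    cases l with
    | nil => exact absurd rfl hγ
    | cons p l =>
      change counit n ((List.map (fun p => gen p.2) (p :: l)).prod) = 0
      rw [List.map_cons, List.prod_cons, map_mul, counit_gen, zero_mul]
  exact this hy

end RootSums

section Roots

variable {L : Type u} [LieRing L] [LieAlgebra ℂ L] [FiniteDimensional ℂ L]
  [LieAlgebra.IsKilling ℂ L] {H : LieSubalgebra ℂ L} [H.IsCartanSubalgebra]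
  (b : (IsKilling.rootSystem H).Base)

/-- The simple roots form a basis of the dual of `𝔥`, and `𝔥` is reflexive. Values at this element
serve as heights. -/
theorem exists_grading : ∃ h : H, ∀ i ∈ b.support, (IsKilling.rootSystem H).root i h = 1 := by
  refine ⟨(evalEquiv ℂ H).symm (b.toWeightBasis.constr ℂ fun _ => (1 : ℂ)), fun i hi => ?_⟩
  rw [Module.apply_evalEquiv_symm_apply]
  have h1 := b.toWeightBasis.constr_basis ℂ (fun _ => (1 : ℂ)) ⟨i, hi⟩
  rwa [b.toWeightBasis_apply] at h1

/-- An element of `𝔥` on which all simple roots take the value `1`. -/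
def grading : H := (exists_grading b).choose

theorem root_grading {i : H.root} (hi : i ∈ b.support) :
    (IsKilling.rootSystem H).root i (grading b) = 1 := (exists_grading b).choose_spec i hi

theorem height_of_mem_closure {β : Dual ℂ H}
    (hβ : β ∈ AddSubmonoid.closure ((IsKilling.rootSystem H).root '' b.support)) :
    ∃ k : ℕ, β (grading b) = k ∧ (k = 0 → β = 0) := by
  induction hβ using AddSubmonoid.closure_induction with
  | mem x hx =>
    obtain ⟨i, hi, rfl⟩ := hx
    exact ⟨1, by rw [root_grading b hi, Nat.cast_one], by simp⟩
  | zero => exact ⟨0, by simp, by simp⟩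
  | add x y _ _ hx hy =>
    obtain ⟨k, hk, hk'⟩ := hx
    obtain ⟨l, hl, hl'⟩ := hy
    refine ⟨k + l, by simp [hk, hl], fun h => ?_⟩
    rw [hk' (by omega), hl' (by omega), add_zero]

theorem height_of_mem_Qplus {β : Dual ℂ H} (hβ : β ∈ Qplus b) :
    ∃ k : ℕ, 0 < k ∧ β (grading b) = k := by
  obtain ⟨k, hk, hk'⟩ := height_of_mem_closure b hβ.2
  exact ⟨k, Nat.pos_of_ne_zero fun h => hβ.1 (hk' h), hk⟩

theorem add_mem_Qplus {β γ : Dual ℂ H} (hβ : β ∈ Qplus b) (hγ : γ ∈ Qplus b) :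
    β + γ ∈ Qplus b := by
  refine ⟨fun h => ?_, add_mem hβ.2 hγ.2⟩
  obtain ⟨k, hk, hk'⟩ := height_of_mem_Qplus b hβ
  obtain ⟨l, hl, hl'⟩ := height_of_mem_Qplus b hγ
  have := congrArg (fun f : Dual ℂ H => f (grading b)) h
  simp only [LinearMap.add_apply, hk', hl', LinearMap.zero_apply] at this
  norm_cast at this
  omega

theorem neg_notMem_Qplus {β : Dual ℂ H} (hβ : β ∈ Qplus b) : -β ∉ Qplus b := fun h =>
  (add_mem_Qplus b hβ h).1 (by simp)

/-- Splitting off one of the finitely many simple roots lowers the height by one. -/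
theorem finite_closure_of_height (k : ℕ) :
    {β ∈ (AddSubmonoid.closure ((IsKilling.rootSystem H).root '' b.support) : Set (Dual ℂ H)) |
      β (grading b) = k}.Finite := by
  induction k with
  | zero =>
    refine (Set.finite_singleton (0 : Dual ℂ H)).subset ?_
    rintro β ⟨hβ, h0⟩
    obtain ⟨k, hk, hk'⟩ := height_of_mem_closure b hβ
    rw [h0, Nat.cast_inj] at hk
    exact hk' hk.symm
  | succ k ih =>
    refine ((Set.toFinite ((IsKilling.rootSystem H).root '' b.support)).image2 (· + ·) ih).subset ?_
    rintro β ⟨hβ, h0⟩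
    rw [SetLike.mem_coe] at hβ
    induction hβ using AddSubmonoid.closure_induction_left with
    | zero => rw [LinearMap.zero_apply] at h0; norm_cast at h0
    | add_left x hx y hy _ =>
      refine ⟨x, hx, y, ⟨hy, ?_⟩, rfl⟩
      obtain ⟨i, hi, rfl⟩ := hx
      rw [LinearMap.add_apply, root_grading b hi] at h0
      push_cast at h0
      linear_combination h0

theorem finite_Qplus_of_height {s : Set ℂ} (hs : s.Finite) :
    {β ∈ Qplus b | β (grading b) ∈ s}.Finite := by
  have hs' : ((fun k : ℕ => (k : ℂ)) ⁻¹' s).Finite := hs.preimage Nat.cast_injective.injOn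
  refine (hs'.biUnion fun k _ => finite_closure_of_height b k).subset ?_
  rintro β ⟨hβ, hβs⟩
  obtain ⟨k, -, hk⟩ := height_of_mem_Qplus b hβ
  exact Set.mem_biUnion (x := k) (by simpa [hk] using hβs) ⟨hβ.2, hk⟩

theorem exists_root_of_rootSpace_ne_bot {χ : H → ℂ} (h0 : χ ≠ 0) (h : rootSpace H χ ≠ ⊥) :
    ∃ α : H.root, ((IsKilling.rootSystem H).root α : H → ℂ) = χ := by
  refine ⟨⟨⟨χ, h⟩, ?_⟩, rfl⟩
  rw [LieSubalgebra.root, Finset.mem_filter]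
  exact ⟨Finset.mem_univ _, fun hz => h0 hz⟩

/-- Closure of `S` under addition makes the sum of root spaces a subalgebra. As `0` is not in `S`,
every nonzero summand belongs to a root and is among the generators. -/
theorem lieSpan_rootSpaces {S : Set (H → ℂ)} (hadd : ∀ χ ∈ S, ∀ χ' ∈ S, χ + χ' ∈ S)
    (h0 : (0 : H → ℂ) ∉ S) :
    (LieSubalgebra.lieSpan ℂ L {e | ∃ α : H.root, ((IsKilling.rootSystem H).root α : H → ℂ) ∈ S ∧
      e ∈ rootSpace H ((IsKilling.rootSystem H).root α)}).toSubmodule =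
      (rootSum H S).toSubmodule := by
  apply le_antisymm
  · let A : LieSubalgebra ℂ L :=
      { (rootSum H S).toSubmodule with
        lie_mem' := fun {x y} hx hy => by
          refine mem_biSup_genWeightSpace_of hadd ?_ ?_ <;> assumption }
    have : LieSubalgebra.lieSpan ℂ L {e | ∃ α : H.root,
        ((IsKilling.rootSystem H).root α : H → ℂ) ∈ S ∧
        e ∈ rootSpace H ((IsKilling.rootSystem H).root α)} ≤ A := by
      rw [LieSubalgebra.lieSpan_le]
      rintro e ⟨α, hα, he⟩
      exact (le_iSup₂_of_le (f := fun (χ : H → ℂ) (_ : χ ∈ S) => rootSpace H χ) _ hα le_rfl :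
        rootSpace H _ ≤ rootSum H S) he
    exact this
  · rw [rootSum]
    simp only [LieSubmodule.iSup_toSubmodule]
    refine iSup₂_le fun χ hχ x hx => ?_
    by_cases hb : rootSpace H χ = ⊥
    · rw [hb] at hx
      rw [show x = 0 from by simpa using hx]
      exact zero_mem _
    · obtain ⟨α, hα⟩ := exists_root_of_rootSpace_ne_bot (fun h => h0 (h ▸ hχ)) hb
      exact LieSubalgebra.subset_lieSpan ⟨α, by rwa [hα], by rwa [hα]⟩

/-- `Q₊` as a set of functions. -/
def posSet : Set (H → ℂ) := {χ | ∃ β ∈ Qplus b, χ = β}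

/-- `-Q₊` as a set of functions. -/
def negSet : Set (H → ℂ) := {χ | ∃ β : Dual ℂ H, -β ∈ Qplus b ∧ χ = β}

theorem mem_posSet {β : Dual ℂ H} : (β : H → ℂ) ∈ posSet b ↔ β ∈ Qplus b :=
  ⟨fun ⟨γ, hγ, h⟩ => by rwa [DFunLike.coe_injective h], fun h => ⟨β, h, rfl⟩⟩

theorem mem_negSet {β : Dual ℂ H} : (β : H → ℂ) ∈ negSet b ↔ -β ∈ Qplus b :=
  ⟨fun ⟨γ, hγ, h⟩ => by rwa [DFunLike.coe_injective h], fun h => ⟨β, h, rfl⟩⟩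

theorem zero_notMem_posSet : (0 : H → ℂ) ∉ posSet b := by
  have : ((0 : Dual ℂ H) : H → ℂ) ∉ posSet b := by rw [mem_posSet]; exact fun h => h.1 rfl
  exact this

theorem zero_notMem_negSet : (0 : H → ℂ) ∉ negSet b := by
  have : ((0 : Dual ℂ H) : H → ℂ) ∉ negSet b := by
    rw [mem_negSet, neg_zero]; exact fun h => h.1 rfl
  exact this

theorem disjoint_posSet_negSet : Disjoint (posSet b) (negSet b) := by
  rw [Set.disjoint_left]
  rintro _ ⟨β, hβ, rfl⟩ h
  exact neg_notMem_Qplus b hβ ((mem_negSet b).1 h)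

theorem nPlus_toSubmodule : (nPlus b).toSubmodule = (rootSum H (posSet b)).toSubmodule := by
  rw [← lieSpan_rootSpaces ?_ (zero_notMem_posSet b)]
  · simp only [nPlus, mem_posSet]
  · rintro _ ⟨β, hβ, rfl⟩ _ ⟨γ, hγ, rfl⟩
    exact ⟨β + γ, add_mem_Qplus b hβ hγ, rfl⟩

theorem nMinus_toSubmodule : (nMinus b).toSubmodule = (rootSum H (negSet b)).toSubmodule := by
  rw [← lieSpan_rootSpaces ?_ (zero_notMem_negSet b)]
  · simp only [nMinus, mem_negSet]
  · rintro _ ⟨β, hβ, rfl⟩ _ ⟨γ, hγ, rfl⟩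
    exact ⟨β + γ, by rw [neg_add]; exact add_mem_Qplus b hβ hγ, rfl⟩

theorem rootSum_all : rootSum H (posSet b ∪ ({0} ∪ negSet b)) = ⊤ := by
  rw [eq_top_iff, ← LieModule.iSup_genWeightSpace_eq_top ℂ H L]
  refine iSup_le fun χ => ?_
  by_cases hb : rootSpace H χ = ⊥
  · exact (le_of_eq hb).trans bot_le
  · refine le_iSup₂_of_le (f := fun (χ : H → ℂ) _ => rootSpace H χ) χ ?_ le_rfl
    by_cases h0 : χ = 0
    · exact Or.inr (Or.inl h0)
    · obtain ⟨α, rfl⟩ := exists_root_of_rootSpace_ne_bot h0 hb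
      have hne : (IsKilling.rootSystem H).root α ≠ 0 := (IsKilling.rootSystem H).ne_zero α
      rcases b.root_mem_or_neg_mem α with h | h
      · exact Or.inl ((mem_posSet b).2 ⟨hne, h⟩)
      · exact Or.inr (Or.inr ((mem_negSet b).2 ⟨neg_ne_zero.2 hne, h⟩))

theorem isCompl_nMinus : IsCompl (nMinus b).toSubmodule (H.toSubmodule ⊔ (nPlus b).toSubmodule) := by
  rw [nMinus_toSubmodule, nPlus_toSubmodule, cartan_toSubmodule (H := H), ← rootSum_union]
  constructor
  · refine rootSum_disjoint (Set.disjoint_union_right.2 ⟨?_, (disjoint_posSet_negSet b).symm⟩)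
    simpa using zero_notMem_negSet b
  · rw [codisjoint_iff, ← rootSum_union,
      show negSet b ∪ ({0} ∪ posSet b) = posSet b ∪ ({0} ∪ negSet b) by ac_rfl, rootSum_all]
    rfl

theorem isCompl_cartan : IsCompl H.toSubmodule ((nMinus b).toSubmodule ⊔ (nPlus b).toSubmodule) := by
  rw [nMinus_toSubmodule, nPlus_toSubmodule, cartan_toSubmodule (H := H), ← rootSum_union]
  constructor
  · refine rootSum_disjoint (Set.disjoint_union_right.2 ⟨?_, ?_⟩)
    · simpa using zero_notMem_negSet b
    · simpa using zero_notMem_posSet b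
  · rw [codisjoint_iff, ← rootSum_union,
      show {0} ∪ (negSet b ∪ posSet b) = posSet b ∪ ({0} ∪ negSet b) by ac_rfl, rootSum_all]
    rfl

theorem lie_mem_nPlus {h : L} (hh : h ∈ H) {e : L} (he : e ∈ nPlus b) : ⁅h, e⁆ ∈ nPlus b := by
  rw [← LieSubalgebra.mem_toSubmodule, nPlus_toSubmodule] at he ⊢
  exact (rootSum H (posSet b)).lie_mem (x := (⟨h, hh⟩ : H)) he

theorem lie_mem_nMinus {h : L} (hh : h ∈ H) {e : L} (he : e ∈ nMinus b) : ⁅h, e⁆ ∈ nMinus b := by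
  rw [← LieSubalgebra.mem_toSubmodule, nMinus_toSubmodule] at he ⊢
  exact (rootSum H (negSet b)).lie_mem (x := (⟨h, hh⟩ : H)) he

/-! ### Weight bases -/

/-- A basis of a subalgebra that consists of root vectors. -/
def IsWtBasis {ι : Type*} {n : LieSubalgebra ℂ L} (e : Basis ι ℂ n) (wt : ι → Dual ℂ H) : Prop :=
  ∀ i, (e i : L) ∈ rootSpace H (wt i)

/-- Root spaces are lines, and different weights give independent lines. -/
theorem exists_wtBasis {ι : Type*} {wt : ι → Dual ℂ H} (hinj : Function.Injective wt)
    (h0 : ∀ i, wt i ≠ 0) (hb : ∀ i, rootSpace H (wt i) ≠ ⊥) {n : LieSubalgebra ℂ L}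
    (hn : n.toSubmodule = (rootSum H (Set.range fun i => (wt i : H → ℂ))).toSubmodule) :
    ∃ e : Basis ι ℂ n, IsWtBasis e wt := by
  have hle : ∀ i, (rootSpace H (wt i)).toSubmodule ≤ n.toSubmodule := by
    intro i
    rw [hn]
    exact le_iSup₂_of_le (f := fun (χ : H → ℂ) (_ : χ ∈ _) => rootSpace H χ) _ ⟨i, rfl⟩ le_rfl
  have h1 : ∀ i, ∃ v : L, v ≠ 0 ∧ v ∈ rootSpace H (wt i) ∧
      (rootSpace H (wt i)).toSubmodule ≤ Submodule.span ℂ {v} := by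
    intro i
    obtain ⟨α, hα⟩ := exists_root_of_rootSpace_ne_bot (fun h => h0 i (DFunLike.coe_injective h)) (hb i)
    have h := IsKilling.finrank_rootSpace_eq_one (α : LieModule.Weight ℂ H L)
      (LieSubalgebra.isNonZero_coe_root α)
    rw [show ((α : LieModule.Weight ℂ H L) : H → ℂ) = wt i from hα] at h
    obtain ⟨v, hv, hv'⟩ := finrank_eq_one_iff'.1 h
    refine ⟨v, fun h => hv (Subtype.ext h), v.2, fun w hw => ?_⟩
    obtain ⟨c, hc⟩ := hv' ⟨w, hw⟩
    rw [Submodule.mem_span_singleton]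
    exact ⟨c, congrArg Subtype.val hc⟩
  choose v hv0 hv hspan using h1
  have hli : LinearIndependent ℂ v := by
    have := ((LieModule.iSupIndep_genWeightSpace ℂ H L).comp
      (DFunLike.coe_injective.comp hinj : Function.Injective fun i => (wt i : H → ℂ)))
    rw [← LieSubmodule.iSupIndep_toSubmodule] at this
    exact this.linearIndependent _ hv hv0
  have hspan' : n.toSubmodule ≤ Submodule.span ℂ (Set.range v) := by
    rw [hn, rootSum]
    simp only [LieSubmodule.iSup_toSubmodule]
    refine iSup₂_le ?_
    rintro _ ⟨i, rfl⟩
    exact (hspan i).trans (Submodule.span_mono (by rintro _ rfl; exact ⟨i, rfl⟩))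
  let w : ι → n := fun i => ⟨v i, hle i (hv i)⟩
  have hw : LinearIndependent ℂ w := LinearIndependent.of_comp n.toSubmodule.subtype hli
  refine ⟨Basis.mk hw ?_, fun i => by rw [Basis.mk_apply]; exact hv i⟩
  rintro ⟨x, hx⟩ -
  have hx' := hspan' hx
  have hr : Set.range v = n.toSubmodule.subtype '' Set.range w := by rw [← Set.range_comp]; rfl
  rw [hr, ← Submodule.map_span, Submodule.mem_map] at hx'
  obtain ⟨y, hy, hyx⟩ := hx'
  rwa [show (⟨x, hx⟩ : n) = y from Subtype.ext hyx.symm]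

/-- Compare coefficients in `[h, x] = χ(h) x`, with `x` expanded in the basis of root vectors. -/
theorem mem_span_of_mem_rootSpace {ι : Type*} [Fintype ι] {n : LieSubalgebra ℂ L}
    {e : Basis ι ℂ n} {wt : ι → Dual ℂ H} (he : IsWtBasis e wt) {χ : Dual ℂ H} {x : n}
    (hx : (x : L) ∈ rootSpace H χ) : x ∈ Submodule.span ℂ (e '' {k | wt k = χ}) := by
  rw [Basis.mem_span_image]
  intro i hi
  rw [Set.mem_ofPred_eq]
  ext h
  rw [Finset.mem_coe, Finsupp.mem_support_iff] at hi
  have hli : LinearIndependent ℂ fun i => (e i : L) :=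
    e.linearIndependent.map' n.toSubmodule.subtype (Submodule.ker_subtype _)
  have hx1 : (x : L) = ∑ j, e.repr x j • (e j : L) := by
    have h1 := congrArg n.toSubmodule.subtype (e.sum_repr x)
    rw [map_sum] at h1
    exact h1.symm
  have h1 := IsKilling.lie_eq_smul_of_mem_rootSpace hx h
  rw [hx1, LieSubalgebra.coe_bracket_of_module, lie_sum, Finset.smul_sum, ← sub_eq_zero,
    ← Finset.sum_sub_distrib] at h1
  have h2 : ∑ j, (e.repr x j * (wt j h - χ h)) • (e j : L) = 0 := by
    rw [← h1]
    refine Finset.sum_congr rfl fun j _ => ?_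
    rw [lie_smul, ← LieSubalgebra.coe_bracket_of_module,
      IsKilling.lie_eq_smul_of_mem_rootSpace (he j) h]
    module
  have h3 := Fintype.linearIndependent_iff.1 hli _ h2 i
  exact sub_eq_zero.1 ((mul_eq_zero.1 h3).resolve_left hi)

/-- The adjoint representation of `L` is faithful, and its restriction to the subalgebra factors
through the enveloping algebra. -/
theorem gen_injective (n : LieSubalgebra ℂ L) : Function.Injective (gen : n → U n) := by
  intro x y hxy
  have h := congrArg (UniversalEnvelopingAlgebra.lift ℂ ((LieAlgebra.ad ℂ L).comp n.incl)) hxy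
  rw [lift_gen, lift_gen] at h
  have hi : Function.Injective (LieAlgebra.ad ℂ L) := by
    rw [← LieHom.ker_eq_bot, LieAlgebra.ad_ker_eq_self_module_ker, LieModule.ker_eq_bot]
  exact Subtype.ext (hi h)

/-! ### Ordered monomials as bases of the weight spaces of `U 𝔫`. -/

section MonWeights

variable {ι : Type*} [Fintype ι] {n : LieSubalgebra ℂ L} {e : Basis ι ℂ n} {wt : ι → Dual ℂ H}

theorem lie_mem_span_of_isWtBasis (he : IsWtBasis e wt) (i j : ι) :
    ⁅e i, e j⁆ ∈ Submodule.span ℂ (e '' {k | wt k = wt i + wt j}) :=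
  mem_span_of_mem_rootSpace he (lie_mem_genWeightSpace_of_mem_genWeightSpace (he i) (he j))

variable [LinearOrder ι]

theorem wtSpace_eq_span_mon (he : IsWtBasis e wt) (γ : Dual ℂ H) :
    wtSpace n γ = Submodule.span ℂ (mon e '' {s | (s.map wt).sum = γ}) := by
  apply le_antisymm
  · refine Submodule.span_le.2 ?_
    rintro _ ⟨l, hl, rfl, rfl⟩
    have hw : Submodule.span ℂ {u : U n | ∃ l' : List ι, (l'.map wt).sum = (l.map Prod.fst).sum ∧
        u = (l'.map fun i => gen (e i)).prod} ≤
        Submodule.span ℂ (mon e '' {s | (s.map wt).sum = (l.map Prod.fst).sum}) := by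
      refine Submodule.span_le.2 ?_
      rintro _ ⟨l', h, rfl⟩
      rw [← h]
      exact prod_mem_span_mon (lie_mem_span_of_isWtBasis he) l'
    refine hw ?_
    clear hw
    induction l with
    | nil => exact Submodule.subset_span ⟨[], by simp, by simp⟩
    | cons p l ih =>
      have h1 : gen p.2 ∈ Submodule.span ℂ ((fun i => gen (e i)) '' {k | wt k = p.1}) := by
        have := Submodule.mem_map_of_mem (f := (UniversalEnvelopingAlgebra.ι ℂ : n →ₗ⁅ℂ⁆ U n).toLinearMap)
          (mem_span_of_mem_rootSpace he (hl p List.mem_cons_self))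
        rwa [Submodule.map_span, ← Set.image_comp] at this
      have h2 := Submodule.mul_mem_mul h1 (ih fun q hq => hl q (List.mem_cons_of_mem _ hq))
      rw [Submodule.span_mul_span] at h2
      refine Submodule.span_mono ?_ h2
      rintro _ ⟨_, ⟨i, hi, rfl⟩, _, ⟨l', hl', rfl⟩, rfl⟩
      exact ⟨i :: l', by simp only [List.map_cons, List.sum_cons, hl']; rw [hi], by simp⟩
  · refine Submodule.span_le.2 ?_
    rintro _ ⟨s, rfl, rfl⟩
    refine Submodule.subset_span ⟨s.sort.map fun i => (wt i, e i), ?_, ?_, ?_⟩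
    · intro p hp
      obtain ⟨i, -, rfl⟩ := List.mem_map.1 hp
      exact he i
    · rw [List.map_map]
      conv_rhs => rw [← Multiset.sort_eq s (· ≤ ·)]
      rw [Multiset.map_coe, Multiset.sum_coe]
      rfl
    · rw [List.map_map]; rfl

theorem span_mon (he : IsWtBasis e wt) : Submodule.span ℂ (Set.range (mon e)) = ⊤ := by
  have hw : Submodule.span ℂ {u : U n | ∃ l : List ι, u = (l.map fun i => gen (e i)).prod} ≤
      Submodule.span ℂ (Set.range (mon e)) := by
    refine Submodule.span_le.2 ?_
    rintro _ ⟨l, rfl⟩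
    exact Submodule.span_mono (Set.image_subset_range _ _)
      (prod_mem_span_mon (lie_mem_span_of_isWtBasis he) l)
  rw [eq_top_iff]
  refine fun u _ => hw (mem_of_left_stable ?_ ?_ u)
  · exact Submodule.subset_span ⟨[], by simp⟩
  · intro x u hu
    have h1 : gen x ∈ Submodule.span ℂ (Set.range fun i => gen (e i)) := by
      have := Submodule.mem_map_of_mem (f := (UniversalEnvelopingAlgebra.ι ℂ : n →ₗ⁅ℂ⁆ U n).toLinearMap)
        (e.mem_span x)
      rwa [Submodule.map_span, ← Set.range_comp] at this
    have h2 := Submodule.mul_mem_mul h1 hu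
    rw [Submodule.span_mul_span] at h2
    refine Submodule.span_mono ?_ h2
    rintro _ ⟨_, ⟨i, rfl⟩, _, ⟨l, rfl⟩, rfl⟩
    exact ⟨i :: l, by simp⟩

theorem finrank_wtSpace (he : IsWtBasis e wt) {γ : Dual ℂ H}
    (hfin : {s : Multiset ι | (s.map wt).sum = γ}.Finite) :
    FiniteDimensional ℂ (wtSpace n γ) ∧
      finrank ℂ (wtSpace n γ) = {s : Multiset ι | (s.map wt).sum = γ}.ncard := by
  rw [wtSpace_eq_span_mon he]
  have hli := linearIndependent_mon (gen_injective n) e.linearIndependent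
  refine ⟨FiniteDimensional.span_of_finite ℂ (hfin.image _), ?_⟩
  have := hfin.fintype
  have h2 : LinearIndependent ℂ
      (fun s : {s : Multiset ι | (s.map wt).sum = γ} => mon e (s : Multiset ι)) :=
    hli.comp _ Subtype.val_injective
  rw [Set.image_eq_range, finrank_span_eq_card h2, ← Nat.card_eq_fintype_card]
  rfl

end MonWeights

/-- Negation exchanges positive and negative roots, so one index set serves both bases. This makes
the dimensions of opposite weight spaces equal in `finrank_wtSpace_eq`. -/
theorem exists_wtBases : ∃ (N : ℕ) (wt : Fin N → Dual ℂ H) (e : Basis (Fin N) ℂ (nPlus b))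
    (f : Basis (Fin N) ℂ (nMinus b)), (∀ i, wt i ∈ Qplus b) ∧ IsWtBasis e wt ∧
      IsWtBasis f (fun i => -wt i) := by
  classical
  let R := {α : H.root // (IsKilling.rootSystem H).root α ∈ Qplus b}
  let eq : Fin (Fintype.card R) ≃ R := (Fintype.equivFin R).symm
  let wt : Fin (Fintype.card R) → Dual ℂ H := fun i => (IsKilling.rootSystem H).root (eq i).1
  have hinj : Function.Injective wt := fun i j h =>
    eq.injective (Subtype.ext ((IsKilling.rootSystem H).root.injective h))
  have hne : ∀ α : H.root, rootSpace H ((IsKilling.rootSystem H).root α) ≠ ⊥ := fun α =>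
    (α : LieModule.Weight ℂ H L).genWeightSpace_ne_bot
  have hsum : ∀ S T : Set (H → ℂ), S ⊆ T → (∀ χ ∈ T, rootSpace H χ ≠ ⊥ → χ ∈ S) →
      rootSum H T = rootSum H S := by
    intro S T h h'
    refine le_antisymm (iSup₂_le fun χ hχ => ?_) (biSup_mono h)
    by_cases hb : rootSpace H χ = ⊥
    · exact (le_of_eq hb).trans bot_le
    · exact le_iSup₂_of_le (f := fun (χ : H → ℂ) _ => rootSpace H χ) χ (h' χ hχ hb) le_rfl
  obtain ⟨e, he⟩ := exists_wtBasis (n := nPlus b) hinj (fun i => (eq i).2.1) (fun i => hne _) (by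
    rw [nPlus_toSubmodule, hsum]
    · rintro _ ⟨i, rfl⟩; exact ⟨_, (eq i).2, rfl⟩
    · intro χ hχ hb
      obtain ⟨α, rfl⟩ := exists_root_of_rootSpace_ne_bot
        (fun h => zero_notMem_posSet b (h ▸ hχ)) hb
      refine ⟨eq.symm ⟨α, (mem_posSet b).1 hχ⟩, ?_⟩
      simp only [wt, Equiv.apply_symm_apply])
  have hneg : ∀ α : H.root, ∃ α' : H.root, (IsKilling.rootSystem H).root α' =
      -(IsKilling.rootSystem H).root α := by
    rintro ⟨α, hα⟩
    exact ⟨⟨-α, by simpa using hα⟩, rfl⟩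
  obtain ⟨f, hf⟩ := exists_wtBasis (n := nMinus b) (wt := fun i => -wt i)
    (fun i j h => hinj (neg_injective h)) (fun i => neg_ne_zero.2 (eq i).2.1) (fun i => by
      obtain ⟨α', h⟩ := hneg (eq i).1
      simp only [wt]
      rw [← h]; exact hne _) (by
    rw [nMinus_toSubmodule, hsum]
    · rintro _ ⟨i, rfl⟩; exact ⟨-wt i, by rw [neg_neg]; exact (eq i).2, rfl⟩
    · intro χ hχ hb
      obtain ⟨α, rfl⟩ := exists_root_of_rootSpace_ne_bot
        (fun h => zero_notMem_negSet b (h ▸ hχ)) hb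
      obtain ⟨α', h⟩ := hneg α
      refine ⟨eq.symm ⟨α', by rw [h]; exact (mem_negSet b).1 hχ⟩, ?_⟩
      simp only [wt, Equiv.apply_symm_apply, h, neg_neg])
  exact ⟨_, wt, e, f, fun i => (eq i).2, he, hf⟩

/-- Each letter contributes at least one to the height, so the height of `γ` bounds the size of the
multiset and hence all multiplicities. -/
theorem finite_multiset_of_sum_eq {ι : Type*} [Fintype ι] {wt : ι → Dual ℂ H}
    (hwt : ∀ i, wt i ∈ Qplus b) (γ : Dual ℂ H) : {s : Multiset ι | (s.map wt).sum = γ}.Finite := by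
  classical
  have hcard : ∀ s : Multiset ι, ∃ k : ℕ, s.card ≤ k ∧ (s.map wt).sum (grading b) = k := by
    intro s
    induction s using Multiset.induction with
    | empty => exact ⟨0, by simp, by simp⟩
    | cons i s ih =>
      obtain ⟨k, hk, hk'⟩ := ih
      obtain ⟨l, hl, hl'⟩ := height_of_mem_Qplus b (hwt i)
      refine ⟨l + k, by rw [Multiset.card_cons]; omega, ?_⟩
      rw [Multiset.map_cons, Multiset.sum_cons, LinearMap.add_apply, hl', hk', Nat.cast_add]
  by_cases hex : ∃ s₀ : Multiset ι, (s₀.map wt).sum = γ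
  · obtain ⟨s₀, rfl⟩ := hex
    obtain ⟨N, -, hN⟩ := hcard s₀
    refine (Set.finite_Iic (N • (Finset.univ : Finset ι).val)).subset ?_
    intro s hs
    obtain ⟨k, hk, hk'⟩ := hcard s
    rw [Set.mem_ofPred_eq] at hs
    rw [hs, hN, Nat.cast_inj] at hk'
    rw [Set.mem_Iic, Multiset.le_iff_count]
    intro i
    rw [Multiset.count_nsmul, Multiset.count_eq_one_of_mem Finset.univ.nodup (Finset.mem_univ_val i)]
    have := Multiset.count_le_card i s
    omega
  · refine Set.finite_empty.subset fun s hs => hex ⟨s, hs⟩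

theorem finiteDimensional_wtSpace_nPlus (γ : Dual ℂ H) :
    FiniteDimensional ℂ (wtSpace (nPlus b) γ) := by
  obtain ⟨N, wt, e, f, hwt, he, hf⟩ := exists_wtBases b
  exact (finrank_wtSpace he (finite_multiset_of_sum_eq b hwt γ)).1

theorem multiset_sum_map_neg {ι G : Type*} [AddCommGroup G] (wt : ι → G) (s : Multiset ι) :
    (s.map fun i => -wt i).sum = -(s.map wt).sum := by
  rw [← Multiset.sum_map_neg', Multiset.map_map]; rfl

theorem multiset_sum_neg {ι G : Type*} [AddCommGroup G] (wt : ι → G) (γ : G) :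
    {s : Multiset ι | (s.map fun i => -wt i).sum = -γ} = {s | (s.map wt).sum = γ} := by
  ext s
  rw [Set.mem_ofPred_eq, Set.mem_ofPred_eq, multiset_sum_map_neg, neg_inj]

theorem finiteDimensional_wtSpace_nMinus (γ : Dual ℂ H) :
    FiniteDimensional ℂ (wtSpace (nMinus b) (-γ)) := by
  obtain ⟨N, wt, e, f, hwt, he, hf⟩ := exists_wtBases b
  refine (finrank_wtSpace hf ?_).1
  rw [multiset_sum_neg]
  exact finite_multiset_of_sum_eq b hwt γ

theorem finrank_wtSpace_eq (γ : Dual ℂ H) :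
    finrank ℂ (wtSpace (nPlus b) γ) = finrank ℂ (wtSpace (nMinus b) (-γ)) := by
  obtain ⟨N, wt, e, f, hwt, he, hf⟩ := exists_wtBases b
  have hfin := finite_multiset_of_sum_eq b hwt γ
  rw [(finrank_wtSpace he hfin).2, (finrank_wtSpace hf (by rwa [multiset_sum_neg])).2,
    multiset_sum_neg]

theorem sum_mem_Qplus {ι : Type*} {wt : ι → Dual ℂ H} (hwt : ∀ i, wt i ∈ Qplus b)
    {s : Multiset ι} (hs : s ≠ 0) : (s.map wt).sum ∈ Qplus b := by
  induction s using Multiset.induction with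
  | empty => exact absurd rfl hs
  | cons i s ih =>
    rw [Multiset.map_cons, Multiset.sum_cons]
    by_cases h : s = 0
    · subst h; simpa using hwt i
    · exact add_mem_Qplus b (hwt i) (ih h)

variable {b}

/-- `U 𝔫₊` is spanned by `1` and by its weight spaces with weight in `Q₊`. -/
@[elab_as_elim]
theorem nPlus_induction {C : U (nPlus b) → Prop} (one : C 1)
    (wt : ∀ γ ∈ Qplus b, ∀ x ∈ wtSpace (nPlus b) γ, C x)
    (add : ∀ u v, C u → C v → C (u + v)) (smul : ∀ (c : ℂ) u, C u → C (c • u))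
    (u : U (nPlus b)) : C u := by
  obtain ⟨N, w, e, f, hw, he, hf⟩ := exists_wtBases b
  have hu : u ∈ Submodule.span ℂ (Set.range (mon e)) := by rw [span_mon he]; trivial
  induction hu using Submodule.span_induction with
  | mem x hx =>
    obtain ⟨s, rfl⟩ := hx
    by_cases hs : s = 0
    · rw [hs, mon_zero]; exact one
    · refine wt _ (sum_mem_Qplus b hw hs) _ ?_
      rw [wtSpace_eq_span_mon he]
      exact Submodule.subset_span ⟨s, rfl, rfl⟩
  | zero => simpa using smul 0 1 one
  | add u v _ _ hu hv => exact add u v hu hv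
  | smul c u _ hu => exact smul c u hu

/-- `U 𝔫₋` is spanned by `1` and by its weight spaces with weight in `-Q₊`. -/
@[elab_as_elim]
theorem nMinus_induction {C : U (nMinus b) → Prop} (one : C 1)
    (wt : ∀ γ ∈ Qplus b, ∀ x ∈ wtSpace (nMinus b) (-γ), C x)
    (add : ∀ u v, C u → C v → C (u + v)) (smul : ∀ (c : ℂ) u, C u → C (c • u))
    (u : U (nMinus b)) : C u := by
  obtain ⟨N, w, e, f, hw, he, hf⟩ := exists_wtBases b
  have hu : u ∈ Submodule.span ℂ (Set.range (mon f)) := by rw [span_mon hf]; trivial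
  induction hu using Submodule.span_induction with
  | mem x hx =>
    obtain ⟨s, rfl⟩ := hx
    by_cases hs : s = 0
    · rw [hs, mon_zero]; exact one
    · refine wt _ (sum_mem_Qplus b hw hs) _ ?_
      rw [wtSpace_eq_span_mon hf]
      exact Submodule.subset_span ⟨s, multiset_sum_map_neg w s, rfl⟩
  | zero => simpa using smul 0 1 one
  | add u v _ _ hu hv => exact add u v hu hv
  | smul c u _ hu => exact smul c u hu

end Roots

/-! ### The Harish-Chandra projection -/

section HarishChandra

variable {L : Type u} [LieRing L] [LieAlgebra ℂ L] [FiniteDimensional ℂ L]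
  [LieAlgebra.IsKilling ℂ L] {H : LieSubalgebra ℂ L} [H.IsCartanSubalgebra]
  (b : (IsKilling.rootSystem H).Base)

/-- The projection `L → 𝔫₋` along `𝔥 + 𝔫₊`. -/
def prMinus : L →ₗ[ℂ] nMinus b := Submodule.projectionOnto _ _ (isCompl_nMinus b)

/-- The extension of `λ ∈ 𝔥*` to `L` by zero on `𝔫₋ + 𝔫₊`. -/
def extWt (lam : Dual ℂ H) : L →ₗ[ℂ] ℂ := lam ∘ₗ Submodule.projectionOnto _ _ (isCompl_cartan b)

theorem prMinus_eq_zero {x : L} : prMinus b x = 0 ↔ x ∈ H.toSubmodule ⊔ (nPlus b).toSubmodule :=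
  Submodule.projectionOnto_apply_eq_zero_iff (isCompl_nMinus b)

theorem extWt_cartan (lam : Dual ℂ H) (h : H) : extWt b lam h = lam h :=
  congrArg lam (Submodule.projectionOnto_apply_left (isCompl_cartan b) h)

theorem extWt_nPlus (lam : Dual ℂ H) {e : L} (he : e ∈ nPlus b) : extWt b lam e = 0 := by
  rw [extWt, LinearMap.comp_apply,
    (Submodule.projectionOnto_apply_eq_zero_iff (isCompl_cartan b)).2 (Submodule.mem_sup_right he),
    map_zero]

theorem extWt_nMinus (lam : Dual ℂ H) {e : L} (he : e ∈ nMinus b) : extWt b lam e = 0 := by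
  rw [extWt, LinearMap.comp_apply,
    (Submodule.projectionOnto_apply_eq_zero_iff (isCompl_cartan b)).2 (Submodule.mem_sup_left he),
    map_zero]

theorem lie_cartan_cartan {x y : L} (hx : x ∈ H) (hy : y ∈ H) : ⁅x, y⁆ = 0 :=
  congrArg Subtype.val (trivial_lie_zero H H ⟨x, hx⟩ ⟨y, hy⟩)

theorem lie_mem_nPlus_of_borel {x y : L} (hx : x ∈ H.toSubmodule ⊔ (nPlus b).toSubmodule)
    (hy : y ∈ H.toSubmodule ⊔ (nPlus b).toSubmodule) : ⁅x, y⁆ ∈ nPlus b := by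
  obtain ⟨h, hh, e, he, rfl⟩ := Submodule.mem_sup.1 hx
  obtain ⟨h', hh', e', he', rfl⟩ := Submodule.mem_sup.1 hy
  rw [add_lie, lie_add, lie_add, lie_cartan_cartan hh hh', zero_add, ← lie_skew e h']
  exact add_mem (lie_mem_nPlus b hh he')
    (add_mem (neg_mem (lie_mem_nPlus b hh' he)) ((nPlus b).lie_mem he he'))

theorem isSplitting (lam : Dual ℂ H) : IsSplitting (nMinus b) (prMinus b) (extWt b lam) where
  pr_coe x := Submodule.projectionOnto_apply_left (isCompl_nMinus b) x
  chi_coe x := extWt_nMinus b lam x.2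
  pr_lie _ _ hx hy := (prMinus_eq_zero b).2 (Submodule.mem_sup_right
    (lie_mem_nPlus_of_borel b ((prMinus_eq_zero b).1 hx) ((prMinus_eq_zero b).1 hy)))
  chi_lie _ _ hx hy := extWt_nPlus b lam
    (lie_mem_nPlus_of_borel b ((prMinus_eq_zero b).1 hx) ((prMinus_eq_zero b).1 hy))

theorem vermaRep_nPlus_one (lam : Dual ℂ H) {e : L} (he : e ∈ nPlus b) :
    vermaRep (isSplitting b lam) (gen e) 1 = 0 := by
  rw [vermaRep_gen_one_of_pr_eq_zero _ ((prMinus_eq_zero b).2 (Submodule.mem_sup_right he)),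
    extWt_nPlus b lam he, zero_smul]

theorem vermaRep_cartan_one (lam : Dual ℂ H) (h : H) :
    vermaRep (isSplitting b lam) (gen (h : L)) 1 = lam h • 1 := by
  rw [vermaRep_gen_one_of_pr_eq_zero _ ((prMinus_eq_zero b).2 (Submodule.mem_sup_left h.2)),
    extWt_cartan b lam h]

theorem evalAt_gen (lam : Dual ℂ H) (h : H) : evalAt lam (gen h) = lam h := by
  rw [evalAt, lift_gen]; rfl

theorem vermaRep_emb_cartan_one (lam : Dual ℂ H) (c : U H) :
    vermaRep (isSplitting b lam) (emb H c) 1 = evalAt lam c • 1 := by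
  induction c using left_induction with
  | one => simp
  | gen_mul h c hc =>
    rw [map_mul, map_mul, Module.End.mul_apply, hc, emb_gen, map_smul, vermaRep_cartan_one,
      map_mul, evalAt_gen, smul_smul, mul_comm]
  | add c c' hc hc' => simp [hc, hc', add_smul]
  | smul r c hc => simp [hc, smul_smul]

/-- The coefficient of the highest weight vector of `u · 1` in the Verma module on `U 𝔫₋`. -/
def modelCoeff (lam : Dual ℂ H) : U L →ₗ[ℂ] ℂ :=
  (counit (nMinus b)).toLinearMap ∘ₗ LinearMap.applyₗ 1 ∘ₗ
    (vermaRep (isSplitting b lam)).toLinearMap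

theorem modelCoeff_apply (lam : Dual ℂ H) (u : U L) :
    modelCoeff b lam u = counit _ (vermaRep (isSplitting b lam) u 1) := rfl

/-- The subspace `𝔫₋ · U L + U L · 𝔫₊`. -/
def hcKer : Submodule ℂ (U L) :=
  Submodule.span ℂ {v | ∃ y ∈ nMinus b, ∃ u, v = gen y * u} ⊔
    Submodule.span ℂ {v | ∃ e ∈ nPlus b, ∃ u, v = u * gen e}

theorem gen_mul_mem_hcKer {y : L} (hy : y ∈ nMinus b) (u : U L) : gen y * u ∈ hcKer b :=
  Submodule.mem_sup_left (Submodule.subset_span ⟨y, hy, u, rfl⟩)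

theorem mul_gen_mem_hcKer {e : L} (he : e ∈ nPlus b) (u : U L) : u * gen e ∈ hcKer b :=
  Submodule.mem_sup_right (Submodule.subset_span ⟨e, he, u, rfl⟩)

theorem eq_zero_of_mem_hcKer {V : Type*} [AddCommGroup V] [Module ℂ V] {p : U L →ₗ[ℂ] V}
    (h1 : ∀ y ∈ nMinus b, ∀ u, p (gen y * u) = 0) (h2 : ∀ e ∈ nPlus b, ∀ u, p (u * gen e) = 0)
    {u : U L} (hu : u ∈ hcKer b) : p u = 0 := by
  have : hcKer b ≤ LinearMap.ker p := by
    refine sup_le (Submodule.span_le.2 ?_) (Submodule.span_le.2 ?_)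
    · rintro _ ⟨y, hy, u, rfl⟩; exact h1 y hy u
    · rintro _ ⟨e, he, u, rfl⟩; exact h2 e he u
  exact this hu

theorem modelCoeff_gen_mul (lam : Dual ℂ H) {y : L} (hy : y ∈ nMinus b) (u : U L) :
    modelCoeff b lam (gen y * u) = 0 := by
  rw [modelCoeff_apply, map_mul, Module.End.mul_apply,
    show gen y = emb (nMinus b) (gen ⟨y, hy⟩) from
      (emb_gen (nMinus b) ⟨y, hy⟩).symm, vermaRep_emb, map_mul,
    counit_gen, zero_mul]

theorem modelCoeff_mul_gen (lam : Dual ℂ H) {e : L} (he : e ∈ nPlus b) (u : U L) :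
    modelCoeff b lam (u * gen e) = 0 := by
  rw [modelCoeff_apply, map_mul, Module.End.mul_apply, vermaRep_nPlus_one b lam he, map_zero,
    map_zero]

theorem modelCoeff_emb_cartan (lam : Dual ℂ H) (c : U H) :
    modelCoeff b lam (emb H c) = evalAt lam c := by
  rw [modelCoeff_apply, vermaRep_emb_cartan_one, map_smul, map_one, smul_eq_mul, mul_one]

/-! ### `U 𝔥` as polynomial functions, the triangular decomposition, and the projection onto `U 𝔥`.
-/

theorem mul_comm_of_cartan (c d : U H) : c * d = d * c := by
  have hgen : ∀ (h : H) (d : U H), gen h * d = d * gen h := by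
    intro h d
    induction d using left_induction with
    | one => simp
    | gen_mul h' d hd =>
      have := gen_lie h h'
      rw [trivial_lie_zero H H h h', gen, map_zero] at this
      rw [← mul_assoc, sub_eq_zero.1 this.symm, mul_assoc, hd, mul_assoc]
    | add d d' hd hd' => rw [mul_add, add_mul, hd, hd']
    | smul r d hd => rw [mul_smul_comm, hd, smul_mul_assoc]
  induction c using left_induction with
  | one => simp
  | gen_mul h c hc => rw [mul_assoc, hc, ← mul_assoc, hgen, mul_assoc]
  | add c c' hc hc' => rw [mul_add, add_mul, hc, hc']
  | smul r c hc => rw [mul_smul_comm, ← hc, smul_mul_assoc]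

/-- Elements of `U 𝔥` are separated by evaluation at the points of `𝔥*`. -/
theorem eq_zero_of_evalAt {c : U H} (h : ∀ lam, evalAt lam c = 0) : c = 0 := by
  let _ : CommRing (U H) := { (inferInstance : Ring (U H)) with mul_comm := mul_comm_of_cartan }
  let e := Module.finBasis ℂ H
  let φ : MvPolynomial (Fin (finrank ℂ H)) ℂ →ₐ[ℂ] U H := MvPolynomial.aeval fun i => gen (e i)
  have hφ : c ∈ LinearMap.range φ.toLinearMap := by
    refine mem_of_left_stable (P := LinearMap.range φ.toLinearMap) ⟨1, map_one φ⟩ ?_ c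
    rintro x _ ⟨f, rfl⟩
    refine ⟨(∑ i, MvPolynomial.C (e.repr x i) * MvPolynomial.X i) * f, ?_⟩
    rw [AlgHom.toLinearMap_apply, map_mul]
    congr 1
    conv_rhs => rw [← e.sum_repr x]
    simp only [map_sum, map_mul, φ, MvPolynomial.aeval_X, gen, map_smul, Algebra.smul_def]
    refine Finset.sum_congr rfl fun i _ => ?_
    rw [MvPolynomial.algHom_C]
  obtain ⟨f, rfl⟩ := hφ
  -- A polynomial over `ℂ` vanishing at all points is zero; the point `v` is reached by the weight
  -- taking the values `v` on the basis `e`.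
  have hf : f = 0 := by
    refine MvPolynomial.funext fun v => ?_
    have h1 := h (e.constr ℂ v)
    have h2 : (evalAt (e.constr ℂ v)).comp φ = MvPolynomial.aeval v := by
      ext i
      have h3 : φ (MvPolynomial.X i) = gen (e i) := MvPolynomial.aeval_X _ i
      rw [AlgHom.comp_apply, h3, evalAt_gen, Basis.constr_basis, MvPolynomial.aeval_X]
    rw [map_zero, ← h1, AlgHom.toLinearMap_apply, ← AlgHom.comp_apply, h2]
    rfl
  rw [hf, map_zero]

/-- The triangular decomposition of `U L`. -/
theorem mem_triangular (u : U L) :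
    u ∈ mulSpan (nMinus b) (mulSpan H (LinearMap.range (emb (nPlus b)).toLinearMap)) := by
  have h1 : ∀ s : LieSubalgebra ℂ L, (1 : U L) ∈ LinearMap.range (emb s).toLinearMap :=
    fun s => ⟨1, map_one (emb s)⟩
  have hplus : ∀ c ∈ (nPlus b).toSubmodule, ∀ p ∈ LinearMap.range (emb (nPlus b)).toLinearMap,
      gen c * p ∈ LinearMap.range (emb (nPlus b)).toLinearMap := by
    rintro c hc _ ⟨x, rfl⟩
    exact ⟨gen ⟨c, hc⟩ * x, by rw [AlgHom.toLinearMap_apply, map_mul, emb_gen]; rfl⟩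
  have hborel : ∀ c ∈ H.toSubmodule ⊔ (nPlus b).toSubmodule,
      ∀ p ∈ mulSpan H (LinearMap.range (emb (nPlus b)).toLinearMap),
      gen c * p ∈ mulSpan H (LinearMap.range (emb (nPlus b)).toLinearMap) := fun c hc p hp =>
    mulSpan_left_stable (fun e he h hh => Submodule.mem_sup_right
      (by rw [← lie_skew]; exact neg_mem (lie_mem_nPlus b hh he))) hplus hc hp
  have hall : ∀ x : L, x ∈ (nMinus b).toSubmodule ⊔ (H.toSubmodule ⊔ (nPlus b).toSubmodule) :=
    fun x => by rw [(isCompl_nMinus b).sup_eq_top]; trivial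
  refine mem_of_left_stable ?_ (fun x u hu =>
    mulSpan_left_stable (fun c _ a _ => hall _) hborel (hall x) hu) u
  have := Submodule.mul_mem_mul (h1 (nMinus b)) (Submodule.mul_mem_mul (h1 H) (h1 (nPlus b)))
  rwa [one_mul, one_mul] at this

theorem emb_mul_sub_mem_hcKer (y : U (nMinus b)) (u : U L) :
    emb (nMinus b) y * u - counit _ y • u ∈ hcKer b := by
  induction y using left_induction with
  | one => simp
  | gen_mul a y hy =>
    rw [map_mul, map_mul, counit_gen, zero_mul, zero_smul, sub_zero, emb_gen, mul_assoc]
    exact gen_mul_mem_hcKer b a.2 _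
  | add y z hy hz =>
    rw [map_add, map_add, add_mul, add_smul, add_sub_add_comm]; exact add_mem hy hz
  | smul r y hy =>
    rw [map_smul, map_smul, smul_mul_assoc, smul_assoc, ← smul_sub]
    exact Submodule.smul_mem _ _ hy

theorem mul_emb_sub_mem_hcKer (x : U (nPlus b)) (u : U L) :
    u * emb (nPlus b) x - counit _ x • u ∈ hcKer b := by
  induction x using left_induction generalizing u with
  | one => simp
  | gen_mul a x hx =>
    have := add_mem (hx (u * gen (a : L)))
      (Submodule.smul_mem _ (counit _ x) (mul_gen_mem_hcKer b a.2 u))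
    rw [sub_add_cancel] at this
    rwa [map_mul, map_mul, counit_gen, zero_mul, zero_smul, sub_zero, emb_gen, ← mul_assoc]
  | add y z hy hz =>
    rw [map_add, map_add, mul_add, add_smul, add_sub_add_comm]; exact add_mem (hy u) (hz u)
  | smul r y hy =>
    rw [map_smul, map_smul, mul_smul_comm, smul_assoc, ← smul_sub]
    exact Submodule.smul_mem _ _ (hy u)

/-- The two spaces span by the triangular decomposition, since `U 𝔫₋` and `U 𝔫₊` act by their
counits modulo `hcKer`. They are disjoint because the Verma coefficient vanishes on `hcKer` and
equals evaluation at `λ` on `U 𝔥`, for every `λ`. -/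
theorem isCompl_hcKer : IsCompl (LinearMap.range (emb H).toLinearMap) (hcKer b) := by
  constructor
  · rw [Submodule.disjoint_def]
    rintro _ ⟨c, rfl⟩ hc
    rw [AlgHom.toLinearMap_apply] at hc ⊢
    rw [eq_zero_of_evalAt (c := c), map_zero]
    intro lam
    rw [← modelCoeff_emb_cartan b]
    exact eq_zero_of_mem_hcKer b (fun y hy u => modelCoeff_gen_mul b lam hy u)
      (fun e he u => modelCoeff_mul_gen b lam he u) hc
  · rw [codisjoint_iff, eq_top_iff]
    intro u _
    refine Submodule.mul_induction_on (mem_triangular b u) ?_ fun _ _ => add_mem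
    rintro _ ⟨y, rfl⟩ p hp
    rw [AlgHom.toLinearMap_apply, ← sub_add_cancel (emb (nMinus b) y * p) (counit _ y • p)]
    refine add_mem (Submodule.mem_sup_right (emb_mul_sub_mem_hcKer b y p))
      (Submodule.smul_mem _ _ ?_)
    refine Submodule.mul_induction_on hp ?_ fun _ _ => add_mem
    rintro _ ⟨c, rfl⟩ _ ⟨x, rfl⟩
    rw [AlgHom.toLinearMap_apply, AlgHom.toLinearMap_apply,
      ← sub_add_cancel (emb H c * emb (nPlus b) x) (counit _ x • emb H c)]
    exact add_mem (Submodule.mem_sup_right (mul_emb_sub_mem_hcKer b x _))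
      (Submodule.smul_mem _ _ (Submodule.mem_sup_left ⟨c, rfl⟩))

theorem emb_cartan_injective (b : (IsKilling.rootSystem H).Base) : Function.Injective (emb H).toLinearMap := by
  rw [injective_iff_map_eq_zero]
  intro c hc
  refine eq_zero_of_evalAt fun lam => ?_
  rw [← modelCoeff_emb_cartan b, ← AlgHom.toLinearMap_apply, hc, map_zero]

theorem exists_isHCProj : ∃ p, IsHCProj b p := by
  refine ⟨(LinearEquiv.ofInjective _ (emb_cartan_injective b)).symm.toLinearMap ∘ₗ
    Submodule.projectionOnto _ _ (isCompl_hcKer b), fun c => ?_, fun y hy u => ?_, fun e he u => ?_⟩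
  · rw [LinearMap.comp_apply, LinearEquiv.coe_coe, LinearEquiv.symm_apply_eq]
    exact Submodule.projectionOnto_apply_left (isCompl_hcKer b)
      (LinearEquiv.ofInjective _ (emb_cartan_injective b) c)
  · rw [LinearMap.comp_apply, (Submodule.projectionOnto_apply_eq_zero_iff (isCompl_hcKer b)).2
      (gen_mul_mem_hcKer b hy u), map_zero]
  · rw [LinearMap.comp_apply, (Submodule.projectionOnto_apply_eq_zero_iff (isCompl_hcKer b)).2
      (mul_gen_mem_hcKer b he u), map_zero]

theorem isHCProj_hcProj : IsHCProj b (hcProj b) := by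
  rw [hcProj, dif_pos (exists_isHCProj b)]
  exact (exists_isHCProj b).choose_spec

/-- The linear form `u ↦ (u)₀(λ)`. -/
def hwFun (lam : Dual ℂ H) : U L →ₗ[ℂ] ℂ := (evalAt lam).toLinearMap ∘ₗ hcProj b

/-! ### Rules for the linear form `u ↦ (u)₀(λ)`. -/

variable (lam : Dual ℂ H)

/-- Both forms vanish on `hcKer` and agree on `U 𝔥`. From here on `(u)₀(λ)` is computed as a
coefficient in the Verma module. -/
theorem hwFun_eq_modelCoeff : hwFun b lam = modelCoeff b lam := by
  ext u
  obtain ⟨_, ⟨c, rfl⟩, z, hz, rfl⟩ := Submodule.mem_sup.1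
    (by rw [(isCompl_hcKer b).sup_eq_top]; trivial :
      u ∈ LinearMap.range (emb H).toLinearMap ⊔ hcKer b)
  obtain ⟨h0, h1, h2⟩ := isHCProj_hcProj b
  rw [map_add, map_add, AlgHom.toLinearMap_apply, modelCoeff_emb_cartan,
    eq_zero_of_mem_hcKer b (fun y hy u => modelCoeff_gen_mul b lam hy u)
      (fun e he u => modelCoeff_mul_gen b lam he u) hz, hwFun, LinearMap.comp_apply, h0,
    LinearMap.comp_apply, eq_zero_of_mem_hcKer b h1 h2 hz, map_zero]
  rfl

theorem hwFun_gen_mul {y : L} (hy : y ∈ nMinus b) (u : U L) : hwFun b lam (gen y * u) = 0 := by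
  rw [hwFun_eq_modelCoeff, modelCoeff_gen_mul b lam hy]

theorem hwFun_mul_gen {e : L} (he : e ∈ nPlus b) (u : U L) : hwFun b lam (u * gen e) = 0 := by
  rw [hwFun_eq_modelCoeff, modelCoeff_mul_gen b lam he]

theorem hwFun_one : hwFun b lam 1 = 1 := by
  rw [hwFun_eq_modelCoeff, modelCoeff_apply]; simp

theorem hwFun_mul_cartan (u : U L) (h : H) :
    hwFun b lam (u * gen (h : L)) = lam h * hwFun b lam u := by
  rw [hwFun_eq_modelCoeff, modelCoeff_apply, map_mul, Module.End.mul_apply, vermaRep_cartan_one,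
    map_smul, map_smul]
  rfl

theorem hwFun_cartan_mul (h : H) (u : U L) :
    hwFun b lam (gen (h : L) * u) = lam h * hwFun b lam u := by
  rw [hwFun_eq_modelCoeff, modelCoeff_apply, map_mul, Module.End.mul_apply, vermaRep_gen,
    modelCoeff_apply]
  generalize (vermaRep (isSplitting b lam) u) 1 = w
  induction w using left_induction with
  | one =>
    rw [← vermaRep_gen (isSplitting b lam), vermaRep_cartan_one, map_smul, smul_eq_mul]
  | gen_mul a w _ =>
    rw [vermaOp_gen_mul, map_add, map_mul, map_mul, counit_gen,
      show ⁅(h : L), (a : L)⁆ = ((⟨_, lie_mem_nMinus b h.2 a.2⟩ : nMinus b) : L) from rfl,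
      vermaOp_coe (isSplitting b lam), map_mul, counit_gen]
    simp
  | add w w' hw hw' => simp only [map_add, hw, hw', mul_add]
  | smul r w hw => simp only [map_smul, hw, smul_eq_mul]; ring

theorem hwFun_emb_nMinus_mul (y : U (nMinus b)) (u : U L) :
    hwFun b lam (emb _ y * u) = counit _ y * hwFun b lam u := by
  have := eq_zero_of_mem_hcKer b (p := hwFun b lam) (fun y hy u => hwFun_gen_mul b lam hy u)
    (fun e he u => hwFun_mul_gen b lam he u) (emb_mul_sub_mem_hcKer b y u)
  rwa [map_sub, map_smul, sub_eq_zero] at this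

theorem hwFun_emb_nMinus (y : U (nMinus b)) : hwFun b lam (emb _ y) = counit _ y := by
  have := hwFun_emb_nMinus_mul b lam y 1
  rwa [mul_one, hwFun_one, mul_one] at this

theorem hwFun_emb_nPlus (x : U (nPlus b)) : hwFun b lam (emb _ x) = counit _ x := by
  have := eq_zero_of_mem_hcKer b (p := hwFun b lam) (fun y hy u => hwFun_gen_mul b lam hy u)
    (fun e he u => hwFun_mul_gen b lam he u) (mul_emb_sub_mem_hcKer b x 1)
  rwa [one_mul, map_sub, map_smul, sub_eq_zero, hwFun_one, smul_eq_mul, mul_one] at this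

theorem hwFun_emb_cartan_mul (c : U H) (u : U L) :
    hwFun b lam (emb H c * u) = evalAt lam c * hwFun b lam u := by
  induction c using left_induction with
  | one => simp
  | gen_mul h c hc =>
    rw [map_mul (emb H), mul_assoc, emb_gen, hwFun_cartan_mul, hc, map_mul, evalAt_gen, mul_assoc]
  | add c c' hc hc' => simp only [map_add, add_mul, hc, hc']
  | smul r c hc => simp only [map_smul, smul_mul_assoc, hc, smul_eq_mul]; ring

theorem shapPairing_apply (x : U (nPlus b)) (y : U (nMinus b)) :
    shapPairing b lam x y = hwFun b lam (antipode L (emb _ x) * emb _ y) := rfl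

end HarishChandra

/-! ### Irreducible quotients of Verma modules -/

section Irreducible

variable {L : Type u} [LieRing L] [LieAlgebra ℂ L] [FiniteDimensional ℂ L]
  [LieAlgebra.IsKilling ℂ L] {H : LieSubalgebra ℂ L} [H.IsCartanSubalgebra]
  (b : (IsKilling.rootSystem H).Base)

variable (lam : Dual ℂ H)

/-- The annihilator of the highest weight vector of `V(λ)`. -/
def annIdeal : Submodule (U L) (U L) where
  carrier := {u | ∀ a, hwFun b lam (a * u) = 0}
  add_mem' := fun {u v} hu hv a => by rw [mul_add, map_add, hu, hv, add_zero]
  zero_mem' := fun a => by rw [mul_zero, map_zero]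
  smul_mem' := fun c u hu a => by rw [smul_eq_mul, ← mul_assoc]; exact hu _

theorem hwFun_of_mem_annIdeal {u : U L} (hu : u ∈ annIdeal b lam) : hwFun b lam u = 0 := by
  simpa using hu 1

theorem one_notMem_annIdeal : (1 : U L) ∉ annIdeal b lam := fun h => by
  simpa [hwFun_one] using hwFun_of_mem_annIdeal b lam h

theorem gen_mem_vermaIdeal {e : L} (he : e ∈ nPlus b) : gen e ∈ vermaIdeal b lam :=
  Submodule.subset_span (Or.inl ⟨e, he, rfl⟩)

theorem cartan_sub_mem_vermaIdeal (h : H) :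
    gen (h : L) - algebraMap ℂ (U L) (lam h) ∈ vermaIdeal b lam :=
  Submodule.subset_span (Or.inr ⟨h, rfl⟩)

variable {b lam} in
theorem mul_mem_vermaIdeal (a : U L) {u : U L} (hu : u ∈ vermaIdeal b lam) :
    a * u ∈ vermaIdeal b lam := Submodule.smul_mem _ a hu

variable {b lam} in
theorem smul_mem_vermaIdeal (c : ℂ) {u : U L} (hu : u ∈ vermaIdeal b lam) :
    c • u ∈ vermaIdeal b lam := by
  rw [Algebra.smul_def]; exact mul_mem_vermaIdeal _ hu

theorem vermaIdeal_le_annIdeal : vermaIdeal b lam ≤ annIdeal b lam := by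
  refine Submodule.span_le.2 ?_
  rintro _ (⟨e, he, rfl⟩ | ⟨h, rfl⟩) a
  · exact hwFun_mul_gen b lam he a
  · rw [mul_sub, map_sub, hwFun_mul_cartan, ← Algebra.commutes, ← Algebra.smul_def, map_smul,
      smul_eq_mul, sub_self]

/-- In the decomposition `U 𝔫₋ · U 𝔥 · U 𝔫₊`, left factors from `U 𝔫₋` and `U 𝔥` only multiply the
form by a scalar. The antipode is harmless because it is an involution preserving `U 𝔫₊`. -/
theorem mem_annIdeal_of_nPlus {u : U L}
    (hu : ∀ x : U (nPlus b), hwFun b lam (antipode L (emb _ x) * u) = 0) : u ∈ annIdeal b lam := by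
  intro a
  refine Submodule.mul_induction_on (mem_triangular b a) ?_ fun _ _ h h' => by
    rw [add_mul, map_add, h, h', add_zero]
  rintro _ ⟨y, rfl⟩ p hp
  rw [AlgHom.toLinearMap_apply, mul_assoc, hwFun_emb_nMinus_mul]
  refine mul_eq_zero_of_right _ (Submodule.mul_induction_on hp ?_ fun _ _ h h' => by
    rw [add_mul, map_add, h, h', add_zero])
  rintro _ ⟨c, rfl⟩ _ ⟨x, rfl⟩
  rw [AlgHom.toLinearMap_apply, AlgHom.toLinearMap_apply, mul_assoc, hwFun_emb_cartan_mul]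
  refine mul_eq_zero_of_right _ ?_
  have := hu (antipode _ x)
  rwa [antipode_emb, antipode_antipode] at this

variable {b lam} in
-- Turns `K_λ`, defined by a pairing, into the annihilator in `U 𝔫₋` of the highest weight vector of
-- `V(λ)`; see `smul_hwVec_eq_zero`.
theorem mem_K_iff {y : U (nMinus b)} : y ∈ K b lam ↔ emb _ y ∈ annIdeal b lam := by
  rw [K, LinearMap.mem_ker]
  constructor
  · intro h
    exact mem_annIdeal_of_nPlus b lam fun x => LinearMap.congr_fun h x
  · intro h
    ext x
    exact h _

/-- The operators on `U 𝔫₋` compute the action on the quotient by `vermaIdeal`, which links the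
model to `M(λ)`. -/
theorem gen_mul_emb_sub_mem_vermaIdeal (x : L) (y : U (nMinus b)) :
    gen x * emb _ y - emb _ (vermaOp _ (prMinus b) (extWt b lam) x y) ∈ vermaIdeal b lam := by
  induction y using left_induction generalizing x with
  | one =>
    rw [vermaOp_one, map_one, mul_one, map_add, emb_gen, AlgHom.commutes]
    obtain ⟨y, hy, z, hz, rfl⟩ := Submodule.mem_sup.1
      (by rw [(isCompl_nMinus b).sup_eq_top]; trivial :
        x ∈ (nMinus b).toSubmodule ⊔ (H.toSubmodule ⊔ (nPlus b).toSubmodule))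
    obtain ⟨h, hh, e, he, rfl⟩ := Submodule.mem_sup.1 hz
    have hpr : (prMinus b (y + (h + e)) : L) = y := by
      rw [map_add, (prMinus_eq_zero b).2 hz, add_zero]
      exact congrArg Subtype.val ((isSplitting b lam).pr_coe ⟨y, hy⟩)
    have hchi : extWt b lam (y + (h + e)) = lam ⟨h, hh⟩ := by
      rw [map_add, map_add, extWt_nMinus b lam hy, extWt_nPlus b lam he]
      simpa using extWt_cartan b lam ⟨h, hh⟩
    rw [hpr, hchi, gen, map_add, map_add,
      show ∀ p q r s : U L, p + (q + r) - (p + s) = (q - s) + r by intros; abel]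
    exact add_mem (cartan_sub_mem_vermaIdeal b lam ⟨h, hh⟩) (gen_mem_vermaIdeal b lam he)
  | gen_mul a y hy =>
    have key : gen x * emb _ (gen a * y) - emb _ (vermaOp _ (prMinus b) (extWt b lam) x (gen a * y))
        = gen (a : L) * (gen x * emb _ y - emb _ (vermaOp _ (prMinus b) (extWt b lam) x y)) +
          (gen ⁅x, (a : L)⁆ * emb _ y -
            emb _ (vermaOp _ (prMinus b) (extWt b lam) ⁅x, (a : L)⁆ y)) := by
      rw [vermaOp_gen_mul, map_add, map_mul, map_mul, emb_gen, gen_lie]; noncomm_ring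
    rw [key]
    exact add_mem (mul_mem_vermaIdeal _ (hy x)) (hy _)
  | add y z hy hz =>
    rw [map_add, map_add, map_add, mul_add, add_sub_add_comm]; exact add_mem (hy x) (hz x)
  | smul r y hy =>
    rw [map_smul, map_smul, map_smul, mul_smul_comm, ← smul_sub]
    exact smul_mem_vermaIdeal r (hy x)

/-- Every element of `M(λ)` is the class of an element of `U 𝔫₋`. -/
theorem exists_sub_emb_mem_vermaIdeal (u : U L) :
    ∃ y : U (nMinus b), u - emb _ y ∈ vermaIdeal b lam := by
  induction u using left_induction with
  | one => exact ⟨1, by simp⟩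
  | gen_mul x u hu =>
    obtain ⟨y, hy⟩ := hu
    refine ⟨vermaOp _ (prMinus b) (extWt b lam) x y, ?_⟩
    have := add_mem (mul_mem_vermaIdeal (gen x) hy) (gen_mul_emb_sub_mem_vermaIdeal b lam x y)
    rwa [mul_sub, sub_add_sub_cancel] at this
  | add u v hu hv =>
    obtain ⟨y, hy⟩ := hu
    obtain ⟨z, hz⟩ := hv
    exact ⟨y + z, by rw [map_add, add_sub_add_comm]; exact add_mem hy hz⟩
  | smul c u hu =>
    obtain ⟨y, hy⟩ := hu
    exact ⟨c • y, by rw [map_smul, ← smul_sub]; exact smul_mem_vermaIdeal c hy⟩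

theorem vermaRep_of_mem_vermaIdeal {u : U L} (hu : u ∈ vermaIdeal b lam) :
    vermaRep (isSplitting b lam) u 1 = 0 := by
  induction hu using Submodule.span_induction with
  | mem u hu =>
    rcases hu with ⟨e, he, rfl⟩ | ⟨h, rfl⟩
    · exact vermaRep_nPlus_one b lam he
    · rw [map_sub, LinearMap.sub_apply, vermaRep_cartan_one, AlgHom.commutes,
        Module.algebraMap_end_apply, sub_self]
  | zero => simp
  | add u v _ _ hu hv => rw [map_add, LinearMap.add_apply, hu, hv, add_zero]
  | smul a u _ hu => rw [smul_eq_mul, map_mul, Module.End.mul_apply, hu, map_zero]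

theorem eq_zero_of_emb_mem_vermaIdeal {y : U (nMinus b)} (hy : emb _ y ∈ vermaIdeal b lam) :
    y = 0 := by
  simpa [vermaRep_emb] using vermaRep_of_mem_vermaIdeal b lam hy

theorem cartan_mul_emb {n : LieSubalgebra ℂ L} {γ : Dual ℂ H} {y : U n}
    (hy : y ∈ wtSpace n γ) (h : H) :
    gen (h : L) * emb n y = emb n y * gen (h : L) + γ h • emb n y := by
  induction hy using Submodule.span_induction with
  | mem y hy =>
    obtain ⟨l, hl, rfl, rfl⟩ := hy
    induction l with
    | nil => simp
    | cons p l ih =>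
      have ih' := ih fun q hq => hl q (List.mem_cons_of_mem _ hq)
      have hp : gen (h : L) * gen (p.2 : L) = gen (p.2 : L) * gen (h : L) + p.1 h • gen (p.2 : L) := by
        have hl' : ⁅(h : L), (p.2 : L)⁆ = p.1 h • (p.2 : L) :=
          IsKilling.lie_eq_smul_of_mem_rootSpace (hl p List.mem_cons_self) h
        rw [← sub_eq_iff_eq_add', ← gen_lie, hl', gen, map_smul]
      rw [List.map_cons, List.prod_cons, List.map_cons, List.sum_cons, map_mul, emb_gen,
        ← mul_assoc, hp, add_mul, mul_assoc, ih', LinearMap.add_apply, add_smul, mul_add,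
        mul_assoc, smul_mul_assoc, mul_smul_comm]
      abel
  | zero => simp
  | add y z _ _ hy hz => rw [map_add, mul_add, add_mul, hy, hz, smul_add]; abel
  | smul c y _ hy =>
    rw [map_smul, mul_smul_comm, smul_mul_assoc, hy, smul_add, smul_comm]

theorem aeval_sub_mem_vermaIdeal (q : Polynomial ℂ) (h : H) :
    Polynomial.aeval (gen (h : L)) q - algebraMap ℂ (U L) (q.eval (lam h)) ∈ vermaIdeal b lam := by
  obtain ⟨d, hd⟩ := Polynomial.X_sub_C_dvd_sub_C_eval (a := lam h) (p := q)
  have := congrArg (Polynomial.aeval (gen (h : L))) hd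
  rw [map_sub, Polynomial.aeval_C, mul_comm, map_mul, map_sub, Polynomial.aeval_X,
    Polynomial.aeval_C] at this
  rw [this]
  exact mul_mem_vermaIdeal _ (cartan_sub_mem_vermaIdeal b lam h)

/-- A polynomial in the grading element can kill all lower weight components of a vector of `M(λ)`
without killing the highest one. This lets a submodule be tested on its highest weight component. -/
theorem exists_polynomial_mul_emb (y : U (nMinus b)) : ∃ q : Polynomial ℂ,
    q.eval (lam (grading b)) ≠ 0 ∧ Polynomial.aeval (gen (grading b : L)) q * emb _ y -
      algebraMap ℂ (U L) (counit _ y * q.eval (lam (grading b))) ∈ vermaIdeal b lam := by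
  induction y using nMinus_induction with
  | one => exact ⟨1, by simp, by simp⟩
  | wt γ hγ y hy =>
    obtain ⟨k, hk, hk'⟩ := height_of_mem_Qplus b hγ
    -- The grading element acts on this component by `λ(h) - k`, where `k` is the height of `γ`. At
    -- `λ(h)` the polynomial takes the value `k ≠ 0`.
    refine ⟨Polynomial.X - Polynomial.C (lam (grading b) - k), by simp; omega, ?_⟩
    rw [counit_of_mem_wtSpace (neg_ne_zero.2 hγ.1) hy, zero_mul, map_zero, sub_zero, map_sub,
      Polynomial.aeval_X, Polynomial.aeval_C, sub_mul, cartan_mul_emb hy, LinearMap.neg_apply, hk',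
      map_sub, sub_mul, ← Algebra.smul_def, neg_smul, ← Algebra.smul_def]
    have := mul_mem_vermaIdeal (emb _ y) (cartan_sub_mem_vermaIdeal b lam (grading b))
    rw [mul_sub, ← Algebra.commutes, ← Algebra.smul_def] at this
    convert this using 1
    abel
  | add y z hy hz =>
    obtain ⟨q, hq, hqy⟩ := hy
    obtain ⟨r, hr, hrz⟩ := hz
    refine ⟨q * r, by rw [Polynomial.eval_mul]; exact mul_ne_zero hq hr, ?_⟩
    set g := gen (grading b : L)
    set l := lam (grading b)
    have h1 := add_mem (mul_mem_vermaIdeal (Polynomial.aeval g r) hqy)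
      (mul_mem_vermaIdeal (algebraMap ℂ (U L) (counit _ y * q.eval l))
        (aeval_sub_mem_vermaIdeal b lam r (grading b)))
    have h2 := add_mem (mul_mem_vermaIdeal (Polynomial.aeval g q) hrz)
      (mul_mem_vermaIdeal (algebraMap ℂ (U L) (counit _ z * r.eval l))
        (aeval_sub_mem_vermaIdeal b lam q (grading b)))
    have hcomm : Polynomial.aeval g q * Polynomial.aeval g r =
        Polynomial.aeval g r * Polynomial.aeval g q := by rw [← map_mul, mul_comm, map_mul]
    have hsc : algebraMap ℂ (U L) (counit _ (y + z) * (q * r).eval l) =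
        algebraMap ℂ (U L) (counit _ y * q.eval l) * algebraMap ℂ (U L) (r.eval l) +
        algebraMap ℂ (U L) (counit _ z * r.eval l) * algebraMap ℂ (U L) (q.eval l) := by
      rw [← map_mul, ← map_mul, ← map_add, map_add, Polynomial.eval_mul]
      congr 1
      ring
    have hmul : Polynomial.aeval g (q * r) * emb _ (y + z) =
        Polynomial.aeval g r * (Polynomial.aeval g q * emb _ y) +
        Polynomial.aeval g q * (Polynomial.aeval g r * emb _ z) := by
      rw [map_add, mul_add, ← mul_assoc, ← mul_assoc, ← hcomm, map_mul]
    rw [hsc, hmul]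
    convert add_mem h1 h2 using 1
    rw [mul_sub, mul_sub, mul_sub, mul_sub, Algebra.commutes _ (Polynomial.aeval g r),
      Algebra.commutes _ (Polynomial.aeval g q)]
    abel
  | smul c y hy =>
    obtain ⟨q, hq, hqy⟩ := hy
    refine ⟨q, hq, ?_⟩
    convert smul_mem_vermaIdeal c hqy using 1
    rw [map_smul, map_smul, smul_sub, mul_smul_comm, smul_eq_mul, mul_assoc, map_mul,
      ← Algebra.smul_def]

/-- If some element of `I` had a nonzero highest weight coefficient, projecting to that component
would put a nonzero scalar in `I`. So the coefficient vanishes on `I`, and `I` is a left ideal. -/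
theorem le_annIdeal_of_ne_top {I : Submodule (U L) (U L)} (hI : vermaIdeal b lam ≤ I)
    (hne : I ≠ ⊤) : I ≤ annIdeal b lam := by
  have h0 : ∀ u ∈ I, hwFun b lam u = 0 := by
    intro u hu
    obtain ⟨y, hy⟩ := exists_sub_emb_mem_vermaIdeal b lam u
    have hyI : emb _ y ∈ I := by
      have := sub_mem hu (hI hy)
      rwa [sub_sub_cancel] at this
    obtain ⟨q, hq, hqy⟩ := exists_polynomial_mul_emb b lam y
    have h1 := hwFun_of_mem_annIdeal b lam (vermaIdeal_le_annIdeal b lam hy)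
    rw [map_sub, hwFun_emb_nMinus, sub_eq_zero] at h1
    rw [h1]
    by_contra hc
    apply hne
    have h2 := sub_mem (I.smul_mem (Polynomial.aeval (gen (grading b : L)) q) hyI) (hI hqy)
    rw [smul_eq_mul, sub_sub_cancel] at h2
    have h3 := I.smul_mem (algebraMap ℂ (U L) (counit _ y * q.eval (lam (grading b)))⁻¹) h2
    rw [smul_eq_mul, ← map_mul, inv_mul_cancel₀ (mul_ne_zero hc hq), map_one] at h3
    exact Ideal.eq_top_iff_one I |>.2 h3
  exact fun u hu a => h0 _ (I.smul_mem a hu)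

theorem maxSub_eq : maxSub b lam = (annIdeal b lam).map (vermaIdeal b lam).mkQ := by
  apply le_antisymm
  · refine sSup_le fun N hN => ?_
    rw [← Submodule.map_comap_eq_of_surjective (Submodule.mkQ_surjective _) N]
    refine Submodule.map_mono (le_annIdeal_of_ne_top b lam ?_ fun h => hN ?_)
    · conv_lhs => rw [← Submodule.ker_mkQ (vermaIdeal b lam)]
      exact LinearMap.ker_le_comap _
    · rw [← Submodule.map_comap_eq_of_surjective (Submodule.mkQ_surjective _) N, h,
        Submodule.map_top, Submodule.range_mkQ]
  · refine le_sSup fun h => ?_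
    have h1 : (vermaIdeal b lam).mkQ 1 ∈ (annIdeal b lam).map (vermaIdeal b lam).mkQ := by
      rw [h]; trivial
    obtain ⟨u, hu, hu1⟩ := h1
    rw [← sub_eq_zero, ← map_sub, ← LinearMap.mem_ker, Submodule.ker_mkQ] at hu1
    have := sub_mem hu (vermaIdeal_le_annIdeal b lam hu1)
    rw [sub_sub_cancel] at this
    exact one_notMem_annIdeal b lam this

theorem smul_hwVec (u : U L) :
    u • hwVec b lam = (maxSub b lam).mkQ ((vermaIdeal b lam).mkQ u) := by
  rw [hwVec, ← map_smul, ← map_smul, smul_eq_mul, mul_one]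

variable {lam} in
theorem smul_hwVec_eq_zero {u : U L} : u • hwVec b lam = 0 ↔ u ∈ annIdeal b lam := by
  rw [smul_hwVec, ← LinearMap.mem_ker, Submodule.ker_mkQ, maxSub_eq]
  constructor
  · rintro ⟨v, hv, hvu⟩
    rw [← sub_eq_zero, ← map_sub, ← LinearMap.mem_ker, Submodule.ker_mkQ] at hvu
    have := sub_mem hv (vermaIdeal_le_annIdeal b lam hvu)
    rwa [sub_sub_cancel] at this
  · exact fun h => ⟨u, h, rfl⟩

theorem exists_smul_hwVec (v : Irr b lam) : ∃ u : U L, u • hwVec b lam = v := by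
  obtain ⟨w, rfl⟩ := Submodule.mkQ_surjective _ v
  obtain ⟨u, rfl⟩ := Submodule.mkQ_surjective _ w
  exact ⟨u, smul_hwVec b lam u⟩

/-! ### The Shapovalov pairing -/

/-- Simplicity of `M(λ)` makes its largest proper submodule zero, and `U 𝔫₋` embeds in `M(λ)`. -/
theorem K_eq_bot_of_isGeneric (hg : IsGeneric b lam) {y : U (nMinus b)} (hy : y ∈ K b lam) :
    y = 0 := by
  have : IsSimpleModule (U L) (Verma b lam) := hg
  rw [mem_K_iff] at hy
  have hmem : (vermaIdeal b lam).mkQ (emb _ y) ∈ maxSub b lam := by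
    rw [maxSub_eq]; exact ⟨_, hy, rfl⟩
  rcases eq_bot_or_eq_top (maxSub b lam) with h | h
  · rw [h, Submodule.mem_bot, ← LinearMap.mem_ker, Submodule.ker_mkQ] at hmem
    exact eq_zero_of_emb_mem_vermaIdeal b lam hmem
  · exfalso
    have h1 : (1 : U L) • hwVec b lam = 0 := by
      rw [smul_hwVec, ← LinearMap.mem_ker, Submodule.ker_mkQ, h]; trivial
    exact one_notMem_annIdeal b lam ((smul_hwVec_eq_zero b).1 h1)

variable {b} in
-- The element `S(x) y` has weight `γ - β`, while `h u` and `u h` have the same highest weight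
-- coefficient `λ(h) (u)₀(λ)`.
theorem shapPairing_eq_zero {γ β : Dual ℂ H} (hne : γ ≠ β) {x : U (nPlus b)}
    (hx : x ∈ wtSpace (nPlus b) γ) {y : U (nMinus b)} (hy : y ∈ wtSpace (nMinus b) (-β)) :
    shapPairing b lam x y = 0 := by
  obtain ⟨h, hh⟩ : ∃ h, γ h ≠ β h := by
    by_contra hc
    push Not at hc
    exact hne (LinearMap.ext hc)
  have h1 := cartan_mul_emb hx h
  have h2 := cartan_mul_emb hy h
  have h1' := congrArg (antipode L) h1
  rw [antipode_gen_mul, map_add, antipode_mul, antipode_gen, map_smul] at h1'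
  have h3 : gen (h : L) * (antipode L (emb _ x) * emb _ y) =
      antipode L (emb _ x) * emb _ y * gen (h : L) +
        (γ h - β h) • (antipode L (emb _ x) * emb _ y) := by
    have h4 : gen (h : L) * antipode L (emb _ x) =
        antipode L (emb _ x) * gen (h : L) + γ h • antipode L (emb _ x) := by
      rw [neg_mul, neg_add_eq_sub, eq_sub_iff_add_eq, neg_add_eq_iff_eq_add] at h1'
      exact h1'
    rw [← mul_assoc, h4, add_mul, mul_assoc, h2, mul_add, sub_smul, smul_mul_assoc, mul_smul_comm,
      LinearMap.neg_apply, neg_smul, mul_assoc]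
    abel
  have h5 := congrArg (hwFun b lam) h3
  rw [map_add, hwFun_cartan_mul, hwFun_mul_cartan, map_smul, left_eq_add, smul_eq_mul,
    mul_eq_zero] at h5
  rw [shapPairing_apply]
  exact h5.resolve_left (sub_ne_zero.2 hh)

theorem shapPairing_one_left (y : U (nMinus b)) : shapPairing b lam 1 y = counit _ y := by
  rw [shapPairing_apply, map_one, antipode_one, one_mul, hwFun_emb_nMinus]

theorem shapPairing_one_right (x : U (nPlus b)) : shapPairing b lam x 1 = counit _ x := by
  rw [shapPairing_apply, map_one, mul_one, antipode_emb, hwFun_emb_nPlus, counit_antipode]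

variable {b lam} in
theorem counit_of_mem_K {y : U (nMinus b)} (hy : y ∈ K b lam) : counit _ y = 0 := by
  rw [← shapPairing_one_left b lam]
  exact LinearMap.congr_fun (LinearMap.mem_ker.1 hy) 1

variable {b lam} in
theorem counit_of_mem_Ktilde {x : U (nPlus b)} (hx : x ∈ Ktilde b lam) : counit _ x = 0 := by
  rw [← shapPairing_one_right b lam]
  exact LinearMap.congr_fun (LinearMap.mem_ker.1 hx) 1

variable {b lam} in
/-- A vector of weight `-β` lies in `K_λ` if it is orthogonal to the vectors of weight `β`. -/
theorem mem_K_of_wtSpace {β : Dual ℂ H} (hβ : β ∈ Qplus b) {y : U (nMinus b)}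
    (hy : y ∈ wtSpace (nMinus b) (-β))
    (h : ∀ x ∈ wtSpace (nPlus b) β, shapPairing b lam x y = 0) : y ∈ K b lam := by
  rw [K, LinearMap.mem_ker]
  ext x
  rw [LinearMap.flip_apply, LinearMap.zero_apply]
  induction x using nPlus_induction with
  | one => rw [shapPairing_one_left, counit_of_mem_wtSpace (neg_ne_zero.2 hβ.1) hy]
  | wt γ hγ x hx =>
    by_cases hγβ : γ = β
    · exact h x (hγβ ▸ hx)
    · exact shapPairing_eq_zero lam hγβ hx hy
  | add x x' hx hx' => rw [map_add, LinearMap.add_apply, hx, hx', add_zero]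
  | smul c x hx => rw [map_smul, LinearMap.smul_apply, hx, smul_zero]

variable {b lam} in
theorem mem_Ktilde_of_wtSpace {β : Dual ℂ H} (hβ : β ∈ Qplus b) {x : U (nPlus b)}
    (hx : x ∈ wtSpace (nPlus b) β)
    (h : ∀ y ∈ wtSpace (nMinus b) (-β), shapPairing b lam x y = 0) : x ∈ Ktilde b lam := by
  rw [Ktilde, LinearMap.mem_ker]
  ext y
  rw [LinearMap.zero_apply]
  induction y using nMinus_induction with
  | one => rw [shapPairing_one_right, counit_of_mem_wtSpace hβ.1 hx]
  | wt γ hγ y hy =>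
    by_cases hγβ : β = γ
    · exact h y (hγβ ▸ hy)
    · exact shapPairing_eq_zero lam hγβ hx hy
  | add x x' hx hx' => rw [map_add, hx, hx', add_zero]
  | smul c x hx => rw [map_smul, hx, smul_zero]

/-- The Shapovalov pairing of the weight spaces of weight `β` and `-β`. -/
def wtPairing (β : Dual ℂ H) : wtSpace (nPlus b) β →ₗ[ℂ] wtSpace (nMinus b) (-β) →ₗ[ℂ] ℂ :=
  (shapPairing b lam).compl₁₂ (wtSpace (nPlus b) β).subtype (wtSpace (nMinus b) (-β)).subtype

/-- For generic `λ` there is no nonzero weight vector in `K̃_λ`. -/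
theorem Ktilde_wtSpace_of_isGeneric (hg : IsGeneric b lam) {β : Dual ℂ H} (hβ : β ∈ Qplus b)
    {x : U (nPlus b)} (hx : x ∈ wtSpace (nPlus b) β) (hxK : x ∈ Ktilde b lam) : x = 0 := by
  have := finiteDimensional_wtSpace_nPlus b β
  have := finiteDimensional_wtSpace_nMinus b β
  have hinj : Function.Injective (wtPairing b lam β).flip := by
    rw [injective_iff_map_eq_zero]
    intro y hy
    refine Subtype.ext (K_eq_bot_of_isGeneric b lam hg (mem_K_of_wtSpace hβ y.2 fun x hx => ?_))
    exact LinearMap.congr_fun hy ⟨x, hx⟩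
  -- Equal dimensions turn triviality of the right kernel into surjectivity: every linear form on
  -- the weight space of `U 𝔫₊` is a pairing with some `y`, so the left kernel is trivial too.
  have hsurj : Function.Surjective (wtPairing b lam β).flip := by
    refine (LinearMap.injective_iff_surjective_of_finrank_eq_finrank ?_).1 hinj
    rw [Subspace.dual_finrank_eq, finrank_wtSpace_eq]
  have hz : (⟨x, hx⟩ : wtSpace (nPlus b) β) = 0 := by
    rw [← Module.forall_dual_apply_eq_zero_iff ℂ]
    intro φ
    obtain ⟨y, rfl⟩ := hsurj φ
    exact LinearMap.congr_fun (LinearMap.mem_ker.1 hxK) y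
  exact congrArg Subtype.val hz

end Irreducible

/-! ### The reduced fusion element -/

section TensorSeparation

variable {A V B : Type*} [AddCommGroup A] [Module ℂ A] [AddCommGroup V] [Module ℂ V]
  [AddCommGroup B] [Module ℂ B]

theorem equivFinsupp_rTensor {κ : Type*} [DecidableEq κ] (C : Basis κ ℂ V) (S : A →ₗ[ℂ] B)
    (D : A ⊗[ℂ] V) (i : κ) : TensorProduct.equivFinsuppOfBasisRight C (S.rTensor V D) i =
      S (TensorProduct.equivFinsuppOfBasisRight C D i) := by
  induction D using TensorProduct.induction_on with
  | zero => simp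
  | tmul a v => simp
  | add D D' h h' => simp only [map_add, Finsupp.add_apply, h, h']

/-- If linear forms `p x` separate the points of `A` modulo the kernel of `T`, then they do so after
tensoring with `V`. -/
theorem rTensor_eq_zero_of_separating {X : Type*} (p : X → A →ₗ[ℂ] ℂ) (T : A →ₗ[ℂ] B)
    (hT : ∀ a, (∀ x, p x a = 0) → T a = 0) {D : A ⊗[ℂ] V}
    (hD : ∀ x, (p x).rTensor V D = 0) : T.rTensor V D = 0 := by
  classical
  -- A basis of `V` turns a tensor into a family of vectors of `A`, to which `hT` applies
  -- coordinatewise.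
  let C := Basis.ofVectorSpace ℂ V
  apply (TensorProduct.equivFinsuppOfBasisRight C).injective
  ext i
  rw [equivFinsupp_rTensor, map_zero, Finsupp.zero_apply]
  refine hT _ fun x => ?_
  rw [← equivFinsupp_rTensor, hD, map_zero, Finsupp.zero_apply]

/-- A finite family in `W` that is a basis of `W` modulo `K`. -/
theorem exists_basis_mod (W K : Submodule ℂ A) [FiniteDimensional ℂ W] :
    ∃ (n : ℕ) (x : Fin n → A), (∀ i, x i ∈ W) ∧ LinearIndependent ℂ (fun i => K.mkQ (x i)) ∧
      W ≤ Submodule.span ℂ (Set.range x) ⊔ K := by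
  have : FiniteDimensional ℂ (W.map K.mkQ) := inferInstance
  let e := Module.finBasis ℂ (W.map K.mkQ)
  have he : ∀ i, ∃ x ∈ W, K.mkQ x = e i := fun i => (e i).2
  choose x hx hxe using he
  refine ⟨_, x, hx, ?_, ?_⟩
  · simp only [hxe]
    exact e.linearIndependent.map' (W.map K.mkQ).subtype (Submodule.ker_subtype _)
  · intro w hw
    have h1 := congrArg Subtype.val (e.sum_repr ⟨K.mkQ w, w, hw, rfl⟩)
    rw [AddSubmonoidClass.coe_finsetSum] at h1
    set c := e.repr ⟨K.mkQ w, w, hw, rfl⟩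
    have h2 : w - ∑ i, c i • x i ∈ K := by
      rw [← Submodule.Quotient.mk_eq_zero, ← Submodule.mkQ_apply, map_sub, map_sum, sub_eq_zero]
      refine Eq.trans h1.symm ?_
      refine Finset.sum_congr rfl fun i _ => ?_
      rw [map_smul, hxe]; rfl
    rw [← sub_add_cancel w (∑ i, c i • x i), add_comm]
    exact add_mem (Submodule.mem_sup_left (Submodule.sum_mem _ fun i _ =>
      Submodule.smul_mem _ _ (Submodule.subset_span ⟨i, rfl⟩))) (Submodule.mem_sup_right h2)

end TensorSeparation

/-! ### Invertibility of Gram matrices and contraction of the weight components of `J_red(λ)`. -/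

section FusionTerms

variable {L : Type u} [LieRing L] [LieAlgebra ℂ L] [FiniteDimensional ℂ L]
  [LieAlgebra.IsKilling ℂ L] {H : LieSubalgebra ℂ L} [H.IsCartanSubalgebra]
  (b : (IsKilling.rootSystem H).Base)

variable (lam : Dual ℂ H)

/-- The Gram matrix of the Shapovalov pairing. -/
def gram {m n : ℕ} (z : Fin m → U (nPlus b)) (x : Fin n → U (nMinus b)) :
    Matrix (Fin m) (Fin n) ℂ := Matrix.of fun k l => shapPairing b lam (z k) (x l)

variable {b lam} in
-- If `v` is in the kernel, `∑ vᵢ xᵢ` is orthogonal to the `z k` and to `K̃_λ`, hence to all of `(U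
-- 𝔫₊)[β]`. It then lies in `K_λ`, and the `x i` are independent modulo `K_λ`.
theorem gram_mulVec_injective {β : Dual ℂ H} (hβ : β ∈ Qplus b) {m n : ℕ}
    {z : Fin m → U (nPlus b)} {x : Fin n → U (nMinus b)}
    (hx : ∀ i, x i ∈ wtSpace (nMinus b) (-β))
    (hli : LinearIndependent ℂ fun i => (K b lam).mkQ (x i))
    (hspan : wtSpace (nPlus b) β ≤ Submodule.span ℂ (Set.range z) ⊔ Ktilde b lam) :
    Function.Injective (gram b lam z x).mulVec := by
  rw [← Matrix.coe_mulVecLin, injective_iff_map_eq_zero]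
  intro v hv
  rw [Fintype.linearIndependent_iff] at hli
  refine funext (hli v ?_)
  simp only [← map_smul]
  rw [← map_sum, Submodule.mkQ_apply, Submodule.Quotient.mk_eq_zero]
  refine mem_K_of_wtSpace hβ (Submodule.sum_mem _ fun i _ => Submodule.smul_mem _ _ (hx i))
    fun w hw => ?_
  obtain ⟨s, hs, κ, hκ, rfl⟩ := Submodule.mem_sup.1 (hspan hw)
  rw [map_add, LinearMap.add_apply, LinearMap.mem_ker.1 hκ, LinearMap.zero_apply, add_zero]
  have hle : Submodule.span ℂ (Set.range z) ≤
      LinearMap.ker ((shapPairing b lam).flip (∑ i, v i • x i)) := by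
    refine Submodule.span_le.2 ?_
    rintro _ ⟨k, rfl⟩
    have := congrFun hv k
    rw [Matrix.mulVecLin_apply, Matrix.mulVec, dotProduct] at this
    rw [SetLike.mem_coe, LinearMap.mem_ker, LinearMap.flip_apply, map_sum]
    simp only [map_smul, smul_eq_mul]
    rw [← show _ = (0 : ℂ) from this]
    exact Finset.sum_congr rfl fun l _ => mul_comm _ _
  exact hle hs

variable {b lam} in
theorem gram_vecMul_injective {β : Dual ℂ H} (hβ : β ∈ Qplus b) {m n : ℕ}
    {z : Fin m → U (nPlus b)} {x : Fin n → U (nMinus b)}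
    (hz : ∀ i, z i ∈ wtSpace (nPlus b) β)
    (hli : LinearIndependent ℂ fun i => (Ktilde b lam).mkQ (z i))
    (hspan : wtSpace (nMinus b) (-β) ≤ Submodule.span ℂ (Set.range x) ⊔ K b lam) :
    Function.Injective (gram b lam z x).vecMul := by
  rw [← Matrix.coe_vecMulLinear, injective_iff_map_eq_zero]
  intro v hv
  rw [Fintype.linearIndependent_iff] at hli
  refine funext (hli v ?_)
  simp only [← map_smul]
  rw [← map_sum, Submodule.mkQ_apply, Submodule.Quotient.mk_eq_zero]
  refine mem_Ktilde_of_wtSpace hβ (Submodule.sum_mem _ fun i _ => Submodule.smul_mem _ _ (hz i))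
    fun w hw => ?_
  obtain ⟨s, hs, κ, hκ, rfl⟩ := Submodule.mem_sup.1 (hspan hw)
  have hκ' : shapPairing b lam (∑ i, v i • z i) κ = 0 :=
    LinearMap.congr_fun (LinearMap.mem_ker.1 hκ) _
  rw [map_add, hκ', add_zero]
  have hle : Submodule.span ℂ (Set.range x) ≤
      LinearMap.ker (shapPairing b lam (∑ i, v i • z i)) := by
    refine Submodule.span_le.2 ?_
    rintro _ ⟨l, rfl⟩
    have := congrFun hv l
    rw [Matrix.vecMulLinear_apply, Matrix.vecMul, dotProduct] at this
    rw [SetLike.mem_coe, LinearMap.mem_ker, map_sum, LinearMap.sum_apply]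
    simp only [map_smul, LinearMap.smul_apply, smul_eq_mul]
    exact this
  exact hle hs

/-- The two bases are chosen independently; injectivity of the Gram matrix on either side forces
them to have the same size. -/
theorem exists_isFusionTerm {β : Dual ℂ H} (hβ : β ∈ Qplus b) : ∃ t, IsFusionTerm b lam β t := by
  have := finiteDimensional_wtSpace_nPlus b β
  have := finiteDimensional_wtSpace_nMinus b β
  obtain ⟨n, x, hx, hxli, hxs⟩ := exists_basis_mod (wtSpace (nMinus b) (-β)) (K b lam)
  obtain ⟨m, z, hz, hzli, hzs⟩ := exists_basis_mod (wtSpace (nPlus b) β) (Ktilde b lam)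
  have h1 : n ≤ m := by
    simpa using LinearMap.finrank_le_finrank_of_injective
      (f := (gram b lam z x).mulVecLin) (gram_mulVec_injective hβ hx hxli hzs)
  have h2 : m ≤ n := by
    simpa using LinearMap.finrank_le_finrank_of_injective
      (f := (gram b lam z x).vecMulLinear) (gram_vecMul_injective hβ hz hzli hxs)
  obtain rfl : n = m := le_antisymm h1 h2
  exact ⟨_, n, x, z, hx, hz, hxli, hzli, hxs, hzs, rfl⟩

theorem isFusionTerm_fusionTerm {β : Dual ℂ H} (hβ : β ∈ Qplus b) :
    IsFusionTerm b lam β (fusionTerm b lam β) := by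
  rw [fusionTerm, dif_pos (exists_isFusionTerm b lam hβ)]
  exact (exists_isFusionTerm b lam hβ).choose_spec

/-- The contraction of the first tensor factor with `x` by the Shapovalov pairing. -/
def contr (x : U (nPlus b)) (V : Type*) [AddCommGroup V] [Module ℂ V] :
    U (nMinus b) ⊗[ℂ] V →ₗ[ℂ] V :=
  (TensorProduct.lid ℂ V).toLinearMap ∘ₗ (shapPairing b lam x).rTensor V

theorem contr_tmul (x : U (nPlus b)) {V : Type*} [AddCommGroup V] [Module ℂ V] (y : U (nMinus b))
    (v : V) : contr b lam x V (y ⊗ₜ v) = shapPairing b lam x y • v := by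
  simp [contr]

theorem contr_add (x x' : U (nPlus b)) {V : Type*} [AddCommGroup V] [Module ℂ V]
    (t : U (nMinus b) ⊗[ℂ] V) :
    contr b lam (x + x') V t = contr b lam x V t + contr b lam x' V t := by
  simp [contr, LinearMap.rTensor_add]

theorem contr_smul (c : ℂ) (x : U (nPlus b)) {V : Type*} [AddCommGroup V] [Module ℂ V]
    (t : U (nMinus b) ⊗[ℂ] V) : contr b lam (c • x) V t = c • contr b lam x V t := by
  simp [contr, LinearMap.rTensor_smul]

theorem contr_lTensor (x : U (nPlus b)) {V W : Type*} [AddCommGroup V] [Module ℂ V]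
    [AddCommGroup W] [Module ℂ W] (f : V →ₗ[ℂ] W) (t : U (nMinus b) ⊗[ℂ] V) :
    contr b lam x W (f.lTensor _ t) = f (contr b lam x V t) := by
  induction t using TensorProduct.induction_on with
  | zero => simp
  | tmul y v => rw [LinearMap.lTensor_tmul, contr_tmul, contr_tmul, map_smul]
  | add t t' h h' => rw [map_add, map_add, h, h', map_add, map_add]

/-- The contractions detect exactly the first factor modulo `K_λ`, so nothing is lost after a map
that kills `K_λ`. -/
theorem eq_zero_of_contr {V B : Type*} [AddCommGroup V] [Module ℂ V] [AddCommGroup B] [Module ℂ B]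
    {T : U (nMinus b) →ₗ[ℂ] B} (hT : ∀ y ∈ K b lam, T y = 0) {D : U (nMinus b) ⊗[ℂ] V}
    (hD : ∀ x, contr b lam x V D = 0) : T.rTensor V D = 0 := by
  refine rTensor_eq_zero_of_separating (shapPairing b lam) T (fun y hy => hT y ?_) fun x => ?_
  · exact LinearMap.mem_ker.2 (LinearMap.ext hy)
  · exact (TensorProduct.lid ℂ V).map_eq_zero_iff.1 (hD x)

theorem eq_of_contr {V B : Type*} [AddCommGroup V] [Module ℂ V] [AddCommGroup B] [Module ℂ B]
    {T : U (nMinus b) →ₗ[ℂ] B} (hT : ∀ y ∈ K b lam, T y = 0) {D D' : U (nMinus b) ⊗[ℂ] V}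
    (hD : ∀ x, contr b lam x V D = contr b lam x V D') : T.rTensor V D = T.rTensor V D' := by
  rw [← sub_eq_zero, ← map_sub]
  exact eq_zero_of_contr b lam hT fun x => by rw [map_sub, hD, sub_self]

variable {b lam} in
theorem mem_span_of_isFusionTerm {β : Dual ℂ H} {t : U (nMinus b) ⊗[ℂ] U (nPlus b)}
    (ht : IsFusionTerm b lam β t) : t ∈ Submodule.span ℂ
      {s | ∃ y ∈ wtSpace (nMinus b) (-β), ∃ z ∈ wtSpace (nPlus b) β, s = y ⊗ₜ[ℂ] z} := by
  obtain ⟨n, x, z, hx, hz, -, -, -, -, rfl⟩ := ht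
  exact Submodule.sum_mem _ fun i _ => Submodule.sum_mem _ fun j _ =>
    Submodule.smul_mem _ _ (Submodule.subset_span ⟨_, hx i, _, hz j, rfl⟩)

variable {b lam} in
theorem map_fusionTerm_eq_zero {β : Dual ℂ H} {t : U (nMinus b) ⊗[ℂ] U (nPlus b)}
    (ht : IsFusionTerm b lam β t) {W : Type*} [AddCommGroup W] [Module ℂ W]
    {f : U (nMinus b) ⊗[ℂ] U (nPlus b) →ₗ[ℂ] W}
    (hf : ∀ y ∈ wtSpace (nMinus b) (-β), ∀ z ∈ wtSpace (nPlus b) β, f (y ⊗ₜ z) = 0) : f t = 0 := by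
  have : Submodule.span ℂ
      {s | ∃ y ∈ wtSpace (nMinus b) (-β), ∃ z ∈ wtSpace (nPlus b) β, s = y ⊗ₜ[ℂ] z} ≤
      LinearMap.ker f := by
    refine Submodule.span_le.2 ?_
    rintro _ ⟨y, hy, z, hz, rfl⟩
    exact hf y hy z hz
  exact this (mem_span_of_isFusionTerm ht)

variable {b lam} in
/-- Contraction with the fusion term is the identity modulo `K̃_λ`. -/
theorem contr_fusionTerm {β : Dual ℂ H} (hβ : β ∈ Qplus b) {t : U (nMinus b) ⊗[ℂ] U (nPlus b)}
    (ht : IsFusionTerm b lam β t) {w : U (nPlus b)} (hw : w ∈ wtSpace (nPlus b) β) :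
    contr b lam w _ t - w ∈ Ktilde b lam ⊓ wtSpace (nPlus b) β := by
  obtain ⟨n, x, z, hx, hz, hxli, hzli, hxs, hzs, rfl⟩ := ht
  change contr b lam w _ (∑ i, ∑ j, (gram b lam z x)⁻¹ i j • (x i ⊗ₜ[ℂ] z j)) - w ∈ _
  have hunit : IsUnit (gram b lam z x).det :=
    (Matrix.isUnit_iff_isUnit_det _).1
      (Matrix.mulVec_injective_iff_isUnit.1 (gram_mulVec_injective hβ hx hxli hzs))
  have hc : ∀ w, contr b lam w _ (∑ i, ∑ j, (gram b lam z x)⁻¹ i j • (x i ⊗ₜ[ℂ] z j)) =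
      ∑ j, (∑ i, shapPairing b lam w (x i) * (gram b lam z x)⁻¹ i j) • z j := by
    intro w
    rw [map_sum, Finset.sum_congr rfl fun j _ => Finset.sum_smul, Finset.sum_comm]
    refine Finset.sum_congr rfl fun i _ => ?_
    rw [map_sum]
    refine Finset.sum_congr rfl fun j _ => ?_
    rw [map_smul, contr_tmul, smul_smul, mul_comm]
  have hz' : ∀ k, contr b lam (z k) _ (∑ i, ∑ j, (gram b lam z x)⁻¹ i j • (x i ⊗ₜ[ℂ] z j)) =
      z k := by
    intro k
    rw [hc]
    have : ∀ j, ∑ i, shapPairing b lam (z k) (x i) * (gram b lam z x)⁻¹ i j =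
        (1 : Matrix (Fin n) (Fin n) ℂ) k j := by
      intro j
      rw [← Matrix.mul_nonsing_inv _ hunit, Matrix.mul_apply]
      rfl
    simp [this, Matrix.one_apply]
  constructor
  -- Contraction fixes each `z k`, because the Gram matrix meets its inverse, and kills `K̃_λ`. So
  -- the error is exactly `-κ`.
  · obtain ⟨s, hs, κ, hκ, rfl⟩ := Submodule.mem_sup.1 (hzs hw)
    have hκ0 : contr b lam κ _ (∑ i, ∑ j, (gram b lam z x)⁻¹ i j • (x i ⊗ₜ[ℂ] z j)) = 0 := by
      rw [hc]
      simp [LinearMap.mem_ker.1 hκ]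
    have hs' : contr b lam s _ (∑ i, ∑ j, (gram b lam z x)⁻¹ i j • (x i ⊗ₜ[ℂ] z j)) = s := by
      clear hw
      induction hs using Submodule.span_induction with
      | mem _ h => obtain ⟨k, rfl⟩ := h; exact hz' k
      | zero => simp [contr]
      | add p q _ _ hp hq => rw [contr_add, hp, hq]
      | smul c p _ hp => rw [contr_smul, hp]
    rw [contr_add, hκ0, hs', add_zero, sub_add_cancel_left]
    exact neg_mem hκ
  -- The error is also homogeneous. At generic `λ` only the weight vectors of `K̃_λ` are known to
  -- vanish, so this is needed.
  · refine sub_mem ?_ hw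
    rw [hc]
    exact Submodule.sum_mem _ fun j _ => Submodule.smul_mem _ _ (hz j)

end FusionTerms

/-! ### The fusion operators -/

section LocalFiniteness

variable {L : Type u} [LieRing L] [LieAlgebra ℂ L]

/-- For a matrix entry `f = r_{ij}` one has `f(x a) = ∑ₖ r(x)_{ik} r(a)_{kj}`, so all translates lie
in the span of the entries of row `i`. -/
theorem exists_finiteDimensional_orbit {f : Dual ℂ (U L)} (hf : f ∈ matElts L) :
    ∃ W : Submodule ℂ (Dual ℂ (U L)), FiniteDimensional ℂ W ∧
      ∀ a, f ∘ₗ LinearMap.mulRight ℂ a ∈ W := by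
  induction hf using Submodule.span_induction with
  | zero => exact ⟨⊥, inferInstance, fun a => by simp⟩
  | add f g _ _ hf hg =>
    obtain ⟨W, hW, hWf⟩ := hf
    obtain ⟨W', hW', hWg⟩ := hg
    exact ⟨W ⊔ W', inferInstance, fun a => add_mem (Submodule.mem_sup_left (hWf a))
      (Submodule.mem_sup_right (hWg a))⟩
  | smul c f _ hf =>
    obtain ⟨W, hW, hWf⟩ := hf
    exact ⟨W, hW, fun a => W.smul_mem c (hWf a)⟩
  | mem f hf =>
    obtain ⟨n, hn, hd, r, i, j, hr⟩ := hf
    refine ⟨Submodule.span ℂ (Set.range fun k => Matrix.entryLinearMap ℂ ℂ i k ∘ₗ r.toLinearMap),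
      FiniteDimensional.span_of_finite ℂ (Set.finite_range _), fun a => ?_⟩
    have : f ∘ₗ LinearMap.mulRight ℂ a =
        ∑ k, r a k j • (Matrix.entryLinearMap ℂ ℂ i k ∘ₗ r.toLinearMap) := by
      ext x
      simp [hr, Matrix.mul_apply, LinearMap.sum_apply, mul_comm]
    rw [this]
    exact Submodule.sum_mem _ fun k _ => Submodule.smul_mem _ _ (Submodule.subset_span ⟨k, rfl⟩)

/-- The left regular representation is locally finite. -/
theorem exists_finiteDimensional_stable (f : matElts L) :
    ∃ R : Submodule ℂ (matElts L), FiniteDimensional ℂ R ∧ (∀ a, regAct L a f ∈ R) ∧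
      ∀ a, ∀ g ∈ R, regAct L a g ∈ R := by
  obtain ⟨W, hW, hWf⟩ := exists_finiteDimensional_orbit f.2
  let R := LinearMap.range ((regAct L).toLinearMap.flip f)
  refine ⟨R, ?_, fun a => ⟨a, rfl⟩, ?_⟩
  · refine Module.Finite.of_injective (LinearMap.codRestrict W ((matElts L).subtype ∘ₗ
      R.subtype) ?_) fun x y hxy => Subtype.ext (Subtype.ext ?_)
    · rintro ⟨_, a, rfl⟩
      exact hWf a
    · exact congrArg (fun w : W => (w : Dual ℂ (U L))) hxy
  · rintro a _ ⟨c, rfl⟩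
    exact ⟨a * c, by rw [LinearMap.flip_apply, AlgHom.toLinearMap_apply, map_mul]; rfl⟩

end LocalFiniteness

/-! ### The vector `J_red(λ)(1 ⊗ g)` and the equations it satisfies. -/

section FusionVec

variable {L : Type u} [LieRing L] [LieAlgebra ℂ L] [FiniteDimensional ℂ L]
  [LieAlgebra.IsKilling ℂ L] {H : LieSubalgebra ℂ L} [H.IsCartanSubalgebra]
  (b : (IsKilling.rootSystem H).Base)


variable {b} in
theorem regAct_cartan_emb {n : LieSubalgebra ℂ L} {γ : Dual ℂ H} {z : U n} (hz : z ∈ wtSpace n γ)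
    {g : matElts L} {h : H} (hg : regAct L (gen (h : L)) g = 0) :
    regAct L (gen (h : L)) (regAct L (emb n z) g) = γ h • regAct L (emb n z) g := by
  rw [← Module.End.mul_apply, ← map_mul, cartan_mul_emb hz, map_add, map_mul, LinearMap.add_apply,
    Module.End.mul_apply, hg, map_zero, zero_add, map_smul, LinearMap.smul_apply]

/-- A nonzero `z g` is an eigenvector of the grading element in a finite-dimensional space, with the
height of `β` as eigenvalue. So only finitely many heights occur, each for finitely many `β`. -/
theorem finite_weights {g : matElts L} (hg : regAct L (gen (grading b : L)) g = 0) :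
    {β ∈ Qplus b | ∃ z ∈ wtSpace (nPlus b) β, regAct L (emb _ z) g ≠ 0}.Finite := by
  obtain ⟨R, hR, hgR, hst⟩ := exists_finiteDimensional_stable g
  let T : End ℂ R := LinearMap.restrict (regAct L (gen (grading b : L))) (hst _)
  refine (finite_Qplus_of_height b (Module.End.finite_hasEigenvalue (R := ℂ) (M := R) T)).subset ?_
  rintro β ⟨hβ, z, hz, hne⟩
  refine ⟨hβ, Module.End.hasEigenvalue_of_hasEigenvector
    (x := ⟨regAct L (emb _ z) g, hgR _⟩) ⟨?_, ?_⟩⟩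
  · rw [Module.End.mem_eigenspace_iff]
    exact Subtype.ext (regAct_cartan_emb hz hg)
  · exact fun h => hne (congrArg Subtype.val h)

/-- The map `y ⊗ z ↦ y ⊗ z g`. -/
def evalTensor (g : matElts L) :
    U (nMinus b) ⊗[ℂ] U (nPlus b) →ₗ[ℂ] U (nMinus b) ⊗[ℂ] matElts L :=
  (((regAct L).comp (emb (nPlus b))).toLinearMap.flip g).lTensor (U (nMinus b))

theorem evalTensor_tmul (g : matElts L) (y : U (nMinus b)) (z : U (nPlus b)) :
    evalTensor b g (y ⊗ₜ z) = y ⊗ₜ regAct L (emb _ z) g := rfl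

variable (lam : Dual ℂ H)

/-- The element `J_red(λ) (1 ⊗ g)` of `U 𝔫₋ ⊗ F`. -/
def fusionVec (g : matElts L) : U (nMinus b) ⊗[ℂ] matElts L :=
  1 ⊗ₜ g + ∑ᶠ β ∈ Qplus b, evalTensor b g (fusionTerm b lam β)

/-- A `finsum` with infinite support is zero by convention; finiteness is what lets linear maps pass
through the sum in `map_fusionVec`. -/
theorem finite_support_evalTensor {g : matElts L} (hg : regAct L (gen (grading b : L)) g = 0) :
    (Qplus b ∩ Function.support fun β => evalTensor b g (fusionTerm b lam β)).Finite := by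
  refine (finite_weights b hg).subset ?_
  rintro β ⟨hβ, hne⟩
  refine ⟨hβ, ?_⟩
  by_contra! hc
  refine hne (map_fusionTerm_eq_zero (isFusionTerm_fusionTerm b lam hβ) fun y _ z hz => ?_)
  rw [evalTensor_tmul, hc z hz, TensorProduct.tmul_zero]

theorem map_fusionVec {g : matElts L} (hg : regAct L (gen (grading b : L)) g = 0) {W : Type*}
    [AddCommGroup W] [Module ℂ W] (f : U (nMinus b) ⊗[ℂ] matElts L →ₗ[ℂ] W) :
    f (fusionVec b lam g) =
      f (1 ⊗ₜ g) + ∑ᶠ β ∈ Qplus b, f (evalTensor b g (fusionTerm b lam β)) := by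
  rw [fusionVec, map_add]
  congr 1
  exact AddMonoidHom.map_finsum_mem' f.toAddMonoidHom (finite_support_evalTensor b lam hg)

/-- The fusion operators are determined by the vectors `J_red(λ) (1 ⊗ g)`. -/
theorem fusion_tmul {g : matElts L} (hg : regAct L (gen (grading b : L)) g = 0) {M : Type u}
    [AddCommGroup M] [Module ℂ M] (s : U (nMinus b) →ₐ[ℂ] End ℂ M) (m : M) :
    fusion b lam s (m ⊗ₜ g) =
      (s.toLinearMap.flip m).rTensor (matElts L) (fusionVec b lam g) := by
  rw [map_fusionVec b lam hg, fusion]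
  congr 1
  · simp
  · refine finsum_mem_congr rfl fun β _ => ?_
    induction fusionTerm b lam β using TensorProduct.induction_on with
    | zero => simp
    | tmul y z => simp [evalTensor_tmul]
    | add t t' h h' => simp only [map_add, LinearMap.add_apply, h, h']

variable {b lam} in
/-- The defining property of `J_red(λ) (1 ⊗ g)`. -/
theorem contr_fusionVec {g : matElts L} (hg : regAct L (gen (grading b : L)) g = 0)
    (hK : ∀ γ ∈ Qplus b, ∀ x ∈ wtSpace (nPlus b) γ, x ∈ Ktilde b lam → regAct L (emb _ x) g = 0)
    (x : U (nPlus b)) : contr b lam x _ (fusionVec b lam g) = regAct L (emb _ x) g := by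
  induction x using nPlus_induction with
  | one =>
    rw [map_fusionVec b lam hg, contr_tmul, finsum_mem_eq_zero_of_forall_eq_zero, add_zero,
      shapPairing_one_left]
    · simp
    · intro β hβ
      refine map_fusionTerm_eq_zero (f := contr b lam 1 _ ∘ₗ evalTensor b g)
        (isFusionTerm_fusionTerm b lam hβ) fun y hy z _ => ?_
      rw [LinearMap.comp_apply, evalTensor_tmul, contr_tmul, shapPairing_one_left,
        counit_of_mem_wtSpace (neg_ne_zero.2 hβ.1) hy, zero_smul]
  | wt γ hγ x hx =>
    rw [map_fusionVec b lam hg, contr_tmul, shapPairing_one_right, counit_of_mem_wtSpace hγ.1 hx,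
      -- Weight spaces of different weights are orthogonal, so only the term `β = γ` is left, and
      -- `contr_fusionTerm` evaluates it modulo vectors that kill `g`.
      zero_smul, zero_add, finsum_eq_single _ γ]
    · simp only [hγ, finsum_true]
      have h1 := contr_fusionTerm hγ (isFusionTerm_fusionTerm b lam hγ) hx
      have h2 := hK γ hγ _ h1.2 h1.1
      rw [map_sub, map_sub, LinearMap.sub_apply, sub_eq_zero] at h2
      rw [← h2, evalTensor, contr_lTensor]
      rfl
    · intro β hne
      by_cases hβ : β ∈ Qplus b
      swap
      · simp only [hβ, finsum_false]
      simp only [hβ, finsum_true]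
      refine map_fusionTerm_eq_zero (f := contr b lam x _ ∘ₗ evalTensor b g)
        (isFusionTerm_fusionTerm b lam hβ) fun y hy z _ => ?_
      rw [LinearMap.comp_apply, evalTensor_tmul, contr_tmul,
        shapPairing_eq_zero lam hne.symm hx hy, zero_smul]
  | add x x' hx hx' => rw [contr_add, hx, hx', map_add, map_add, LinearMap.add_apply]
  | smul c x hx => rw [contr_smul, hx, map_smul, map_smul, LinearMap.smul_apply]

end FusionVec

section Membership

variable {L : Type u} [LieRing L] [LieAlgebra ℂ L] [FiniteDimensional ℂ L]
  [LieAlgebra.IsKilling ℂ L] {H : LieSubalgebra ℂ L} [H.IsCartanSubalgebra]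
  (b : (IsKilling.rootSystem H).Base)


variable {b}

theorem regAct_Ktilde {lam : Dual ℂ H} {P : Submodule ℂ (U L)} (hP : KtildeInU b lam ≤ P)
    {g : matElts L} (hg : g ∈ F0 H P) {x : U (nPlus b)} (hx : x ∈ Ktilde b lam) :
    regAct L (emb _ x) g = 0 := by
  have h := hg.2 _ (hP ⟨x, hx, rfl⟩)
  rwa [AlgHom.toLinearMap_apply, counit_emb, counit_of_mem_Ktilde hx, zero_smul] at h

theorem regAct_K {lam : Dual ℂ H} {P : Submodule ℂ (U L)} (hP : KinU b lam ≤ P)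
    {g : matElts L} (hg : g ∈ F0 H P) {y : U (nMinus b)} (hy : y ∈ K b lam) :
    regAct L (emb _ y) g = 0 := by
  have h := hg.2 _ (hP ⟨y, hy, rfl⟩)
  rwa [AlgHom.toLinearMap_apply, counit_emb, counit_of_mem_K hy, zero_smul] at h

end Membership

/-! ### Limits of fusion operators -/

section Limits

theorem ConvergesTo.map {X W W' : Type*} [AddCommGroup W] [Module ℂ W] [AddCommGroup W']
    [Module ℂ W'] {l : Filter X} {u : X → W} {w : W} (h : ConvergesTo l u w) (A : W →ₗ[ℂ] W') :
    ConvergesTo l (fun x => A (u x)) (A w) := by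
  obtain ⟨E, hE, hw, hu, ht⟩ := h
  exact ⟨E.map A, inferInstance, Submodule.mem_map_of_mem hw,
    hu.mono fun x hx => Submodule.mem_map_of_mem hx, fun ξ => ht (ξ ∘ₗ A)⟩

theorem ConvergesTo.congr {X W : Type*} [AddCommGroup W] [Module ℂ W] {l : Filter X} {u v : X → W}
    {w : W} (h : ConvergesTo l u w) (huv : ∀ᶠ x in l, u x = v x) : ConvergesTo l v w := by
  obtain ⟨E, hE, hw, hu, ht⟩ := h
  refine ⟨E, hE, hw, ?_, fun ξ => (ht ξ).congr' ?_⟩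
  · filter_upwards [hu, huv] with x hx hxv
    exact hxv ▸ hx
  · filter_upwards [huv] with x hx
    rw [hx]

theorem convergesTo_bot {X W : Type*} [AddCommGroup W] [Module ℂ W] (u : X → W) (w : W) :
    ConvergesTo ⊥ u w :=
  ⟨Submodule.span ℂ {w}, inferInstance, Submodule.mem_span_singleton_self w, Filter.eventually_bot,
    fun _ => Filter.tendsto_bot⟩

/-- The left multiplication of a Lie algebra on its enveloping algebra. -/
abbrev mulLieRingModule (n : Type u) [LieRing n] [LieAlgebra ℂ n] : LieRingModule n (U n) where
  bracket x m := gen x * m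
  add_lie x y m := by rw [gen, map_add, add_mul]
  lie_add x m m' := mul_add _ _ _
  leibniz_lie x y m := by
    change gen x * (gen y * m) = gen ⁅x, y⁆ * m + gen y * (gen x * m)
    rw [gen_lie]
    noncomm_ring

end Limits

/-! ### Passage to the limit along generic weights. -/

section Convergence

variable {L : Type u} [LieRing L] [LieAlgebra ℂ L] [FiniteDimensional ℂ L]
  [LieAlgebra.IsKilling ℂ L] {H : LieSubalgebra ℂ L} [H.IsCartanSubalgebra]
  (b : (IsKilling.rootSystem H).Base)


variable (lam₀ : Dual ℂ H)

theorem tendsto_coords : Filter.Tendsto (coords b) (genericNhds b lam₀) (nhds (coords b lam₀)) :=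
  Filter.tendsto_comap.mono_left inf_le_left

theorem eventually_isGeneric : ∀ᶠ lam in genericNhds b lam₀, IsGeneric b lam :=
  Filter.mem_inf_of_right (Filter.mem_principal_self _)

/-- The filter controls only the values on simple coroots, and these span `𝔥`. -/
theorem tendsto_apply (h : H) :
    Filter.Tendsto (fun lam : Dual ℂ H => lam h) (genericNhds b lam₀) (nhds (lam₀ h)) := by
  have hh : h ∈ Submodule.span ℂ ((IsKilling.rootSystem H).coroot '' b.support) := by
    rw [b.span_coroot_support, RootPairing.corootSpan, RootPairing.IsRootSystem.span_coroot_eq_top]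
    trivial
  induction hh using Submodule.span_induction with
  | mem h hh =>
    obtain ⟨i, hi, rfl⟩ := hh
    exact (tendsto_pi_nhds.1 (tendsto_coords b lam₀)) ⟨i, hi⟩
  | zero => simp only [map_zero]; exact tendsto_const_nhds
  | add h h' _ _ ht ht' => simpa only [map_add] using ht.add ht'
  | smul c h _ ht => simpa only [map_smul] using ht.const_smul c

theorem tendsto_evalAt (u : U H) : Filter.Tendsto (fun lam : Dual ℂ H => evalAt lam u)
    (genericNhds b lam₀) (nhds (evalAt lam₀ u)) := by
  induction u using left_induction with
  | one => simp only [map_one]; exact tendsto_const_nhds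
  | gen_mul x u hu => simpa only [map_mul, evalAt_gen] using (tendsto_apply b lam₀ x).mul hu
  | add u v hu hv => simpa only [map_add] using hu.add hv
  | smul c u hu => simpa only [map_smul] using hu.const_smul c

theorem tendsto_contr {V : Type*} [AddCommGroup V] [Module ℂ V] (ξ : Dual ℂ V) (x : U (nPlus b))
    (t : U (nMinus b) ⊗[ℂ] V) : Filter.Tendsto (fun lam => ξ (contr b lam x V t))
      (genericNhds b lam₀) (nhds (ξ (contr b lam₀ x V t))) := by
  induction t using TensorProduct.induction_on with
  | zero => simp only [map_zero]; exact tendsto_const_nhds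
  | tmul y v =>
    simp only [contr_tmul, map_smul]
    exact (tendsto_evalAt b lam₀ _).smul_const _
  | add t t' ht ht' => simpa only [map_add] using ht.add ht'

variable {b lam₀}

/-- The universal case: `M = U 𝔫₋` under left multiplication, with the vector `1`. There the
operator `J(λ)^M` returns `J(λ)(1 ⊗ g)` itself. -/
theorem isRegularAt_fusionVec (hreg : GoodRegularity b lam₀) {g : matElts L}
    (hg : g ∈ F0 H (KtildeInU b lam₀)) : IsRegularAt b lam₀ fun lam => fusionVec b lam g := by
  let _ : LieRingModule (nMinus b) (U (nMinus b)) := mulLieRingModule _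
  let _ : LieModule ℂ (nMinus b) (U (nMinus b)) :=
    { smul_lie := fun c x m => by
        change gen (c • x) * m = c • (gen x * m)
        rw [gen, map_smul, smul_mul_assoc]
      lie_smul := fun c x m => mul_smul_comm _ _ _ }
  have hact : actMinus b (U (nMinus b)) = Algebra.lmul ℂ (U (nMinus b)) := by
    refine UniversalEnvelopingAlgebra.hom_ext _ (LieHom.ext fun x => ?_)
    ext m
    simp [actMinus]
    rfl
  have h := hreg (U (nMinus b)) (1 ⊗ₜ ⟨g, hg⟩)
  convert h using 2 with lam
  rw [LinearMap.lTensor_tmul, Submodule.subtype_apply, fusion_tmul b lam (hg.1 _ (grading b).2),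
    hact]
  have : (Algebra.lmul ℂ (U (nMinus b))).toLinearMap.flip 1 = LinearMap.id := by ext; simp
  rw [this, LinearMap.rTensor_id, LinearMap.id_apply]

theorem contr_fusionVec_of_mem {lam : Dual ℂ H} {P : Submodule ℂ (U L)}
    (hP : KtildeInU b lam ≤ P) {g : matElts L} (hg : g ∈ F0 H P) (x : U (nPlus b)) :
    contr b lam x _ (fusionVec b lam g) = regAct L (emb _ x) g :=
  contr_fusionVec (hg.1 _ (grading b).2) (fun _ _ _ _ hx => regAct_Ktilde hP hg hx) x

theorem contr_fusionVec_of_isGeneric {lam : Dual ℂ H} (hlam : IsGeneric b lam) {g : matElts L}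
    (hg : regAct L (gen (grading b : L)) g = 0) (x : U (nPlus b)) :
    contr b lam x _ (fusionVec b lam g) = regAct L (emb _ x) g :=
  contr_fusionVec hg (fun γ hγ x hx hxK => by
    rw [Ktilde_wtSpace_of_isGeneric b lam hlam hγ hx hxK, map_zero, map_zero,
      LinearMap.zero_apply]) x

/-- In `contr_λ x (J(λ)(1 ⊗ g)) = x g` both the coefficients of the vector and the pairing depend
continuously on `λ`, and the right side is constant. Since `F` carries no topology, the equation is
tested on linear forms. -/
theorem exists_limit_fusionVec (hreg : GoodRegularity b lam₀) {g : matElts L}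
    (hg : g ∈ F0 H (KtildeInU b lam₀)) (hne : (genericNhds b lam₀).NeBot) :
    ∃ T, ConvergesTo (genericNhds b lam₀) (fun lam => fusionVec b lam g) T ∧
      ∀ x, contr b lam₀ x _ T = regAct L (emb _ x) g := by
  obtain ⟨n, c, w, hc, hev⟩ := isRegularAt_fusionVec hreg hg
  have hct : ∀ k, Filter.Tendsto (fun lam => c k (coords b lam)) (genericNhds b lam₀)
      (nhds (c k (coords b lam₀))) := fun k =>
    (hc k).continuousAt.tendsto.comp (tendsto_coords b lam₀)
  have hmem : ∀ lam, ∑ k, c k (coords b lam) • w k ∈ Submodule.span ℂ (Set.range w) := fun lam =>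
    Submodule.sum_mem _ fun k _ => Submodule.smul_mem _ _ (Submodule.subset_span ⟨k, rfl⟩)
  refine ⟨∑ k, c k (coords b lam₀) • w k, ⟨Submodule.span ℂ (Set.range w),
    FiniteDimensional.span_of_finite ℂ (Set.finite_range w), hmem _, ?_, fun ξ => ?_⟩, fun x => ?_⟩
  · filter_upwards [hev] with lam hlam
    rw [hlam]
    exact hmem lam
  · have : Filter.Tendsto (fun lam => ξ (∑ k, c k (coords b lam) • w k)) (genericNhds b lam₀)
        (nhds (ξ (∑ k, c k (coords b lam₀) • w k))) := by
      simp only [map_sum, map_smul]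
      exact tendsto_finsetSum _ fun k _ => (hct k).smul_const _
    refine this.congr' ?_
    filter_upwards [hev] with lam hlam
    rw [hlam]
  · rw [← sub_eq_zero, ← Module.forall_dual_apply_eq_zero_iff ℂ]
    intro ξ
    rw [map_sub, sub_eq_zero]
    have h1 : Filter.Tendsto (fun lam => ξ (contr b lam x _ (∑ k, c k (coords b lam) • w k)))
        (genericNhds b lam₀) (nhds (ξ (contr b lam₀ x _ (∑ k, c k (coords b lam₀) • w k)))) := by
      simp only [map_sum, map_smul, smul_eq_mul]
      exact tendsto_finsetSum _ fun k _ => (hct k).mul (tendsto_contr b lam₀ ξ x (w k))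
    refine tendsto_nhds_unique h1 (tendsto_const_nhds.congr' ?_)
    filter_upwards [hev, eventually_isGeneric b lam₀] with lam hlam hgen
    rw [← hlam, contr_fusionVec_of_isGeneric hgen (hg.1 _ (grading b).2)]

/-- Convergence of the fusion operators on `f ⊗ g`. -/
theorem convergesTo_fusion (hreg : GoodRegularity b lam₀) {P : Submodule ℂ (U L)}
    (hP : KinU b lam₀ ≤ P) {f : matElts L} (hf : f ∈ F0 H P) {g : matElts L}
    (hg : g ∈ F0 H (KtildeInU b lam₀)) :
    ConvergesTo (genericNhds b lam₀) (fun lam => fusion b lam (regMinus b) (f ⊗ₜ[ℂ] g))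
      (fusion b lam₀ (regMinus b) (f ⊗ₜ[ℂ] g)) := by
  -- Uniqueness of limits needs a nontrivial filter; along the trivial filter every family converges
  -- to everything.
  rcases (genericNhds b lam₀).eq_or_neBot with h | h
  · rw [h]
    exact convergesTo_bot _ _
  obtain ⟨T, hT, hTc⟩ := exists_limit_fusionVec hreg hg h
  simp only [fusion_tmul b _ (hg.1 _ (grading b).2)]
  -- `T` need not equal `J_red(λ₀)(1 ⊗ g)`. They agree modulo `K_{λ₀}` in the first factor, and
  -- `K_{λ₀}` annihilates `f`.
  have heq : ((regMinus b).toLinearMap.flip f).rTensor (matElts L) (fusionVec b lam₀ g) =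
      ((regMinus b).toLinearMap.flip f).rTensor (matElts L) T := by
    refine eq_of_contr b lam₀ (fun y hy => regAct_K hP hf hy) fun x => ?_
    rw [hTc, contr_fusionVec_of_mem le_rfl hg]
  rw [heq]
  exact hT.map _

end Convergence

/-! ### Intertwining operators and the star product -/

theorem exists_factor {A B C : Type*} [AddCommGroup A] [Module ℂ A] [AddCommGroup B] [Module ℂ B]
    [AddCommGroup C] [Module ℂ C] {p : A →ₗ[ℂ] B} (hp : Function.Surjective p) (f : A →ₗ[ℂ] C)
    (hf : ∀ a, p a = 0 → f a = 0) : ∃ g : B →ₗ[ℂ] C, ∀ a, g (p a) = f a := by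
  obtain ⟨s, hs⟩ := p.exists_rightInverse_of_surjective (LinearMap.range_eq_top.2 hp)
  refine ⟨f ∘ₗ s, fun a => ?_⟩
  rw [LinearMap.comp_apply, ← sub_eq_zero, ← map_sub]
  refine hf _ ?_
  rw [map_sub, ← LinearMap.comp_apply, hs, LinearMap.id_apply, sub_self]

section Intertwiners

variable {L : Type u} [LieRing L] [LieAlgebra ℂ L] [FiniteDimensional ℂ L]
  [LieAlgebra.IsKilling ℂ L] {H : LieSubalgebra ℂ L} [H.IsCartanSubalgebra]
  (b : (IsKilling.rootSystem H).Base)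


variable (lam : Dual ℂ H)

/-- The map `u ↦ u 1_λ` from `U L` to `V(λ)`. -/
def orbitMap : U L →ₗ[ℂ] Irr b lam := (Algebra.lsmul ℂ ℂ (Irr b lam)).toLinearMap.flip (hwVec b lam)

theorem orbitMap_apply (u : U L) : orbitMap b lam u = u • hwVec b lam := rfl

theorem orbitMap_surjective : Function.Surjective (orbitMap b lam) := exists_smul_hwVec b lam

theorem gen_nPlus_smul_hwVec {e : L} (he : e ∈ nPlus b) : gen e • hwVec b lam = 0 :=
  (smul_hwVec_eq_zero b).2 (vermaIdeal_le_annIdeal b lam (gen_mem_vermaIdeal b lam he))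

theorem cartan_smul_hwVec (h : H) : gen (h : L) • hwVec b lam = lam h • hwVec b lam := by
  rw [← sub_eq_zero, ← algebraMap_smul (U L) (lam h), ← sub_smul]
  exact (smul_hwVec_eq_zero b).2 (vermaIdeal_le_annIdeal b lam (cartan_sub_mem_vermaIdeal b lam h))

theorem emb_smul_hwVec_mem_irrWt {β : Dual ℂ H} {y : U (nMinus b)}
    (hy : y ∈ wtSpace (nMinus b) (-β)) : emb _ y • hwVec b lam ∈ irrWt b lam (lam - β) := by
  intro h
  rw [← mul_smul, cartan_mul_emb hy, add_smul, mul_smul, cartan_smul_hwVec, smul_comm,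
    smul_assoc, ← add_smul, LinearMap.neg_apply, LinearMap.sub_apply, sub_eq_add_neg]

/-- The form `u ↦ (u)₀(λ)` descends to `V(λ)`. On a vector of weight `λ - β` its value is multiplied
both by `λ(h)` and by `λ(h) - β(h)`, hence vanishes. -/
theorem exists_isHwCoeff : ∃ p, IsHwCoeff b lam p := by
  obtain ⟨p, hp⟩ := exists_factor (orbitMap_surjective b lam) (hwFun b lam)
    fun u hu => hwFun_of_mem_annIdeal b lam ((smul_hwVec_eq_zero b).1 hu)
  simp only [orbitMap_apply] at hp
  refine ⟨p, ?_, fun β hβ v hv => ?_⟩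
  · rw [← one_smul (U L) (hwVec b lam), hp, hwFun_one]
  · obtain ⟨u, rfl⟩ := exists_smul_hwVec b lam v
    obtain ⟨h, hh⟩ : ∃ h, β h ≠ 0 := by
      by_contra! hc
      exact hβ.1 (LinearMap.ext hc)
    have h1 := congrArg p (hv h)
    rw [← mul_smul, hp, hwFun_cartan_mul, map_smul, hp, LinearMap.sub_apply, smul_eq_mul, sub_mul,
      eq_comm, sub_eq_self, mul_eq_zero] at h1
    rw [hp]
    exact h1.resolve_left hh

variable {b lam} in
theorem IsHwCoeff.apply_emb {p : Irr b lam →ₗ[ℂ] ℂ} (hp : IsHwCoeff b lam p)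
    (y : U (nMinus b)) : p (emb _ y • hwVec b lam) = counit _ y := by
  induction y using nMinus_induction with
  | one => rw [map_one, one_smul, hp.1, map_one]
  | wt γ hγ y hy =>
    rw [hp.2 γ hγ _ (emb_smul_hwVec_mem_irrWt b lam hy),
      counit_of_mem_wtSpace (neg_ne_zero.2 hγ.1) hy]
  | add y z hy hz => rw [map_add, add_smul, map_add, hy, hz, map_add]
  | smul c y hy => rw [map_smul (emb _), smul_assoc, p.map_smul, hy, map_smul]

/-- The defining conditions fix the chosen form on `U 𝔫₋ 1_λ`, which is all of `V(λ)`; so the choice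
is explicit. -/
theorem hwCoeff_smul_hwVec (u : U L) : hwCoeff b lam (u • hwVec b lam) = hwFun b lam u := by
  obtain ⟨y, hy⟩ := exists_sub_emb_mem_vermaIdeal b lam u
  replace hy := vermaIdeal_le_annIdeal b lam hy
  have h1 := (smul_hwVec_eq_zero b).2 hy
  have h2 := hwFun_of_mem_annIdeal b lam hy
  rw [sub_smul, sub_eq_zero] at h1
  rw [map_sub, sub_eq_zero] at h2
  have hp : IsHwCoeff b lam (hwCoeff b lam) := by
    rw [hwCoeff, dif_pos (exists_isHwCoeff b lam)]
    exact (exists_isHwCoeff b lam).choose_spec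
  rw [h1, h2, hp.apply_emb, hwFun_emb_nMinus]

theorem hwCoeff_nMinus_smul {y : L} (hy : y ∈ nMinus b) (v : Irr b lam) :
    hwCoeff b lam (gen y • v) = 0 := by
  obtain ⟨u, rfl⟩ := exists_smul_hwVec b lam v
  rw [← mul_smul, hwCoeff_smul_hwVec, hwFun_gen_mul b lam hy]

theorem hwCoeff_cartan_smul (h : H) (v : Irr b lam) :
    hwCoeff b lam (gen (h : L) • v) = lam h * hwCoeff b lam v := by
  obtain ⟨u, rfl⟩ := exists_smul_hwVec b lam v
  rw [← mul_smul, hwCoeff_smul_hwVec, hwCoeff_smul_hwVec, hwFun_cartan_mul]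

/-- The action of `U L` on `V(λ) ⊗ F`. -/
def diagRep : U L →ₐ[ℂ] End ℂ (Irr b lam ⊗[ℂ] matElts L) :=
  (Module.endTensorEndAlgHom.comp
    (Algebra.TensorProduct.map (Algebra.lsmul ℂ ℂ (Irr b lam)) (regAct L))).comp (comul L)

theorem diagRep_gen (x : L) (t : Irr b lam ⊗[ℂ] matElts L) : diagRep b lam (gen x) t =
    (Algebra.lsmul ℂ ℂ (Irr b lam) (gen x)).rTensor (matElts L) t +
      (regAct L (gen x)).lTensor (Irr b lam) t := by
  rw [diagRep, AlgHom.comp_apply, comul_gen, map_add, LinearMap.add_apply]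
  induction t using TensorProduct.induction_on with
  | zero => simp only [map_zero]
  | tmul v f => simp [-UniversalEnvelopingAlgebra.ι_apply, Module.endTensorEndAlgHom_apply]
  | add t t' h h' => simp only [map_add] at h h' ⊢; rw [add_add_add_comm, h, h']; abel

variable {b lam} in
theorem map_smul_of_mem_homL {φ : Irr b lam →ₗ[ℂ] Irr b lam ⊗[ℂ] matElts L}
    (hφ : φ ∈ homL b lam) (u : U L) (v : Irr b lam) : φ (u • v) = diagRep b lam u (φ v) := by
  induction u using left_induction with
  | one => rw [one_smul, map_one, Module.End.one_apply]
  | gen_mul x u hu => rw [mul_smul, hφ x, ← diagRep_gen, hu, map_mul, Module.End.mul_apply]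
  | add u u' h h' => rw [add_smul, map_add, h, h', map_add, LinearMap.add_apply]
  | smul c u h => rw [smul_assoc, map_smul, h, map_smul, LinearMap.smul_apply]

/-- The `F`-valued matrix coefficient `v ⊗ f ↦ ⟨1_λ^*, a v⟩ f`. -/
def coef (a : U L) : Irr b lam ⊗[ℂ] matElts L →ₗ[ℂ] matElts L :=
  (TensorProduct.lid ℂ (matElts L)).toLinearMap ∘ₗ
    (hwCoeff b lam ∘ₗ Algebra.lsmul ℂ ℂ (Irr b lam) a).rTensor (matElts L)

theorem coef_tmul (a : U L) (v : Irr b lam) (f : matElts L) :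
    coef b lam a (v ⊗ₜ f) = hwCoeff b lam (a • v) • f := by
  simp [coef]

theorem theta_eq (φ : Irr b lam →ₗ[ℂ] Irr b lam ⊗[ℂ] matElts L) :
    theta b lam φ = coef b lam 1 (φ (hwVec b lam)) := by
  rw [theta, coef, map_one]
  rfl

theorem coef_rTensor (a c : U L) (t : Irr b lam ⊗[ℂ] matElts L) :
    coef b lam a ((Algebra.lsmul ℂ ℂ (Irr b lam) c).rTensor (matElts L) t) =
      coef b lam (a * c) t := by
  induction t using TensorProduct.induction_on with
  | zero => simp only [map_zero]
  | tmul v f => rw [LinearMap.rTensor_tmul, coef_tmul, coef_tmul, mul_smul]; rfl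
  | add t t' h h' => simp only [map_add, h, h']

theorem coef_lTensor (a : U L) (T : End ℂ (matElts L)) (t : Irr b lam ⊗[ℂ] matElts L) :
    coef b lam a (T.lTensor (Irr b lam) t) = T (coef b lam a t) := by
  induction t using TensorProduct.induction_on with
  | zero => simp only [map_zero]
  | tmul v f => rw [LinearMap.lTensor_tmul, coef_tmul, coef_tmul, T.map_smul]
  | add t t' h h' => simp only [map_add, h, h']

theorem coef_diagRep_gen (a : U L) (x : L) (t : Irr b lam ⊗[ℂ] matElts L) :
    coef b lam a (diagRep b lam (gen x) t) =
      coef b lam (a * gen x) t + regAct L (gen x) (coef b lam a t) := by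
  rw [diagRep_gen, map_add, coef_rTensor, coef_lTensor]

theorem coef_add (a c : U L) (t : Irr b lam ⊗[ℂ] matElts L) :
    coef b lam (a + c) t = coef b lam a t + coef b lam c t := by
  rw [coef, coef, coef, map_add, LinearMap.comp_add, LinearMap.rTensor_add, LinearMap.comp_add,
    LinearMap.add_apply]

theorem coef_smul (c : ℂ) (a : U L) (t : Irr b lam ⊗[ℂ] matElts L) :
    coef b lam (c • a) t = c • coef b lam a t := by
  rw [coef, coef, map_smul, LinearMap.comp_smul, LinearMap.rTensor_smul, LinearMap.comp_smul,
    LinearMap.smul_apply]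

/-- The recursion behind the inductions on `x` below. If `e` kills `t`, the coefficient at `S(e x)`
is `e` applied to the one at `S(x)`. -/
theorem coef_antipode_gen_mul (e : nPlus b) (x : U (nPlus b)) (t : Irr b lam ⊗[ℂ] matElts L) :
    coef b lam (antipode L (emb _ (gen e * x))) t =
      regAct L (gen (e : L)) (coef b lam (antipode L (emb _ x)) t) -
        coef b lam (antipode L (emb _ x)) (diagRep b lam (gen (e : L)) t) := by
  rw [map_mul, emb_gen, antipode_gen_mul, coef_diagRep_gen, sub_add_cancel_right,
    ← neg_one_smul ℂ, coef_smul]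
  exact neg_one_smul ℂ (coef b lam (antipode L (emb _ x) * gen (e : L)) t)

variable {b lam} in
-- A vector of `V(λ)` on which all the forms `v ↦ ⟨1_λ^*, S(x) v⟩` vanish is zero, by
-- `mem_annIdeal_of_nPlus`.
theorem eq_of_coef {t t' : Irr b lam ⊗[ℂ] matElts L} (h : ∀ x : U (nPlus b),
    coef b lam (antipode L (emb _ x)) t = coef b lam (antipode L (emb _ x)) t') : t = t' := by
  rw [← sub_eq_zero, ← LinearMap.id_apply (R := ℂ) (t - t'), ← LinearMap.rTensor_id]
  refine rTensor_eq_zero_of_separating (fun x : U (nPlus b) => hwCoeff b lam ∘ₗ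
    Algebra.lsmul ℂ ℂ (Irr b lam) (antipode L (emb _ x))) _ (fun v hv => ?_) fun x => ?_
  · obtain ⟨u, rfl⟩ := exists_smul_hwVec b lam v
    rw [LinearMap.id_apply, smul_hwVec_eq_zero]
    refine mem_annIdeal_of_nPlus b lam fun x => ?_
    rw [← hwCoeff_smul_hwVec, mul_smul]
    exact hv x
  · refine (TensorProduct.lid ℂ (matElts L)).map_eq_zero_iff.1 ?_
    change coef b lam _ (t - t') = 0
    rw [map_sub, h, sub_self]

/-- The map `y ⊗ f ↦ y 1_λ ⊗ f`. -/
def applyHw : U (nMinus b) ⊗[ℂ] matElts L →ₗ[ℂ] Irr b lam ⊗[ℂ] matElts L :=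
  (orbitMap b lam ∘ₗ (emb (nMinus b)).toLinearMap).rTensor (matElts L)

theorem applyHw_tmul (y : U (nMinus b)) (f : matElts L) :
    applyHw b lam (y ⊗ₜ f) = (emb _ y • hwVec b lam) ⊗ₜ f := rfl

theorem coef_applyHw (x : U (nPlus b)) (D : U (nMinus b) ⊗[ℂ] matElts L) :
    coef b lam (antipode L (emb _ x)) (applyHw b lam D) = contr b lam x _ D := by
  induction D using TensorProduct.induction_on with
  | zero => simp only [map_zero]
  | tmul y f =>
    rw [applyHw_tmul, coef_tmul, contr_tmul, ← mul_smul, hwCoeff_smul_hwVec, shapPairing_apply]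
  | add t t' h h' => simp only [map_add, h, h']

/-- Acting with `𝔫₋` on `V(λ)` never reaches the highest weight vector, so for the leading
coefficient only the action on `F` counts. -/
theorem coef_one_diagRep_emb (y : U (nMinus b)) (t : Irr b lam ⊗[ℂ] matElts L) :
    coef b lam 1 (diagRep b lam (emb _ y) t) = regAct L (emb _ y) (coef b lam 1 t) := by
  induction y using left_induction with
  | one => simp only [map_one, Module.End.one_apply]
  | gen_mul a y hy =>
    have h0 : ∀ t, coef b lam (gen (a : L)) t = 0 := by
      intro t
      induction t using TensorProduct.induction_on with
      | zero => rw [map_zero]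
      | tmul v f => rw [coef_tmul, hwCoeff_nMinus_smul b lam a.2, zero_smul]
      | add t t' h h' => rw [map_add, h, h', add_zero]
    rw [map_mul, emb_gen, map_mul, Module.End.mul_apply, coef_diagRep_gen, one_mul, h0, zero_add,
      hy, map_mul, Module.End.mul_apply]
  | add y z hy hz => simp only [map_add, LinearMap.add_apply, hy, hz]
  | smul c y hy => simp only [map_smul, LinearMap.smul_apply, hy]

/-- The conditions on `f` for the intertwining operator `φ` with `f_φ = f` to be given by
`J_red(λ)`. -/
structure IsAdmissible (f : matElts L) : Prop where
  cartan : ∀ h : H, regAct L (gen (h : L)) f = 0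
  contr : ∀ x, contr b lam x _ (fusionVec b lam f) = regAct L (emb _ x) f
  K : ∀ y ∈ K b lam, regAct L (emb _ y) f = 0

theorem isAdmissible_of_mem {f : matElts L} (hf : f ∈ F0 H (KinU b lam ⊔ KtildeInU b lam)) :
    IsAdmissible b lam f :=
  ⟨fun h => hf.1 h h.2, contr_fusionVec_of_mem le_sup_right hf, fun _ hy =>
    regAct_K le_sup_left hf hy⟩

/-- At generic `λ` weight zero suffices, since `K_λ` is zero and `K̃_λ` has no weight vectors of
weight in `Q₊`. This covers `f₁` and `f₂` at the weights approaching `λ₀`. -/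
theorem isAdmissible_of_isGeneric (hlam : IsGeneric b lam) {f : matElts L}
    (hf : ∀ h : H, regAct L (gen (h : L)) f = 0) : IsAdmissible b lam f :=
  ⟨hf, contr_fusionVec_of_isGeneric hlam (hf _), fun y hy => by
    rw [K_eq_bot_of_isGeneric b lam hlam hy, map_zero, map_zero, LinearMap.zero_apply]⟩

/-! ### Intertwiners with prescribed leading term, and the formula for the star product. -/

variable {b lam} {f : matElts L}

theorem IsAdmissible.coef_applyHw (hf : IsAdmissible b lam f) (x : U (nPlus b)) :
    coef b lam (antipode L (emb _ x))
    (applyHw b lam (fusionVec b lam f)) = regAct L (emb _ x) f := by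
  rw [EqQuant.coef_applyHw, hf.contr]

theorem IsAdmissible.coef_one (hf : IsAdmissible b lam f) :
    coef b lam 1 (applyHw b lam (fusionVec b lam f)) = f := by
  simpa [antipode_one] using hf.coef_applyHw 1

/-- An intertwining operator is given on the highest weight vector by `J_red(λ)`. -/
theorem IsAdmissible.apply_hwVec (hf : IsAdmissible b lam f)
    {φ : Irr b lam →ₗ[ℂ] Irr b lam ⊗[ℂ] matElts L}
    (hφ : φ ∈ homL b lam) (hθ : theta b lam φ = f) :
    φ (hwVec b lam) = applyHw b lam (fusionVec b lam f) := by
  refine eq_of_coef fun x => ?_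
  rw [hf.coef_applyHw]
  induction x using left_induction with
  | one => simp only [map_one, antipode_one, Module.End.one_apply, ← theta_eq, hθ]
  | gen_mul e x hx =>
    rw [coef_antipode_gen_mul, ← map_smul_of_mem_homL hφ, gen_nPlus_smul_hwVec b lam e.2, map_zero,
      map_zero, sub_zero, hx, map_mul, emb_gen, map_mul, Module.End.mul_apply]
  | add x y hx hy => simp only [map_add, coef_add, LinearMap.add_apply, hx, hy]
  | smul c x hx => simp only [map_smul, coef_smul, LinearMap.smul_apply, hx]

/-- Both coefficients in the recursion are already known, namely `e x f` at `S(e x)` and `x f` at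
`S(x)`; they cancel, leaving the coefficients of the vector acted on by `e`. -/
theorem IsAdmissible.diagRep_nPlus (hf : IsAdmissible b lam f) {e : L} (he : e ∈ nPlus b) :
    diagRep b lam (gen e) (applyHw b lam (fusionVec b lam f)) = 0 := by
  refine eq_of_coef fun x => ?_
  have h := coef_antipode_gen_mul b lam ⟨e, he⟩ x (applyHw b lam (fusionVec b lam f))
  rw [hf.coef_applyHw, hf.coef_applyHw, map_mul, emb_gen, map_mul, Module.End.mul_apply,
    eq_sub_iff_add_eq, add_eq_left] at h
  rw [h, map_zero]

theorem IsAdmissible.diagRep_cartan (hf : IsAdmissible b lam f) (h : H) :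
    diagRep b lam (gen (h : L)) (applyHw b lam (fusionVec b lam f)) =
      lam h • applyHw b lam (fusionVec b lam f) := by
  have hh : ∀ a t, coef b lam (gen (h : L) * a) t = lam h • coef b lam a t := by
    intro a t
    induction t using TensorProduct.induction_on with
    | zero => simp
    | tmul v f => rw [coef_tmul, coef_tmul, mul_smul, hwCoeff_cartan_smul, mul_smul]
    | add t t' h h' => rw [map_add, h, h', map_add, smul_add]
  refine eq_of_coef fun x => ?_
  rw [map_smul, coef_diagRep_gen]
  induction x using nPlus_induction with
  | one =>
    rw [map_one, antipode_one, one_mul, hf.coef_one, hf.cartan, add_zero,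
      ← mul_one (gen (h : L)), hh, hf.coef_one]
  | wt γ hγ x hx =>
    have h1 := congrArg (antipode L) (cartan_mul_emb hx h)
    rw [antipode_gen_mul, map_add, antipode_mul, antipode_gen, map_smul, neg_mul,
      neg_add_eq_sub, neg_eq_iff_eq_neg, neg_sub, sub_eq_add_neg, ← neg_smul] at h1
    rw [h1, coef_add, coef_smul, hh, hf.coef_applyHw, regAct_cartan_emb hx (hf.cartan h), add_assoc,
      ← add_smul, neg_add_cancel, zero_smul, add_zero]
  | add x y hx hy =>
    simp only [map_add, add_mul, coef_add, smul_add, ← hx, ← hy]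
    abel
  | smul c x hx =>
    simp only [map_smul, smul_mul_assoc, coef_smul, smul_comm (lam h) c, ← hx, smul_add]

theorem IsAdmissible.diagRep_vermaIdeal (hf : IsAdmissible b lam f) {u : U L} (hu : u ∈ vermaIdeal b lam) :
    diagRep b lam u (applyHw b lam (fusionVec b lam f)) = 0 := by
  induction hu using Submodule.span_induction with
  | mem u hu =>
    rcases hu with ⟨e, he, rfl⟩ | ⟨h, rfl⟩
    · exact hf.diagRep_nPlus he
    · rw [map_sub, LinearMap.sub_apply, hf.diagRep_cartan, AlgHom.commutes,
        Module.algebraMap_end_apply, sub_self]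
  | zero => rw [map_zero, LinearMap.zero_apply]
  | add u v _ _ hu hv => rw [map_add, LinearMap.add_apply, hu, hv, add_zero]
  | smul a u _ hu => rw [smul_eq_mul, map_mul, Module.End.mul_apply, hu, map_zero]

/-- Modulo `vermaIdeal`, `u` is some `y ∈ K_λ`, and the leading coefficient of `y` acting is `y f =
0`. The other coefficients follow by the recursion, because `e u` is again in the ideal; hence the
induction over all `u` at once. -/
theorem IsAdmissible.diagRep_annIdeal (hf : IsAdmissible b lam f) {u : U L} (hu : u ∈ annIdeal b lam) :
    diagRep b lam u (applyHw b lam (fusionVec b lam f)) = 0 := by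
  refine eq_of_coef fun x => ?_
  rw [map_zero]
  induction x using left_induction generalizing u with
  | one =>
    obtain ⟨y, hy⟩ := exists_sub_emb_mem_vermaIdeal b lam u
    have h1 := hf.diagRep_vermaIdeal hy
    rw [map_sub, LinearMap.sub_apply, sub_eq_zero] at h1
    have h2 := sub_mem hu (vermaIdeal_le_annIdeal b lam hy)
    rw [sub_sub_cancel] at h2
    rw [map_one, antipode_one, h1, coef_one_diagRep_emb, hf.coef_one, hf.K y (mem_K_iff.2 h2)]
  | gen_mul e x hx =>
    rw [coef_antipode_gen_mul, hx hu, map_zero, ← Module.End.mul_apply, ← map_mul,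
      hx (u := gen (e : L) * u) ((annIdeal b lam).smul_mem (gen (e : L)) hu), sub_zero]
  | add x y hx hy => rw [map_add, map_add, coef_add, hx hu, hy hu, add_zero]
  | smul c x hx => rw [map_smul, map_smul, coef_smul, hx hu, smul_zero]

theorem IsAdmissible.exists_mem_homL (hf : IsAdmissible b lam f) :
    ∃ φ ∈ homL b lam, theta b lam φ = f := by
  obtain ⟨φ, hφ⟩ := exists_factor (orbitMap_surjective b lam)
    ((diagRep b lam).toLinearMap.flip (applyHw b lam (fusionVec b lam f)))
    fun u hu => hf.diagRep_annIdeal ((smul_hwVec_eq_zero b).1 hu)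
  simp only [orbitMap_apply, LinearMap.flip_apply, AlgHom.toLinearMap_apply] at hφ
  refine ⟨φ, fun x v => ?_, ?_⟩
  · obtain ⟨u, rfl⟩ := exists_smul_hwVec b lam v
    rw [← mul_smul, hφ, hφ, map_mul, Module.End.mul_apply, diagRep_gen]
  · rw [theta_eq, ← one_smul (U L) (hwVec b lam), hφ, map_one, Module.End.one_apply, hf.coef_one]

theorem coef_assoc (t : Irr b lam ⊗[ℂ] matElts L) (g : matElts L) :
    TensorProduct.lid ℂ (matElts L) ((hwCoeff b lam).rTensor (matElts L)
      ((mulF L).lTensor (Irr b lam) (TensorProduct.assoc ℂ (Irr b lam) (matElts L) (matElts L)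
        (t ⊗ₜ g)))) = mulF L (coef b lam 1 t ⊗ₜ g) := by
  induction t using TensorProduct.induction_on with
  | zero => simp
  | tmul v f =>
    rw [coef_tmul, one_smul, TensorProduct.assoc_tmul, LinearMap.lTensor_tmul,
      LinearMap.rTensor_tmul, TensorProduct.lid_tmul, ← TensorProduct.smul_tmul', map_smul]
  | add t t' h h' => simp only [TensorProduct.add_tmul, map_add, h, h']

/-- Write `ψ(1_λ) = ∑ y 1_λ ⊗ g`. The leading coefficient of `φ(y 1_λ) = y φ(1_λ)` is `y f_φ`, and
the sum of the `y f_φ ⊗ g` is `J_red(λ)(f_φ ⊗ f)`. -/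
theorem IsAdmissible.theta_homMul (hf : IsAdmissible b lam f)
    {φ ψ : Irr b lam →ₗ[ℂ] Irr b lam ⊗[ℂ] matElts L}
    (hφ : φ ∈ homL b lam) (hψ : ψ ∈ homL b lam) (hθ : theta b lam ψ = f) :
    theta b lam (homMul b lam φ ψ) =
      mulF L (fusion b lam (regMinus b) (theta b lam φ ⊗ₜ f)) := by
  rw [fusion_tmul b lam (hf.cartan _), theta, homMul]
  simp only [LinearMap.comp_apply, LinearEquiv.coe_coe]
  rw [hf.apply_hwVec hψ hθ]
  induction fusionVec b lam f using TensorProduct.induction_on with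
  | zero => simp only [map_zero]
  | tmul y g =>
    rw [applyHw_tmul, LinearMap.rTensor_tmul, coef_assoc, map_smul_of_mem_homL hφ,
      coef_one_diagRep_emb, ← theta_eq]
    rfl
  | add t t' h h' => simp only [map_add, h, h']

/-- `IsAdmissible.theta_homMul` holds for any intertwiners with the given leading terms, so it does
not matter which preimages `Function.invFunOn` picks. -/
theorem IsAdmissible.star_eq (hf : IsAdmissible b lam f) {f₁ : matElts L} (hf₁ : IsAdmissible b lam f₁) :
    star b lam f₁ f = mulF L (fusion b lam (regMinus b) (f₁ ⊗ₜ f)) := by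
  rw [star, hf.theta_homMul (Function.invFunOn_mem hf₁.exists_mem_homL)
    (Function.invFunOn_mem hf.exists_mem_homL) (Function.invFunOn_eq hf.exists_mem_homL),
    Function.invFunOn_eq hf₁.exists_mem_homL]

end Intertwiners

end EqQuant

end

theorem mainTheorem6 {L : Type u} [LieRing L] [LieAlgebra ℂ L] [FiniteDimensional ℂ L]
    [LieAlgebra.IsSemisimple ℂ L] (H : LieSubalgebra ℂ L) [H.IsCartanSubalgebra]
    (b : (LieAlgebra.IsKilling.rootSystem H).Base) (lam₀ : Module.Dual ℂ H)
    (hreg : EqQuant.GoodRegularity b lam₀) :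
    (∀ f ∈ EqQuant.F0 H (EqQuant.KinU b lam₀), ∀ g ∈ EqQuant.F0 H (EqQuant.KtildeInU b lam₀),
      EqQuant.ConvergesTo (EqQuant.genericNhds b lam₀)
        (fun lam => EqQuant.fusion b lam (EqQuant.regMinus b) (f ⊗ₜ[ℂ] g))
        (EqQuant.fusion b lam₀ (EqQuant.regMinus b) (f ⊗ₜ[ℂ] g))) ∧
    (∀ f₁ ∈ EqQuant.F0 H (EqQuant.KinU b lam₀ ⊔ EqQuant.KtildeInU b lam₀),
      ∀ f₂ ∈ EqQuant.F0 H (EqQuant.KinU b lam₀ ⊔ EqQuant.KtildeInU b lam₀),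
      EqQuant.ConvergesTo (EqQuant.genericNhds b lam₀)
        (fun lam => EqQuant.star b lam f₁ f₂)
        (EqQuant.star b lam₀ f₁ f₂)) := by
  refine ⟨fun f hf g hg => EqQuant.convergesTo_fusion hreg le_rfl hf hg,
    fun f₁ hf₁ f₂ hf₂ => ?_⟩
  rw [(EqQuant.isAdmissible_of_mem b lam₀ hf₂).star_eq (EqQuant.isAdmissible_of_mem b lam₀ hf₁)]
  have h := EqQuant.convergesTo_fusion hreg le_sup_left hf₁
    (g := f₂) ⟨hf₂.1, fun a ha => hf₂.2 a (Submodule.mem_sup_right ha)⟩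
  refine (h.map (EqQuant.mulF L)).congr ?_
  -- The formula for the star product is needed only at generic `λ`, where weight zero of `f₁` and
  -- `f₂` is enough.
  filter_upwards [EqQuant.eventually_isGeneric b lam₀] with lam hlam
  exact ((EqQuant.isAdmissible_of_isGeneric b lam hlam fun h => hf₂.1 h h.2).star_eq
    (EqQuant.isAdmissible_of_isGeneric b lam hlam fun h => hf₁.1 h h.2)).symm
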